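/- **Setting.** Let $X$ be a smooth ($C^\infty$, Hausdorff, second countable, without boundary) manifold of dimension $d$ with a Lebesgue measure $\mathrm{Leb}$ (a measure with smooth positive density in charts, e.g. the volume of a Riemannian metric), and let $X_0\subset X$ be compact with $\mathrm{Leb}(X_0)>0$. Let $T:X_0\to X_0$ be measurable and nonsingular ($\mathrm{Leb}(T^{-1}A)=0$ whenever $A\subset X_0$ and $\mathrm{Leb}(A)=0$), and let $\mathcal L$ be its transfer operator on $L_1(X_0,\mathrm{Leb})$, defined by $\int_{X_0}\mathcal L f\cdot g\,d\mathrm{Leb}=\int_{X_0}f\cdot g\circ T\,d\mathrm{Leb}$ for bounded measurable $g$. For $\alpha>0$, $C^\alpha(X)$ is the space of complex functions of class $C^{k}$, $k=\lfloor\alpha\rfloor$, whose derivatives of order $k$ in charts are locally Hölder of exponent $\alpha-k$; $\|f\|_{C^\alpha}$ is the corresponding norm computed on a fixed finite family of compact subsets of charts whose interiors cover $X_0$. A distribution supported on $X_0$ is a continuous functional $g\mapsto\langle u,g\,d\mathrm{Leb}\rangle$ on $C^\infty(X)$ vanishing on the functions $g$ that are zero near $X_0$; an integrable function $f$ on $X_0$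 is identified with the distribution $g\mapsto\int_{X_0}fg\,d\mathrm{Leb}$. **Theorem.** Let $H$ be a complex Banach space of distributions supported on $X_0$ (continuously included in the space of distributions), and let $\alpha>0$. Assume: 1. There is $C>0$ such that, for any $u\in H$ and $f\in C^\alpha(X)$, $fu\in H$ and $\|fu\|_H\le C\|f\|_{C^\alpha}\|u\|_H$. (The product is the usual one for $u\in H\cap L_\infty(\mathrm{Leb})$ and is extended to $H$ by continuity, using 2.) 2. $H\cap L_\infty(\mathrm{Leb})$ is dense in $H$. 3. $\mathcal L$ maps $H\cap L_\infty(\mathrm{Leb})$ into itself, continuously for the norm of $H$, and the essential spectral radius of its continuous extension to $H$ is $<1$. (The essential spectral radius is the smallest $r\ge0$ such that the spectrum outside $\{|z|\le r\}$ consists of isolated eigenvalues of finite algebraic multiplicity.) 4. There are $f_0\in H\cap L_\infty(\mathrm{Leb})$ with values in $[0,1]$ and an integer $N_0>0$ such that, for any $\phi\in L_\infty(\mathrm{Leb})$, $f_0=1$ at almost every point where $\mathcal L^{N_0}\phi\ne0$. 5. For any $u\in H$ which is the limit in $H$ of nonnegative functions $u_n\in H\cap L_\infty(\mathrm{Leb})$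 and for which there is a finite positive measure $\mu_u$ on $X_0$ with $\langle u,g\,d\mathrm{Leb}\rangle=\int g\,d\mu_u$ for all $g\in C^\infty(X)$, the measure $\mu_u$ gives zero mass to the set of discontinuity points of $T$. Then there exist finitely many $T$-invariant ergodic probability measures $\mu_1,\dots,\mu_l$ on $X_0$ and pairwise disjoint measurable sets $A_1,\dots,A_l\subset X_0$ such that $\mu_i(A_i)=1$, $\mathrm{Leb}(A_i)>0$, $\mathrm{Leb}(X_0\setminus\bigcup_iA_i)=0$ and, for every $x\in A_i$ and every $f$ in the closure of $C^0(X_0)\cap H$ in $C^0(X_0)$, $$\frac1n\sum_{j=0}^{n-1}f(T^jx)\longrightarrow\int f\,d\mu_i .$$ Moreover, for every $i$ there exist an integer $k_i\ge1$ and a decomposition $\mu_i=\sum_{j\in\mathbb Z/k_i\mathbb Z}\mu_{i,j}$ into positive measures such that $T_*\mu_{i,j}=\mu_{i,j+1}$ for all $j\in\mathbb Z/k_i\mathbb Z$, and each $\nu=k_i\mu_{i,j}$ is a probability measure which is exponentially mixing for $T^{k_i}$ and $C^\alpha$ test functions: there are $C$ and $\delta\in(0,1)$ with $$\Big|\int f\cdot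 g\circ T^{k_in}\,d\nu-\int f\,d\nu\int g\,d\nu\Big|\le C\,\|f\|_{C^\alpha}\|g\|_{C^\alpha}\,\delta^n\qquad(f,g\in C^\alpha(X),\ n\ge0).$$ -/

import Mathlib

open MeasureTheory Filter Set
open scoped Topology ENNReal Manifold ContDiff

noncomputable section

namespace PhysicalMeasures

/-! ### Essential spectral radius of a bounded operator -/

section Spectral

variable {H : Type*} [NormedAddCommGroup H] [NormedSpace ℂ H]

/-- `z` is either in the resolvent set of `A` or an isolated point of the spectrum which is an
eigenvalue of finite algebraic multiplicity: `H` is a direct sum of closed `A`-invariant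
subspaces `F` and `G`, where `F` is finite dimensional and `A - z` is nilpotent on `F` and
bijective on `G`. -/
def IsRegularOrDiscreteEigenvalue (A : H →L[ℂ] H) (z : ℂ) : Prop :=
  ∃ F G : Submodule ℂ H, IsCompl F G ∧ FiniteDimensional ℂ F ∧ IsClosed (G : Set H) ∧
    MapsTo A F F ∧ MapsTo A G G ∧
    (∃ n : ℕ, ∀ x ∈ F, ((A - z • ContinuousLinearMap.id ℂ H) ^ n) x = 0) ∧
    BijOn (A - z • ContinuousLinearMap.id ℂ H) (G : Set H) (G : Set H)

/-- The essential spectral radius: the supremum of `|z|` over the points `z` of the spectrum of `A`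
that are not isolated eigenvalues of finite algebraic multiplicity, that is, the smallest `r` such
that outside the closed disc of radius `r` the spectrum consists of isolated eigenvalues of finite
algebraic multiplicity. -/
def essentialSpectralRadius (A : H →L[ℂ] H) : ℝ≥0∞ :=
  ⨆ (z : ℂ) (_ : ¬ IsRegularOrDiscreteEigenvalue A z), (‖z‖₊ : ℝ≥0∞)

end Spectral

/-! ### The transfer operator -/

section Transfer

variable {Y : Type*} [MeasurableSpace Y]

/-- The transfer operator of `T` with respect to `ν`: `transfer T ν f` is the density with respect
to `ν` of the push-forward under `T` of the complex measure `f dν`. -/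
def transfer (T : Y → Y) (ν : Measure Y) (f : Y → ℂ) : Y → ℂ :=
  ComplexMeasure.rnDeriv ((ν.withDensityᵥ f).map T) ν

/-- The transfer operator is characterised by duality: `∫ (L f) g dν = ∫ f (g ∘ T) dν`, here for
indicator functions `g`. -/
theorem setIntegral_transfer {T : Y → Y} {ν : Measure Y} [SigmaFinite ν]
    (hT : Measure.QuasiMeasurePreserving T ν ν) {f : Y → ℂ} (hf : Integrable f ν)
    {s : Set Y} (hs : MeasurableSet s) :
    ∫ x in s, transfer T ν f x ∂ν = ∫ x in T ⁻¹' s, f x ∂ν := by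
  set c : ComplexMeasure Y := (ν.withDensityᵥ f).map T with hc
  have hcs : ∀ t, MeasurableSet t → c t = ∫ x in T ⁻¹' t, f x ∂ν := fun t ht => by
    rw [hc, VectorMeasure.map_apply _ hT.measurable ht, withDensityᵥ_apply hf (hT.measurable ht)]
  have h0 : ∀ t, MeasurableSet t → ν.toENNRealVectorMeasure t = 0 → c t = 0 := by
    intro t hm ht
    rw [Measure.toENNRealVectorMeasure_apply_measurable hm] at ht
    rw [hcs t hm, Measure.restrict_eq_zero.2 (hT.preimage_null ht), integral_zero_measure]
  have hre : ν.withDensityᵥ ((ComplexMeasure.re c).rnDeriv ν) = ComplexMeasure.re c :=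
    SignedMeasure.withDensityᵥ_rnDeriv_eq _ _ <|
      VectorMeasure.AbsolutelyContinuous.mk fun t hm ht => by
        change (c t).re = 0
        rw [h0 t hm ht, Complex.zero_re]
  have him : ν.withDensityᵥ ((ComplexMeasure.im c).rnDeriv ν) = ComplexMeasure.im c :=
    SignedMeasure.withDensityᵥ_rnDeriv_eq _ _ <|
      VectorMeasure.AbsolutelyContinuous.mk fun t hm ht => by
        change (c t).im = 0
        rw [h0 t hm ht, Complex.zero_im]
  rw [← hcs s hs]
  have hi : Integrable (transfer T ν f) ν := ComplexMeasure.integrable_rnDeriv _ _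
  have e1 : (∫ x in s, (transfer T ν f x).re ∂ν) = (c s).re := by
    have := congrArg (fun m => m s) hre
    rwa [withDensityᵥ_apply (SignedMeasure.integrable_rnDeriv _ _) hs] at this
  have e2 : (∫ x in s, (transfer T ν f x).im ∂ν) = (c s).im := by
    have := congrArg (fun m => m s) him
    rwa [withDensityᵥ_apply (SignedMeasure.integrable_rnDeriv _ _) hs] at this
  apply Complex.ext
  · rw [← e1]
    exact (integral_re hi.integrableOn).symm
  · rw [← e2]
    exact (integral_im hi.integrableOn).symm

end Transfer

/-! ### Lebesgue measure, `C^α` functions and distributions on a manifold -/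

variable {d : ℕ} {X : Type*} [TopologicalSpace X] [ChartedSpace (EuclideanSpace ℝ (Fin d)) X]

/-- `Leb` is a smooth Lebesgue measure on `X` (the volume measure of a smooth Riemannian metric):
in every chart it has a smooth positive density with respect to Lebesgue measure. -/
def IsSmoothMeasure (d : ℕ) {X : Type*} [TopologicalSpace X]
    [ChartedSpace (EuclideanSpace ℝ (Fin d)) X] [MeasurableSpace X] (Leb : Measure X) : Prop :=
  ∀ e ∈ atlas (EuclideanSpace ℝ (Fin d)) X, ∃ ρ : EuclideanSpace ℝ (Fin d) → ℝ,
    ContDiffOn ℝ ∞ ρ e.target ∧ (∀ y ∈ e.target, 0 < ρ y) ∧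
    ∀ s ⊆ e.target, MeasurableSet s → Leb (e.symm '' s) = ∫⁻ y in s, ENNReal.ofReal (ρ y)

/-- The expression of a function in the chart at the point `c`. -/
def inChart (d : ℕ) {X F : Type*} [TopologicalSpace X]
    [ChartedSpace (EuclideanSpace ℝ (Fin d)) X] (f : X → F) (c : X) :
    EuclideanSpace ℝ (Fin d) → F :=
  f ∘ (chartAt (EuclideanSpace ℝ (Fin d)) c).symm

/-- Finitely many compact pieces of charts whose interiors cover `X₀`; such data are used to define
a norm of `C^α` functions near `X₀`. -/
structure ChartCover (d : ℕ) {X : Type*} [TopologicalSpace X]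
    [ChartedSpace (EuclideanSpace ℝ (Fin d)) X] (X₀ : Set X) where
  centers : Finset X
  piece : X → Set (EuclideanSpace ℝ (Fin d))
  isCompact_piece : ∀ c ∈ centers, IsCompact (piece c)
  piece_subset : ∀ c ∈ centers, piece c ⊆ (chartAt (EuclideanSpace ℝ (Fin d)) c).target
  covers : ∀ p ∈ X₀, ∃ c ∈ centers, p ∈ (chartAt (EuclideanSpace ℝ (Fin d)) c).source ∧
    chartAt (EuclideanSpace ℝ (Fin d)) c p ∈ interior (piece c)

section Holder

variable {F : Type*} [NormedAddCommGroup F] [NormedSpace ℝ F]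

/-- `f` is of class `C^α` on `X`: with `k = ⌊α⌋`, it is of class `C^k` and its derivatives of order
`k` in charts are locally Hölder continuous of exponent `α - k`. -/
def IsCAlpha (d : ℕ) {X : Type*} [TopologicalSpace X]
    [ChartedSpace (EuclideanSpace ℝ (Fin d)) X] (α : ℝ) (f : X → F) : Prop :=
  ContMDiff 𝓘(ℝ, EuclideanSpace ℝ (Fin d)) 𝓘(ℝ, F) (⌊α⌋₊ : ℕ) f ∧
  ∀ c : X, ∀ K ⊆ (chartAt (EuclideanSpace ℝ (Fin d)) c).target, IsCompact K →
    ∃ M : ℝ, ∀ y ∈ K, ∀ z ∈ K,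
      ‖iteratedFDeriv ℝ ⌊α⌋₊ (inChart d f c) y - iteratedFDeriv ℝ ⌊α⌋₊ (inChart d f c) z‖ ≤
        M * ‖y - z‖ ^ (α - ⌊α⌋₊)

/-- The inequality `‖f‖_{C^α} ≤ M`, where the norm is the maximum, over the pieces of the cover,
of the suprema of the derivatives of order at most `k = ⌊α⌋` and of the Hölder constant of exponent
`α - k` of the derivative of order `k`. -/
def ChartCover.CAlphaNormLE {X₀ : Set X} (𝒦 : ChartCover d X₀) (α : ℝ) (f : X → F) (M : ℝ) :
    Prop :=
  0 ≤ M ∧ ∀ c ∈ 𝒦.centers,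
    (∀ j ≤ ⌊α⌋₊, ∀ y ∈ 𝒦.piece c, ‖iteratedFDeriv ℝ j (inChart d f c) y‖ ≤ M) ∧
    ∀ y ∈ 𝒦.piece c, ∀ z ∈ 𝒦.piece c,
      ‖iteratedFDeriv ℝ ⌊α⌋₊ (inChart d f c) y - iteratedFDeriv ℝ ⌊α⌋₊ (inChart d f c) z‖ ≤
        M * ‖y - z‖ ^ (α - ⌊α⌋₊)

end Holder

/-- Real-valued smooth functions on `X`. A complex linear functional on complex smooth functions is
the same thing as a real linear map from real smooth functions to `ℂ`. -/
abbrev SmoothFun (d : ℕ) (X : Type*) [TopologicalSpace X]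
    [ChartedSpace (EuclideanSpace ℝ (Fin d)) X] : Type _ :=
  C^∞⟮𝓘(ℝ, EuclideanSpace ℝ (Fin d)), X; 𝓘(ℝ, ℝ), ℝ⟯

/-- `u` is a distribution supported on the compact set `X₀` (with `u g` standing for
`⟨u, g dLeb⟩`): it is continuous for the `C^∞` topology, that is, bounded by a `C^m` norm on a
compact set, and it vanishes on the functions that are zero in a neighbourhood of `X₀`. -/
def IsDistributionOn (X₀ : Set X) (u : SmoothFun d X →ₗ[ℝ] ℂ) : Prop :=
  (∃ (𝒦 : ChartCover d X₀) (m : ℕ) (C : ℝ), ∀ (g : SmoothFun d X) (M : ℝ),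
    𝒦.CAlphaNormLE m g M → ‖u g‖ ≤ C * M) ∧
  ∀ g : SmoothFun d X, (∀ᶠ x in 𝓝ˢ X₀, g x = 0) → u g = 0

/-- A structure of Banach space of (complex) distributions supported on `X₀` on the Banach space
`H`: a continuous linear injection of `H` into the space of distributions supported on `X₀`. The
complex number `pairing u g` is `⟨u, g dLeb⟩`. -/
structure DistributionSpace (d : ℕ) {X : Type*} [TopologicalSpace X]
    [ChartedSpace (EuclideanSpace ℝ (Fin d)) X] (X₀ : Set X)
    (H : Type*) [NormedAddCommGroup H] [NormedSpace ℂ H] where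
  pairing : H →ₗ[ℂ] (SmoothFun d X →ₗ[ℝ] ℂ)
  injective : Function.Injective pairing
  isDistribution : ∀ u, IsDistributionOn X₀ (pairing u)
  continuous_pairing : ∀ g, Continuous fun u => pairing u g

namespace DistributionSpace

variable [MeasurableSpace X] {X₀ : Set X} {H : Type*} [NormedAddCommGroup H] [NormedSpace ℂ H]

/-- The distribution `u ∈ H` is the function `φ` on `X₀`. -/
def IsFun (D : DistributionSpace d X₀ H) (ν : Measure X₀) (u : H) (φ : X₀ → ℂ) : Prop :=
  ∀ g : SmoothFun d X, D.pairing u g = ∫ x, φ x * (g x : ℂ) ∂ν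

/-- The distribution `u ∈ H` is the bounded function `φ` on `X₀`; thus `u ∈ H ∩ L_∞`. -/
def IsBddFun (D : DistributionSpace d X₀ H) (ν : Measure X₀) (u : H) (φ : X₀ → ℂ) : Prop :=
  MemLp φ ∞ ν ∧ D.IsFun ν u φ

/-- Multiplication by `C^α` functions acts on `H`, with `‖f u‖ ≤ C ‖f‖_{C^α} ‖u‖`. The product
`f u` is the usual one for `u ∈ H ∩ L_∞`, and it is extended by continuity to `H`. -/
def CAlphaMultipliers (D : DistributionSpace d X₀ H) (ν : Measure X₀) (𝒦 : ChartCover d X₀)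
    (α : ℝ) : Prop :=
  ∃ C : ℝ, 0 < C ∧ ∀ f : X → ℂ, IsCAlpha d α f → ∃ mul : H →L[ℂ] H,
    (∀ (u : H) (φ : X₀ → ℂ), D.IsBddFun ν u φ → D.IsBddFun ν (mul u) fun x => f x * φ x) ∧
    ∀ M : ℝ, 𝒦.CAlphaNormLE α f M → ∀ u : H, ‖mul u‖ ≤ C * M * ‖u‖

/-- `𝓛` is the continuous extension to `H` of the transfer operator of `T` on `H ∩ L_∞`. -/
def IsTransferExtension (D : DistributionSpace d X₀ H) (ν : Measure X₀) (T : X₀ → X₀)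
    (𝓛 : H →L[ℂ] H) : Prop :=
  ∀ (u : H) (φ : X₀ → ℂ), D.IsBddFun ν u φ → D.IsBddFun ν (𝓛 u) (transfer T ν φ)

/-- If a limit in `H` of nonnegative elements of `H ∩ L_∞` is a measure, then this measure gives
zero mass to the discontinuity set of `T`. -/
def NoMassOnDiscontinuities (D : DistributionSpace d X₀ H) (ν : Measure X₀) (T : X₀ → X₀) :
    Prop :=
  ∀ (u : H) (v : ℕ → H) (φ : ℕ → X₀ → ℝ), (∀ n x, 0 ≤ φ n x) →
    (∀ n, D.IsBddFun ν (v n) fun x => (φ n x : ℂ)) → Tendsto v atTop (𝓝 u) →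
    ∀ m : Measure X₀, IsFiniteMeasure m →
      (∀ g : SmoothFun d X, D.pairing u g = ((∫ x, g x ∂m : ℝ) : ℂ)) →
      m {x | ¬ ContinuousAt T x} = 0

end DistributionSpace

/-- Exponential mixing of the measure `m` for the map `S` and `C^α` test functions. -/
def ExponentiallyMixing [MeasurableSpace X] {X₀ : Set X} (𝒦 : ChartCover d X₀) (α : ℝ)
    (S : X₀ → X₀) (m : Measure X₀) : Prop :=
  ∃ C δ : ℝ, 0 < δ ∧ δ < 1 ∧ ∀ f g : X → ℂ, IsCAlpha d α f → IsCAlpha d α g →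
    ∀ M N : ℝ, 𝒦.CAlphaNormLE α f M → 𝒦.CAlphaNormLE α g N → ∀ n : ℕ,
      ‖∫ x : X₀, f x * g (S^[n] x) ∂m - (∫ x : X₀, f x ∂m) * ∫ x : X₀, g x ∂m‖ ≤
        C * M * N * δ ^ n

end PhysicalMeasures

end

/-!
The theorem rests on two facts: on the range of the spectral projection of `𝓛` for the eigenvalues
of modulus one everything is finite-dimensional, and elements of `H` that are limits of nonnegative
functions are measures, on which `𝓛` acts by push-forward under `T`.

**The peripheral projection.** Since the essential spectral radius is `< 1`, the space `H` splits
into a finite-dimensional invariant part and a part where `𝓛` is an exponential contraction. The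
orbit of a bounded function `φ` is bounded in the weak sense `|⟨𝓛 ^ n φ, g⟩| ≤ ‖g‖_∞ ‖φ‖_{L¹}`, and in
finite dimension a weak bound is a bound, so `𝓛` is power bounded. An idempotent limit of powers of
`𝓛` on the finite-dimensional part gives a finite-rank projection `P` commuting with `𝓛`, with
`𝓛 ^ n (1 - P)` exponentially small and `𝓛 ^ φ j` converging to the identity on the range of `P`
along suitable times `φ j` (`exists_isPeripheralProjection`). No description of the peripheral
eigenvalues is needed.

**Measures.** By the Riesz–Markov–Kakutani theorem the elements of the closed cone generated by the
nonnegative bounded functions are measures (`exists_represents`). As these do not charge the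
discontinuities of `T`, the identity `⟨𝓛 u, g⟩ = ⟨u, g ∘ T⟩` passes to limits and `𝓛` acts on them by
push-forward (`represents_map`). The function `f₀` dominates the image of `𝓛 ^ N₀`, so the range of `P`
is spanned by projections of functions between `0` and multiples of `f₀`; averaging the orbit of
`P f₀` gives a fixed point which is an invariant measure `μ` dominating the whole range of `P`
(`exists_isPeripheralSystem`).

**Rigid sets.** Elements of the cone in the range of `P` are measures with a bounded density with
respect to `μ`. Since `𝓛 ^ φ j` is close to the identity there, the superlevel sets `B` of these
densities are rigid: `μ (T^{-φ j} B Δ B) → 0`. Conversely the restriction of `μ` to a rigid set is in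
the range of `P`. By finiteness of the dimension the family of rigid sets has finitely many atoms
modulo `μ`, the normalized restrictions of `μ` to the atoms form a basis of the range of `P`, and `T`
permutes them. Projecting the product of a basis measure with a function gives a multiple of the
same basis measure, which is the exponential decay of correlations for the power of `T` fixing the
atom (`exists_isAtomBasis`, `exists_isMixingBasis`, `norm_correlation_le`).

**Basins.** Averaging over the period of the permutation gives a projection `Q` with
`∑_{n < L} 𝓛 ^ n = L Q + O(1)` and range spanned by the ergodic averages `μ_i` of the basis measures
along the cycles (`exists_isErgodicBasis`). For any measure of the cone, including bounded densities
with respect to the reference measure, the second moment of the Birkhoff sums of a test function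
over `L` consecutive times is `β L ^ 2 + O(L)` with `β` explicit, which implies almost sure
convergence of the averages and gives the second moment of the limit (`exists_average_limit`).
Applied to test functions dual to the `μ_i`, this shows that the limits are indicator functions of
disjoint sets, the basins of the `μ_i` (`measure_basin`); the basins have positive reference measure
because `μ_i` is approximated in `H` by bounded functions, and they cover almost everything because
`𝓛 ^ N₀ 1` is supported where `f₀ = 1`.
-/

set_option linter.unusedSectionVars false

namespace PhysicalMeasures

/-! ### Quasi-compact operators -/

section QuasiCompact

variable {H : Type*} [NormedAddCommGroup H] [NormedSpace ℂ H]

/-- `P` is a finite-rank spectral projection of `A` such that the complementary part `A (1 - P)` has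
no spectrum in `S`: `P` commutes with the whole commutant of `A` and, for `z` in `S`, the operator
`A - z` has an inverse `B` on the range of `1 - P`. -/
structure IsSpectralProjection (A P : H →L[ℂ] H) (S : Set ℂ) : Prop where
  idem : P * P = P
  comm : ∀ U : H →L[ℂ] H, U * A = A * U → U * P = P * U
  finite : FiniteDimensional ℂ P.range
  inv : ∀ z ∈ S, ∃ B : H →L[ℂ] H, (A - z • 1) * B = 1 - P ∧ B * (A - z • 1) = 1 - P

variable [CompleteSpace H]

/-- The decomposition of the space at a regular point or a discrete eigenvalue `z`, in terms of
operators: the projection `P` on the finite-dimensional part along the complementary part, and the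
inverse `B` of `A - z` on the complementary part, extended by zero. Closedness of the two parts
makes `P` continuous, and the open mapping theorem makes `B` continuous. -/
theorem IsRegularOrDiscreteEigenvalue.exists_projection {A : H →L[ℂ] H} {z : ℂ}
    (h : IsRegularOrDiscreteEigenvalue A z) : ∃ P B : H →L[ℂ] H, ∃ n : ℕ, P * P = P ∧
      FiniteDimensional ℂ P.range ∧ A * P = P * A ∧ (A - z • 1) * B = 1 - P ∧
      B * (A - z • 1) = 1 - P ∧ B * P = 0 ∧ P * B = 0 ∧ (A - z • 1) ^ n * P = 0 := by
  obtain ⟨F, G, hc, hF, hG, hAF, hAG, ⟨n, hn⟩, hbij⟩ := h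
  have hFc : IsClosed (F : Set H) := F.closed_of_finiteDimensional
  have htop : Submodule.IsTopCompl F G := Submodule.IsCompl.isTopCompl_of_isClosed hc hFc hG
  have hzid : z • ContinuousLinearMap.id ℂ H = z • (1 : H →L[ℂ] H) := rfl
  rw [hzid] at hn hbij
  set D : H →L[ℂ] H := A - z • 1 with hD
  have hDF : ∀ x ∈ F, D x ∈ F := fun x hx => by
    simpa [hD] using F.sub_mem (hAF hx) (F.smul_mem z hx)
  have hDG : ∀ x ∈ G, D x ∈ G := fun x hx => by
    simpa [hD] using G.sub_mem (hAG hx) (G.smul_mem z hx)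
  let pF : H →L[ℂ] F := F.projectionOntoL G htop
  let pG : H →L[ℂ] G := G.projectionOntoL F htop.symm
  have hsum : ∀ x, (pF x : H) + (pG x : H) = x := fun x =>
    Submodule.projection_add_projection_eq_self htop.isCompl x
  have hpFF : ∀ x ∈ F, (pF x : H) = x := fun x hx => by
    have := Submodule.projectionOntoL_apply_left (p := F) (q := G) htop ⟨x, hx⟩
    exact congrArg Subtype.val this
  have hpGG : ∀ x ∈ G, (pG x : H) = x := fun x hx => by
    have := Submodule.projectionOntoL_apply_left (p := G) (q := F) htop.symm ⟨x, hx⟩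
    exact congrArg Subtype.val this
  have : CompleteSpace G := hG.completeSpace_coe
  let DG : G →L[ℂ] G := (D.comp G.subtypeL).codRestrict G fun x => hDG x x.2
  have hDGv : ∀ x : G, (DG x : H) = D x := fun x => rfl
  have hinj : DG.ker = ⊥ := by
    rw [LinearMap.ker_eq_bot]
    intro x y hxy
    exact Subtype.ext (hbij.injOn x.2 y.2 (congrArg Subtype.val hxy))
  have hsurj : DG.range = ⊤ := by
    rw [LinearMap.range_eq_top]
    intro y
    obtain ⟨x, hx, hxy⟩ := hbij.surjOn y.2
    exact ⟨⟨x, hx⟩, Subtype.ext hxy⟩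
  let E : G ≃L[ℂ] G := ContinuousLinearEquiv.ofBijective DG hinj hsurj
  have hE : ∀ x : G, D (E.symm x) = x := fun x => by
    rw [← hDGv]
    exact congrArg Subtype.val (ContinuousLinearEquiv.ofBijective_apply_symm_apply DG hinj hsurj x)
  have hE' : ∀ x : G, E.symm (DG x) = x := fun x =>
    ContinuousLinearEquiv.ofBijective_symm_apply_apply DG hinj hsurj x
  have hPD : ∀ x, (pF (D x) : H) = D (pF x) ∧ (pG (D x) : H) = D (pG x) := by
    intro x
    have e1 : D x = D (pF x) + D (pG x) := by rw [← map_add, hsum]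
    have h1 : pG (D (pF x)) = 0 := by
      have := hsum (D (pF x))
      rw [hpFF _ (hDF _ (pF x).2)] at this
      exact Subtype.ext (by simpa using this)
    have h2 : pF (D (pG x)) = 0 := by
      have := hsum (D (pG x))
      rw [hpGG _ (hDG _ (pG x).2)] at this
      exact Subtype.ext (by simpa using this)
    constructor
    · rw [e1, map_add, h2, add_zero, hpFF _ (hDF _ (pF x).2)]
    · rw [e1, map_add, h1, zero_add, hpGG _ (hDG _ (pG x).2)]
  have hFG : ∀ x ∈ G, pF x = 0 := fun x hx => by
    have := hsum x
    rw [hpGG x hx] at this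
    exact Subtype.ext (by simpa using this)
  have hGF : ∀ x ∈ F, pG x = 0 := fun x hx => by
    have := hsum x
    rw [hpFF x hx] at this
    exact Subtype.ext (by simpa using this)
  have hcomm : D * F.subtypeL.comp pF = F.subtypeL.comp pF * D := by
    ext x; simpa using (hPD x).1.symm
  refine ⟨F.subtypeL.comp pF, G.subtypeL.comp (E.symm.toContinuousLinearMap.comp pG), n,
    ?_, ?_, ?_, ?_, ?_, ?_, ?_, ?_⟩
  · ext x; simpa using hpFF _ (pF x).2
  · refine Submodule.finiteDimensional_of_le (S₂ := F) ?_
    rintro _ ⟨x, rfl⟩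
    exact (pF x).2
  · have : A = D + z • 1 := by simp [hD]
    rw [this, add_mul, mul_add, hcomm]; simp
  · ext x
    have := hE (pG x)
    change D (E.symm (pG x) : H) = x - (pF x : H)
    rw [this, eq_sub_iff_add_eq', hsum]
  · ext x
    have h1 : pG (D x) = DG (pG x) := Subtype.ext (hPD x).2
    change (E.symm (pG (D x)) : H) = x - (pF x : H)
    rw [h1, hE', eq_sub_iff_add_eq', hsum]
  · ext x
    simp [hGF _ (pF x).2]
  · ext x
    simp [hFG]
  · ext x
    simpa using hn _ (pF x).2

/-- A point of the discrete spectrum is isolated in the spectrum. -/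
theorem IsRegularOrDiscreteEigenvalue.eventually_isUnit {A : H →L[ℂ] H} {z : ℂ}
    (h : IsRegularOrDiscreteEigenvalue A z) :
    ∀ᶠ w in 𝓝 z, w ≠ z → IsUnit (A - w • (1 : H →L[ℂ] H)) := by
  obtain ⟨P, B, n, hP, -, hAP, hDB, hBD, hBP, hPB, hn⟩ := h.exists_projection
  have hsmall : ∀ᶠ w in 𝓝 z, IsUnit (1 - (w - z) • B) := by
    have hc : Continuous fun w : ℂ => 1 - (w - z) • B := by fun_prop
    have := hc.tendsto z
    simp only [sub_self, zero_smul, sub_zero] at this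
    exact this.eventually (Units.isOpen.mem_nhds isUnit_one)
  filter_upwards [hsmall] with w hw hwz
  set η : ℂ := w - z with hη
  have hη0 : η ≠ 0 := sub_ne_zero.2 hwz
  obtain ⟨D, hD⟩ : ∃ D : H →L[ℂ] H, D = A - z • 1 := ⟨_, rfl⟩
  rw [← hD] at hDB hBD hn
  have hDP : D * P = P * D := by simp [hD, sub_mul, mul_sub, hAP]
  have hP0 : P * (1 - P) = 0 := by rw [mul_sub, mul_one, hP, sub_self]
  have hP0' : (1 - P) * P = 0 := by rw [sub_mul, one_mul, hP, sub_self]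
  have hBQ : B * (1 - P) = B := by rw [mul_sub, hBP, mul_one, sub_zero]
  have hDQ : D * (1 - P) = (1 - P) * D := by rw [mul_sub, sub_mul, hDP, mul_one, one_mul]
  -- On the range of `1 - P` one uses the inverse `B`, on the range of `P` nilpotency.
  have u1 : IsUnit (D * (1 - P) + P) := by
    refine isUnit_iff_exists.2 ⟨B + P, ?_, ?_⟩
    · have : D * (1 - P) * B = 1 - P := by
        rw [mul_assoc, sub_mul, one_mul, hPB, sub_zero, hDB]
      rw [mul_add, add_mul, add_mul, this, hPB, hP, mul_assoc, hP0', mul_zero]; simp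
    · have : B * (D * (1 - P)) = 1 - P := by
        rw [← mul_assoc, hBD]
        rw [mul_sub, mul_one, hP0']; simp
      rw [mul_add, add_mul, add_mul, this, hBP, hP, hDQ, ← mul_assoc, hP0, zero_mul]; simp
  have u2 : IsUnit (1 - P - η • P) := by
    refine isUnit_iff_exists.2 ⟨1 - P - η⁻¹ • P, ?_, ?_⟩ <;>
    · simp only [mul_sub, sub_mul, mul_one, one_mul, hP, smul_mul_assoc, mul_smul_comm]
      simp [smul_smul, hη0]
  have hnil : IsNilpotent (η⁻¹ • (D * P)) := by
    have hc : Commute D P := hDP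
    refine ⟨n + 1, ?_⟩
    have : D ^ (n + 1) * P = 0 := by rw [pow_succ', mul_assoc, hn, mul_zero]
    rw [smul_pow, hc.mul_pow, pow_succ' P n, ← mul_assoc, this, zero_mul, smul_zero]
  have u3 := hnil.isUnit_one_sub
  have key : A - w • (1 : H →L[ℂ] H) =
      ((D * (1 - P) + P) * (1 - η • B)) * ((1 - P - η • P) * (1 - η⁻¹ • (D * P))) := by
    have e1 : (D * (1 - P) + P) * (1 - η • B) = D * (1 - P) + P - η • (1 - P) := by
      have : D * (1 - P) * B = 1 - P := by
        rw [mul_assoc, sub_mul, one_mul, hPB, sub_zero, hDB]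
      rw [mul_sub, mul_one, mul_smul_comm, add_mul, this, hPB, add_zero]
    have e2 : (1 - P - η • P) * (1 - η⁻¹ • (D * P)) = 1 - P - η • P + D * P := by
      have : (1 - P - η • P) * (D * P) = - (η • (D * P)) := by
        rw [sub_mul, sub_mul, hDP, one_mul, smul_mul_assoc, ← mul_assoc, hP]; simp
      rw [mul_sub, mul_one, mul_smul_comm, this, smul_neg, smul_smul, inv_mul_cancel₀ hη0]
      simp
    rw [e1, e2]
    have e3 : A - w • (1 : H →L[ℂ] H) = D - η • 1 := by
      rw [hD, hη, sub_smul]; abel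
    have e4 : P * (D * P) = D * P := by rw [hDP, ← mul_assoc, hP]
    have e5 : D * P * P = D * P := by rw [mul_assoc, hP]
    rw [e3]
    simp only [mul_sub, sub_mul, mul_add, add_mul, mul_one, one_mul, smul_mul_assoc, mul_smul_comm,
      smul_sub, hP, e4, e5]
    have e6 : D * (D * P) = D * P * (D * P) := by
      rw [mul_assoc D P, e4]
    rw [e6]
    abel_nf
  rw [key]
  exact (u1.mul hw).mul (u2.mul u3)

/-- Writing `D = A - z`, one has `1 - P = B ^ n D ^ n` while `D ^ n P = 0`, so that an operator
which commutes with `A` respects both parts. -/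
theorem IsRegularOrDiscreteEigenvalue.isSpectralProjection {A : H →L[ℂ] H} {z : ℂ}
    (h : IsRegularOrDiscreteEigenvalue A z) : ∃ P, IsSpectralProjection A P {z} := by
  obtain ⟨P, B, n, hP, hfin, hAP, hDB, hBD, hBP, hPB, hn⟩ := h.exists_projection
  refine ⟨P, hP, fun U hU => ?_, hfin, ?_⟩
  · obtain ⟨D, hD⟩ : ∃ D : H →L[ℂ] H, D = A - z • 1 := ⟨_, rfl⟩
    rw [← hD] at hDB hBD hn
    have hUD : Commute U D := by
      change U * D = D * U
      simp [hD, sub_mul, mul_sub, hU]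
    have hc : Commute D B := hDB.trans hBD.symm
    have hcP : Commute D P := by
      change D * P = P * D
      simp [hD, sub_mul, mul_sub, hAP]
    have hQ : (1 - P) * (1 - P) = 1 - P := by
      rw [mul_sub, mul_one, sub_mul, one_mul, hP, sub_self, sub_zero]
    have hQn : ∀ k : ℕ, (1 - P) ^ (k + 1) = 1 - P := fun k => by
      induction k with
      | zero => simp
      | succ k ih => rw [pow_succ, ih, hQ]
    have hn' : D ^ (n + 1) * P = 0 := by rw [pow_succ', mul_assoc, hn, mul_zero]
    have hPn : P * D ^ (n + 1) = 0 := by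
      rw [← (hcP.pow_left (n + 1)).eq, hn']
    have e1 : D ^ (n + 1) * B ^ (n + 1) = 1 - P := by rw [← hc.mul_pow, hDB, hQn]
    have e2 : B ^ (n + 1) * D ^ (n + 1) = 1 - P := by rw [← hc.symm.mul_pow, hBD, hQn]
    have c1 : P * U * (1 - P) = 0 := by
      rw [← e1, mul_assoc, ← mul_assoc U, (hUD.pow_right (n + 1)).eq, ← mul_assoc, ← mul_assoc,
        hPn, zero_mul, zero_mul]
    have c2 : (1 - P) * U * P = 0 := by
      rw [← e2, mul_assoc, mul_assoc, ← mul_assoc _ U, ← (hUD.pow_right (n + 1)).eq, mul_assoc U,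
        hn', mul_zero, mul_zero]
    rw [mul_sub, mul_one, sub_eq_zero] at c1
    rw [sub_mul, one_mul, sub_mul, sub_eq_zero] at c2
    rw [c2, ← c1]
  · rintro w rfl
    exact ⟨B, hDB, hBD⟩

theorem IsSpectralProjection.union {A P P' : H →L[ℂ] H} {S S' : Set ℂ}
    (h : IsSpectralProjection A P S) (h' : IsSpectralProjection A P' S') :
    IsSpectralProjection A (1 - (1 - P) * (1 - P')) (S ∪ S') := by
  have hAP : A * P = P * A := h.comm A rfl
  have hAP' : A * P' = P' * A := h'.comm A rfl
  have hPP : P * P' = P' * P := h'.comm P hAP.symm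
  have hfin := h.finite
  have hfin' := h'.finite
  refine ⟨?_, fun U hU => ?_, ?_, ?_⟩
  · have hQ : (1 - P) * (1 - P) = 1 - P := by
      rw [mul_sub, mul_one, sub_mul, one_mul, h.idem, sub_self, sub_zero]
    have hQ' : (1 - P') * (1 - P') = 1 - P' := by
      rw [mul_sub, mul_one, sub_mul, one_mul, h'.idem, sub_self, sub_zero]
    have hc : (1 - P) * (1 - P') = (1 - P') * (1 - P) := by
      simp only [mul_sub, sub_mul, mul_one, one_mul, hPP]; abel
    have hc2 : ((1 - P) * (1 - P')) * ((1 - P) * (1 - P')) = (1 - P) * (1 - P') := by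
      rw [mul_assoc, ← mul_assoc (1 - P'), ← hc, mul_assoc (1 - P), hQ', ← mul_assoc, hQ]
    generalize (1 - P) * (1 - P') = Q at hc2
    rw [mul_sub, mul_one, sub_mul, one_mul, hc2, sub_self, sub_zero]
  · have e1 := h.comm U hU
    have e2 := h'.comm U hU
    have e3 : U * (P * P') = P * P' * U := by rw [← mul_assoc, e1, mul_assoc, e2, mul_assoc]
    simp only [mul_sub, sub_mul, mul_one, one_mul, e1, e2, e3]
  · refine Submodule.finiteDimensional_of_le (S₂ := P.range ⊔ P'.range) ?_
    rintro _ ⟨x, rfl⟩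
    have : (1 - (1 - P) * (1 - P')) x = P (x - P' x) + P' x := by
      simp only [mul_sub, sub_mul, mul_one, one_mul]
      change x - (x - P x - (P' x - P (P' x))) = _
      rw [map_sub]; abel
    exact Submodule.mem_sup.2 ⟨_, ⟨x - P' x, rfl⟩, _, ⟨x, rfl⟩, this.symm⟩
  · have hc : (1 - P) * (1 - P') = (1 - P') * (1 - P) := by
      simp only [mul_sub, sub_mul, mul_one, one_mul, hPP]; abel
    rintro z (hz | hz)
    · obtain ⟨B, h1, h2⟩ := h.inv z hz
      refine ⟨B * (1 - P'), ?_, ?_⟩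
      · rw [← mul_assoc, h1, sub_sub_cancel]
      · have : (1 - P') * (A - z • 1) = (A - z • 1) * (1 - P') := by
          simp only [mul_sub, sub_mul, mul_one, one_mul, hAP', smul_mul_assoc, mul_smul_comm, smul_sub]
          abel
        rw [mul_assoc, this, ← mul_assoc, h2, sub_sub_cancel]
    · obtain ⟨B, h1, h2⟩ := h'.inv z hz
      refine ⟨B * (1 - P), ?_, ?_⟩
      · rw [← mul_assoc, h1, sub_sub_cancel, hc]
      · have : (1 - P) * (A - z • 1) = (A - z • 1) * (1 - P) := by
          simp only [mul_sub, sub_mul, mul_one, one_mul, hAP, smul_mul_assoc, mul_smul_comm, smul_sub]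
          abel
        rw [mul_assoc, this, ← mul_assoc, h2, sub_sub_cancel, hc]

theorem exists_isSpectralProjection_finset {A : H →L[ℂ] H} (S : Finset ℂ)
    (hS : ∀ z ∈ S, IsRegularOrDiscreteEigenvalue A z) :
    ∃ P, IsSpectralProjection A P (S : Set ℂ) := by
  classical
  induction S using Finset.induction_on with
  | empty =>
    refine ⟨0, by simp, by simp, ?_, by simp⟩
    have : (0 : H →L[ℂ] H).range = ⊥ := by
      ext x; simp
    rw [this]; infer_instance
  | insert z S _ ih =>
    obtain ⟨P, hP⟩ := ih fun w hw => hS w (Finset.mem_insert_of_mem hw)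
    obtain ⟨P', hP'⟩ := (hS z (Finset.mem_insert_self z S)).isSpectralProjection
    refine ⟨1 - (1 - P') * (1 - P), ?_⟩
    have := hP'.union hP
    rwa [Finset.coe_insert, Set.insert_eq]

theorem exists_norm_pow_le_of_spectralRadius_lt {R : Type*} [NormedRing R] [NormedAlgebra ℂ R]
    [CompleteSpace R] (a : R) {r : ℝ} (hr : 0 < r) (h : ∀ z ∈ spectrum ℂ a, ‖z‖ < r) :
    ∃ C : ℝ, 0 < C ∧ ∀ n : ℕ, ‖a ^ n‖ ≤ C * r ^ n := by
  rcases subsingleton_or_nontrivial R with hR | hR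
  · refine ⟨1, one_pos, fun n => ?_⟩
    rw [Subsingleton.elim (a ^ n) 0, norm_zero]; positivity
  lift r to NNReal using hr.le
  have hlt : spectralRadius ℂ a < r := spectrum.spectralRadius_lt_of_forall_lt a fun z hz => by
    exact_mod_cast h z hz
  have hev := (spectrum.pow_nnnorm_pow_one_div_tendsto_nhds_spectralRadius a).eventually
    (gt_mem_nhds hlt)
  obtain ⟨N, hN⟩ := eventually_atTop.1 hev
  have hbd : ∀ n, N + 1 ≤ n → ‖a ^ n‖ ≤ (r : ℝ) ^ n := fun n hn => by
    have h1 := (hN n (by omega)).le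
    have hn0 : (0 : ℝ) < n := by
      have : 0 < n := by omega
      exact_mod_cast this
    rw [one_div, ENNReal.rpow_inv_le_iff hn0, ENNReal.rpow_natCast] at h1
    exact_mod_cast h1
  have hr' : (0 : ℝ) < r := hr
  refine ⟨1 + ∑ n ∈ Finset.range (N + 1), ‖a ^ n‖ / r ^ n, by positivity, fun n => ?_⟩
  rcases lt_or_ge n (N + 1) with hn | hn
  · have : ‖a ^ n‖ / r ^ n ≤ ∑ n ∈ Finset.range (N + 1), ‖a ^ n‖ / r ^ n :=
      Finset.single_le_sum (f := fun n => ‖a ^ n‖ / (r : ℝ) ^ n) (fun i _ => by positivity)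
        (Finset.mem_range.2 hn)
    rw [← div_le_iff₀ (by positivity)]
    linarith
  · refine (hbd n hn).trans (le_mul_of_one_le_left (by positivity) ?_)
    have : 0 ≤ ∑ n ∈ Finset.range (N + 1), ‖a ^ n‖ / (r : ℝ) ^ n := by positivity
    linarith

/-- An operator of essential spectral radius `< 1` is exponentially contracting in the complement
of a finite-rank spectral projection. -/
theorem exists_projection_of_essentialSpectralRadius_lt_one {A : H →L[ℂ] H}
    (h : essentialSpectralRadius A < 1) :
    ∃ (P : H →L[ℂ] H) (C δ : ℝ), P * P = P ∧ A * P = P * A ∧ FiniteDimensional ℂ P.range ∧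
      0 < C ∧ 0 < δ ∧ δ < 1 ∧ ∀ n : ℕ, ‖A ^ n * (1 - P)‖ ≤ C * δ ^ n := by
  obtain ⟨ρ, hρ, hρ1⟩ := ENNReal.lt_iff_exists_nnreal_btwn.1 h
  have hρ1' : (ρ : ℝ) < 1 := by exact_mod_cast hρ1
  have hreg : ∀ z : ℂ, (ρ : ℝ) ≤ ‖z‖ → IsRegularOrDiscreteEigenvalue A z := fun z hz => by
    by_contra hcon
    have : (‖z‖₊ : ℝ≥0∞) ≤ essentialSpectralRadius A :=
      le_iSup₂ (f := fun (z : ℂ) (_ : ¬ IsRegularOrDiscreteEigenvalue A z) => (‖z‖₊ : ℝ≥0∞)) z hcon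
    have h2 := this.trans_lt hρ
    have : ‖z‖ < ρ := by exact_mod_cast h2
    linarith
  -- The spectrum outside the disc of radius `ρ` is discrete and compact, hence finite.
  set K : Set ℂ := {z | (ρ : ℝ) ≤ ‖z‖} ∩ Metric.closedBall 0 ‖A‖ with hK
  have hKc : IsCompact K :=
    (isCompact_closedBall 0 ‖A‖).inter_left (isClosed_le continuous_const continuous_norm)
  have hnhds : ∀ z ∈ K, {w | w ≠ z → IsUnit (A - w • (1 : H →L[ℂ] H))} ∈ 𝓝 z := fun z hz =>
    (hreg z hz.1).eventually_isUnit
  obtain ⟨S, hSK, hS⟩ := hKc.elim_nhds_subcover _ hnhds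
  obtain ⟨P, hP⟩ := exists_isSpectralProjection_finset S fun z hz => hreg z (hSK z hz).1
  have hAP : A * P = P * A := hP.comm A rfl
  have hP0 : P * (1 - P) = 0 := by rw [mul_sub, mul_one, hP.idem, sub_self]
  have hinv : ∀ z : ℂ, (ρ : ℝ) ≤ ‖z‖ →
      ∃ B : H →L[ℂ] H, (A - z • 1) * B = 1 - P ∧ B * (A - z • 1) = 1 - P := by
    intro z hz
    by_cases hzS : z ∈ S
    · exact hP.inv z hzS
    have hu : IsUnit (A - z • (1 : H →L[ℂ] H)) := by
      by_cases hzK : z ∈ K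
      · obtain ⟨w, hw, hzw⟩ := Set.mem_iUnion₂.1 (hS hzK)
        exact hzw fun e => hzS (e ▸ hw)
      · have hz2 : ‖A‖ < ‖z‖ := by
          by_contra hcon
          exact hzK ⟨hz, by simpa using not_lt.1 hcon⟩
        have := spectrum.mem_resolventSet_of_norm_lt_mul (𝕜 := ℂ) (a := A) (k := z) (by
          refine lt_of_le_of_lt ?_ hz2
          exact mul_le_of_le_one_right (norm_nonneg _) ContinuousLinearMap.norm_id_le)
        rw [spectrum.mem_resolventSet_iff, Algebra.algebraMap_eq_smul_one] at this
        simpa using this.neg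
    obtain ⟨R, hR1, hR2⟩ := isUnit_iff_exists.1 hu
    have hc : (A - z • 1) * (1 - P) = (1 - P) * (A - z • 1) := by
      simp only [mul_sub, sub_mul, mul_one, one_mul, hAP, smul_mul_assoc, mul_smul_comm, smul_sub]
      abel
    exact ⟨R * (1 - P), by rw [← mul_assoc, hR1, one_mul],
      by rw [mul_assoc, ← hc, ← mul_assoc, hR2, one_mul]⟩
  rcases exists_between (max_lt hρ1' zero_lt_one) with ⟨δ, hδ, hδ1⟩
  have hδ0 : 0 < δ := (le_max_right _ _).trans_lt hδ
  have hρδ : (ρ : ℝ) ≤ δ := ((le_max_left _ _).trans_lt hδ).le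
  have hQQ : (1 - P) * (1 - P) = 1 - P := by rw [sub_mul, one_mul, hP0, sub_zero]
  have hspec : ∀ z ∈ spectrum ℂ (A * (1 - P)), ‖z‖ < δ := by
    intro z hz
    by_contra hcon
    push Not at hcon
    have hz0 : z ≠ 0 := norm_pos_iff.1 (hδ0.trans_le hcon)
    obtain ⟨B, hB1, hB2⟩ := hinv z (hρδ.trans hcon)
    have hBA : B * A = A * B := by simpa [sub_mul, mul_sub] using hB2.trans hB1.symm
    have hBP := hP.comm B hBA
    have hBQ : B * (1 - P) = (1 - P) * B := by simp [mul_sub, sub_mul, hBP]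
    have hAQ : A * (1 - P) = (1 - P) * A := by simp [mul_sub, sub_mul, hAP]
    refine hz ?_
    rw [spectrum.mem_resolventSet_iff, Algebra.algebraMap_eq_smul_one]
    have : IsUnit (A * (1 - P) - z • 1) := by
      have hP0' : (1 - P) * P = 0 := by rw [sub_mul, one_mul, hP.idem, sub_self]
      obtain ⟨D, hD⟩ : ∃ D : H →L[ℂ] H, D = A - z • 1 := ⟨_, rfl⟩
      have f1 : A * (1 - P) - z • 1 = (A - z • 1) * (1 - P) - z • P := by
        rw [sub_mul, smul_mul_assoc, one_mul, smul_sub]; abel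
      have f2 : (A - z • 1) * (1 - P) = (1 - P) * (A - z • 1) := by
        simp only [mul_sub, sub_mul, mul_one, one_mul, hAP, smul_mul_assoc, mul_smul_comm, smul_sub]
        abel
      rw [f1]
      rw [← hD] at hB1 hB2 f2 ⊢
      refine isUnit_iff_exists.2 ⟨B * (1 - P) - z⁻¹ • P, ?_, ?_⟩
      · have g1 : D * (1 - P) * (B * (1 - P)) = 1 - P := by
          rw [hBQ, ← mul_assoc, mul_assoc D, hQQ, f2, mul_assoc, hB1, hQQ]
        have g2 : D * (1 - P) * P = 0 := by rw [mul_assoc, hP0', mul_zero]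
        have g3 : P * (B * (1 - P)) = 0 := by rw [hBQ, ← mul_assoc, hP0, zero_mul]
        rw [mul_sub, sub_mul, sub_mul, g1, mul_smul_comm, g2, smul_mul_assoc, g3, smul_mul_smul_comm,
          hP.idem, mul_inv_cancel₀ hz0]
        simp
      · have g1 : B * (1 - P) * (D * (1 - P)) = 1 - P := by
          rw [f2, mul_assoc, ← mul_assoc (1 - P), hQQ, ← f2, ← mul_assoc, hB2, hQQ]
        have g2 : P * (D * (1 - P)) = 0 := by rw [f2, ← mul_assoc, hP0, zero_mul]
        have g3 : B * (1 - P) * P = 0 := by rw [mul_assoc, hP0', mul_zero]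
        rw [mul_sub, sub_mul, sub_mul, g1, mul_smul_comm, g3, smul_mul_assoc, g2, smul_mul_smul_comm,
          hP.idem, inv_mul_cancel₀ hz0]
        simp
    simpa using this.neg
  obtain ⟨C, hC, hCn⟩ := exists_norm_pow_le_of_spectralRadius_lt _ hδ0 hspec
  have hcQ : Commute A (1 - P) := by
    change A * (1 - P) = (1 - P) * A
    simp [mul_sub, sub_mul, hAP]
  have hQn : ∀ k : ℕ, (1 - P) ^ (k + 1) = 1 - P := fun k => by
    induction k with
    | zero => simp
    | succ k ih => rw [pow_succ, ih, hQQ]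
  refine ⟨P, max C ‖1 - P‖, δ, hP.idem, hAP, hP.finite, lt_max_of_lt_left hC, hδ0, hδ1,
    fun n => ?_⟩
  rcases n with _ | n
  · simp
  · have := hCn (n + 1)
    rw [hcQ.mul_pow, hQn] at this
    exact this.trans (mul_le_mul_of_nonneg_right (le_max_left _ _) (by positivity))

end QuasiCompact

section Peripheral

variable {H : Type*} [NormedAddCommGroup H] [NormedSpace ℂ H]

/-- On a finite-dimensional subspace a separating family of functionals controls the norm. -/
theorem exists_norm_le_sum_of_separating {ι : Type*} (V : Submodule ℂ H) [FiniteDimensional ℂ V]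
    (ev : ι → H →L[ℂ] ℂ) (hsep : ∀ v ∈ V, (∀ i, ev i v = 0) → v = 0) :
    ∃ (I : Finset ι) (c : ℝ), 0 ≤ c ∧ ∀ v ∈ V, ‖v‖ ≤ c * ∑ i ∈ I, ‖ev i v‖ := by
  have hprop : ProperSpace V := FiniteDimensional.proper ℂ V
  have hcomp : IsCompact (Metric.sphere (0 : V) 1) := isCompact_sphere 0 1
  have hne : ∀ v ∈ Metric.sphere (0 : V) 1, ∃ i, ev i v ≠ 0 := fun v hv => by
    by_contra hcon
    push Not at hcon
    have h0 : v = 0 := Subtype.ext (hsep v v.2 hcon)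
    rw [h0] at hv
    simp at hv
  obtain ⟨I, hI⟩ := hcomp.elim_finite_subcover (fun i => {v : V | ev i v ≠ 0})
    (fun i => isOpen_ne_fun (by fun_prop) continuous_const)
    (fun v hv => Set.mem_iUnion.2 (hne v hv))
  have hcont : ContinuousOn (fun v : V => ∑ i ∈ I, ‖ev i v‖) (Metric.sphere (0 : V) 1) := by
    fun_prop
  rcases (Metric.sphere (0 : V) 1).eq_empty_or_nonempty with hemp | hnon
  · refine ⟨I, 0, le_rfl, fun v hv => ?_⟩
    by_contra hcon
    have hv0 : (⟨v, hv⟩ : V) ≠ 0 := fun h => by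
      have : v = 0 := congrArg Subtype.val h
      simp [this] at hcon
    have hmem : (‖(⟨v, hv⟩ : V)‖⁻¹ : ℂ) • (⟨v, hv⟩ : V) ∈ Metric.sphere (0 : V) 1 := by
      rw [mem_sphere_zero_iff_norm, norm_smul, norm_inv, Complex.norm_real, norm_norm,
        inv_mul_cancel₀ (norm_ne_zero_iff.2 hv0)]
    rw [hemp] at hmem
    exact hmem
  · obtain ⟨v₀, hv₀, hmin⟩ := hcomp.exists_isMinOn hnon hcont
    have hpos : 0 < ∑ i ∈ I, ‖ev i v₀‖ := by
      obtain ⟨i, hi, hvi⟩ := Set.mem_iUnion₂.1 (hI hv₀)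
      exact Finset.sum_pos' (fun _ _ => norm_nonneg _) ⟨i, hi, norm_pos_iff.2 hvi⟩
    refine ⟨I, (∑ i ∈ I, ‖ev i v₀‖)⁻¹, by positivity, fun v hv => ?_⟩
    rcases eq_or_ne v 0 with rfl | hv0
    · simp
    have hn : 0 < ‖v‖ := norm_pos_iff.2 hv0
    have hmem : (‖v‖⁻¹ : ℂ) • (⟨v, hv⟩ : V) ∈ Metric.sphere (0 : V) 1 := by
      rw [mem_sphere_zero_iff_norm, norm_smul, norm_inv, Complex.norm_real, norm_norm]
      exact inv_mul_cancel₀ hn.ne'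
    have h1 : ∑ i ∈ I, ‖ev i v₀‖ ≤ ∑ i ∈ I, ‖ev i (((‖v‖⁻¹ : ℂ) • (⟨v, hv⟩ : V) : V) : H)‖ :=
      hmin hmem
    have h2 : ∑ i ∈ I, ‖ev i (((‖v‖⁻¹ : ℂ) • (⟨v, hv⟩ : V) : V) : H)‖ =
        ‖v‖⁻¹ * ∑ i ∈ I, ‖ev i v‖ := by
      rw [Finset.mul_sum]
      refine Finset.sum_congr rfl fun i _ => ?_
      rw [Submodule.coe_smul, map_smul, norm_smul, norm_inv, Complex.norm_real, norm_norm]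
    rw [h2] at h1
    rw [inv_mul_eq_div, le_div_iff₀ hpos]
    calc ‖v‖ * ∑ i ∈ I, ‖ev i v₀‖ ≤ ‖v‖ * (‖v‖⁻¹ * ∑ i ∈ I, ‖ev i v‖) := by gcongr
      _ = ∑ i ∈ I, ‖ev i v‖ := by rw [← mul_assoc, mul_inv_cancel₀ hn.ne', one_mul]

/-- Powers of an operator with a contracting power decay exponentially. -/
theorem exists_norm_pow_le_of_norm_pow_le_half {R : Type*} [NormedRing R] [NormedAlgebra ℂ R]
    [CompleteSpace R] (h1 : ‖(1 : R)‖ ≤ 1) (a : R) {N : ℕ} (hN : N ≠ 0) (h : ‖a ^ N‖ ≤ 1 / 2) :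
    ∃ C r : ℝ, 0 < C ∧ 0 < r ∧ r < 1 ∧ ∀ n : ℕ, ‖a ^ n‖ ≤ C * r ^ n := by
  have hr0 : (0 : ℝ) < (3 / 4 : ℝ) ^ (1 / N : ℝ) := by positivity
  have hN' : (0 : ℝ) < N := by exact_mod_cast Nat.pos_of_ne_zero hN
  have hr1 : (3 / 4 : ℝ) ^ (1 / N : ℝ) < 1 :=
    Real.rpow_lt_one (by norm_num) (by norm_num) (by positivity)
  have hrN : ((3 / 4 : ℝ) ^ (1 / N : ℝ)) ^ N = 3 / 4 := by
    rw [one_div]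
    exact Real.rpow_inv_natCast_pow (by norm_num) hN
  obtain ⟨C, hC, hCn⟩ := exists_norm_pow_le_of_spectralRadius_lt a hr0 fun z hz => by
    have h2 := spectrum.norm_le_norm_mul_of_mem (spectrum.pow_mem_pow a N hz)
    have h3 : ‖z‖ ^ N ≤ 1 / 2 := by
      rw [← norm_pow]
      refine h2.trans ((mul_le_mul h h1 (norm_nonneg _) (by norm_num)).trans (by norm_num))
    refine lt_of_pow_lt_pow_left₀ N hr0.le ?_
    rw [hrN]
    linarith
  exact ⟨C, _, hC, hr0, hr1, hCn⟩

/-- A power-bounded operator on a finite-dimensional space is recurrent on the range of an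
idempotent limit `Q` of its powers, and it is exponentially contracting on the kernel of `Q`. -/
theorem exists_idempotent_tendsto_pow {V : Type*} [NormedAddCommGroup V] [NormedSpace ℂ V]
    [FiniteDimensional ℂ V] (U : V →L[ℂ] V) {b : ℝ} (hb : ∀ n : ℕ, ‖U ^ n‖ ≤ b) :
    ∃ (Q : V →L[ℂ] V) (φ : ℕ → ℕ) (C r : ℝ), Q * Q = Q ∧ U * Q = Q * U ∧ StrictMono φ ∧
      Tendsto (fun j => U ^ φ j) atTop (𝓝 Q) ∧ 0 < C ∧ 0 < r ∧ r < 1 ∧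
      ∀ n : ℕ, ‖U ^ n * (1 - Q)‖ ≤ C * r ^ n := by
  have hprop : ProperSpace (V →L[ℂ] V) := FiniteDimensional.proper ℂ _
  have hcompl : CompleteSpace V := FiniteDimensional.complete ℂ V
  have hball : ∀ n, U ^ n ∈ Metric.closedBall (0 : V →L[ℂ] V) b := fun n => by simpa using hb n
  have hcomp := isCompact_closedBall (0 : V →L[ℂ] V) b
  -- The limit points of the powers form a compact semigroup.
  set s : Set (V →L[ℂ] V) := {x | MapClusterPt x atTop fun n => U ^ n} with hs
  have hsub : ∀ x ∈ s, ∃ φ : ℕ → ℕ, StrictMono φ ∧ Tendsto (fun j => U ^ φ j) atTop (𝓝 x) :=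
    fun x hx => MapClusterPt.tendsto_subseq hx
  have hsball : s ⊆ Metric.closedBall 0 b := fun x hx => by
    obtain ⟨φ, -, hφ⟩ := hsub x hx
    exact Metric.isClosed_closedBall.mem_of_tendsto hφ (Eventually.of_forall fun j => hball _)
  have hsclosed : IsClosed s := isClosed_setOfPred_clusterPt
  have hscomp : IsCompact s := hcomp.of_isClosed_subset hsclosed hsball
  have hsne : s.Nonempty := by
    obtain ⟨x, -, φ, hφ, hx⟩ := hcomp.tendsto_subseq hball
    exact ⟨x, hx.mapClusterPt.of_comp hφ.tendsto_atTop⟩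
  have hsmul : ∀ᵉ (x ∈ s) (y ∈ s), x * y ∈ s := by
    intro x hx y hy
    obtain ⟨φ, hφ, hxφ⟩ := hsub x hx
    obtain ⟨ψ, hψ, hyψ⟩ := hsub y hy
    have hsum : Tendsto (fun j => φ j + ψ j) atTop atTop :=
      tendsto_atTop_mono (fun j => Nat.le_add_right _ _) hφ.tendsto_atTop
    have : Tendsto (fun j => U ^ (φ j + ψ j)) atTop (𝓝 (x * y)) := by
      simpa only [pow_add] using hxφ.mul hyψ
    exact (this.mapClusterPt).of_comp hsum
  obtain ⟨Q, hQs, hQ⟩ := exists_idempotent_in_compact_subsemigroup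
    (fun r => continuous_id.mul continuous_const) s hsne hscomp hsmul
  obtain ⟨φ, hφ, hQφ⟩ := hsub Q hQs
  have hUQ : U * Q = Q * U := by
    refine tendsto_nhds_unique (hQφ.const_mul U) ?_
    have := hQφ.mul_const U
    refine this.congr fun j => ?_
    rw [← pow_succ, ← pow_succ']
  have hcQ : Commute U (1 - Q) := by
    change U * (1 - Q) = (1 - Q) * U
    simp [mul_sub, sub_mul, hUQ]
  have hQQ : (1 - Q) * (1 - Q) = 1 - Q := by
    rw [mul_sub, mul_one, sub_mul, one_mul, hQ, sub_self, sub_zero]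
  have hQn : ∀ k : ℕ, (1 - Q) ^ (k + 1) = 1 - Q := fun k => by
    induction k with
    | zero => simp
    | succ k ih => rw [pow_succ, ih, hQQ]
  have hlim : Tendsto (fun j => ‖U ^ φ j * (1 - Q)‖) atTop (𝓝 0) := by
    have : Tendsto (fun j => U ^ φ j * (1 - Q)) atTop (𝓝 (Q * (1 - Q))) := hQφ.mul_const _
    rw [mul_sub, mul_one, hQ, sub_self] at this
    simpa using this.norm
  obtain ⟨j, hj1, hj2⟩ := ((hlim.eventually (ge_mem_nhds (show (0 : ℝ) < 1 / 2 by norm_num))).and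
    (hφ.tendsto_atTop.eventually (eventually_ge_atTop 1))).exists
  have hpow : ∀ n : ℕ, (U * (1 - Q)) ^ (n + 1) = U ^ (n + 1) * (1 - Q) := fun n => by
    rw [hcQ.mul_pow, hQn]
  obtain ⟨C, r, hC, hr, hr1, hCn⟩ := exists_norm_pow_le_of_norm_pow_le_half
    (R := V →L[ℂ] V) ContinuousLinearMap.norm_id_le (U * (1 - Q)) (N := φ j) (by omega) (by
      obtain ⟨m, hm⟩ : ∃ m, φ j = m + 1 := ⟨φ j - 1, by omega⟩
      rw [hm] at hj1 ⊢
      rwa [hpow])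
  refine ⟨Q, φ, max C ‖1 - Q‖, r, hQ, hUQ, hφ, hQφ, lt_max_of_lt_left hC, hr, hr1, fun n => ?_⟩
  rcases n with _ | n
  · simp
  · rw [← hpow]
    exact (hCn _).trans (mul_le_mul_of_nonneg_right (le_max_left _ _) (by positivity))

/-- `P` is the projection on the recurrent part of `A`: a finite-rank projection commuting with
`A` such that the powers of `A` decay exponentially on the kernel of `P`, while the powers `A ^ φ j`
converge to the identity on the range of `P`. -/
structure IsPeripheralProjection (A P : H →L[ℂ] H) (C δ : ℝ) (φ : ℕ → ℕ) : Prop where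
  idem : P * P = P
  comm : A * P = P * A
  finiteRange : FiniteDimensional ℂ P.range
  C_pos : 0 < C
  δ_pos : 0 < δ
  δ_lt_one : δ < 1
  norm_pow_le : ∀ n : ℕ, ‖A ^ n‖ ≤ C
  contraction : ∀ n : ℕ, ‖A ^ n * (1 - P)‖ ≤ C * δ ^ n
  strictMono : StrictMono φ
  recurrence : Tendsto (fun j => A ^ φ j * P) atTop (𝓝 P)

/-- If the orbits of a dense set of vectors under a quasi-compact operator of essential spectral
radius `< 1` are bounded for a separating family of functionals, then the operator is power bounded
and the projection on its recurrent part exists. -/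
theorem exists_isPeripheralProjection [CompleteSpace H] {ι : Type*} {A : H →L[ℂ] H}
    (hA : essentialSpectralRadius A < 1) (ev : ι → H →L[ℂ] ℂ)
    (hsep : ∀ v, (∀ i, ev i v = 0) → v = 0) {s : Set H} (hs : Dense s)
    (hbdd : ∀ u ∈ s, ∀ i, ∃ b : ℝ, ∀ n : ℕ, ‖ev i ((A ^ n) u)‖ ≤ b) :
    ∃ (P : H →L[ℂ] H) (C δ : ℝ) (φ : ℕ → ℕ), IsPeripheralProjection A P C δ φ := by
  obtain ⟨P, C, δ, hP, hAP, hfin, hC, hδ, hδ1, hcontr⟩ :=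
    exists_projection_of_essentialSpectralRadius_lt_one hA
  obtain ⟨V, hV⟩ : ∃ V : Submodule ℂ H, V = P.range := ⟨_, rfl⟩
  rw [← hV] at hfin
  have hcomm : Commute A P := hAP
  obtain ⟨I, c, hc, hI⟩ := exists_norm_le_sum_of_separating V ev fun v _ => hsep v
  have hPV : ∀ x, P x ∈ V := fun x => hV ▸ ⟨x, rfl⟩
  have hPid : ∀ v ∈ V, P v = v := by
    intro v hv
    rw [hV] at hv
    obtain ⟨x, rfl⟩ := hv
    exact DFunLike.congr_fun hP x
  have hAnP : ∀ n x, (A ^ n) (P x) = P ((A ^ n) x) := fun n x =>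
    DFunLike.congr_fun (hcomm.pow_left n).eq x
  -- The vectors of the range of `P` with bounded orbit form a subspace, which is everything.
  let W : Submodule ℂ H :=
    { carrier := {v | v ∈ V ∧ ∃ b : ℝ, ∀ n : ℕ, ‖(A ^ n) v‖ ≤ b}
      add_mem' := by
        rintro x y ⟨hx, b, hb⟩ ⟨hy, b', hb'⟩
        refine ⟨V.add_mem hx hy, b + b', fun n => ?_⟩
        rw [map_add]
        exact (norm_add_le _ _).trans (add_le_add (hb n) (hb' n))
      zero_mem' := ⟨V.zero_mem, 0, fun n => by simp⟩
      smul_mem' := by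
        rintro a x ⟨hx, b, hb⟩
        refine ⟨V.smul_mem a hx, ‖a‖ * b, fun n => ?_⟩
        rw [map_smul, norm_smul]
        exact mul_le_mul_of_nonneg_left (hb n) (norm_nonneg _) }
  have hWV : W ≤ V := fun x hx => hx.1
  have hWfin : FiniteDimensional ℂ W := Submodule.finiteDimensional_of_le hWV
  have hWclosed : IsClosed (W : Set H) := W.closed_of_finiteDimensional
  have hsW : ∀ u ∈ s, P u ∈ W := fun u hu => by
    refine ⟨hPV u, ?_⟩
    choose b hb using hbdd u hu
    refine ⟨c * ∑ i ∈ I, (b i + ‖ev i‖ * (C * ‖u‖)), fun n => ?_⟩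
    have hmem : (A ^ n) (P u) ∈ V := by rw [hAnP]; exact hPV _
    refine (hI _ hmem).trans (mul_le_mul_of_nonneg_left (Finset.sum_le_sum fun i _ => ?_) hc)
    have h1 : (A ^ n) (P u) = (A ^ n) u - (A ^ n * (1 - P)) u := by
      change _ = (A ^ n) u - (A ^ n) (u - P u)
      rw [map_sub, sub_sub_cancel]
    rw [h1, map_sub]
    refine (norm_sub_le _ _).trans (add_le_add (hb i n) ?_)
    refine ((ev i).le_opNorm _).trans (mul_le_mul_of_nonneg_left ?_ (norm_nonneg _))
    refine (ContinuousLinearMap.le_opNorm _ _).trans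
      (mul_le_mul_of_nonneg_right ((hcontr n).trans ?_) (norm_nonneg _))
    exact mul_le_of_le_one_right hC.le (pow_le_one₀ hδ.le hδ1.le)
  have hall : ∀ u, P u ∈ W := fun u =>
    (hWclosed.preimage P.continuous).closure_subset_iff.2 hsW (hs u)
  obtain ⟨b, hb⟩ := banach_steinhaus (g := fun n : ℕ => A ^ n * P) fun u => (hall u).2
  -- Split the finite-dimensional part further, along an idempotent limit of the powers.
  let p : H →L[ℂ] V := P.codRestrict V hPV
  have hAV : ∀ v : V, A v ∈ V := fun v => by
    rw [← hPid v v.2]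
    exact (DFunLike.congr_fun hAP (v : H)) ▸ hPV _
  let U : V →L[ℂ] V := (A.comp V.subtypeL).codRestrict V hAV
  have hU : ∀ n (v : V), ((U ^ n) v : H) = (A ^ n) v := fun n => by
    induction n with
    | zero => intro v; rfl
    | succ n ih =>
      intro v
      rw [pow_succ, pow_succ]
      exact ih (U v)
  have hUb : ∀ n : ℕ, ‖U ^ n‖ ≤ b := fun n => by
    have hb0 : 0 ≤ b := (norm_nonneg _).trans (hb 0)
    refine ContinuousLinearMap.opNorm_le_bound _ hb0 fun v => ?_
    have : ((U ^ n) v : H) = (A ^ n * P) v := by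
      rw [hU]; change _ = (A ^ n) (P v); rw [hPid v v.2]
    change ‖((U ^ n) v : H)‖ ≤ b * ‖(v : H)‖
    rw [this]
    exact (ContinuousLinearMap.le_opNorm _ _).trans (mul_le_mul_of_nonneg_right (hb n)
      (norm_nonneg _))
  obtain ⟨Q, φ, C', r, hQ, hUQ, hφ, hQφ, hC', hr, hr1, hQn⟩ := exists_idempotent_tendsto_pow U hUb
  have hpid : ∀ v : V, p v = v := fun v => Subtype.ext (hPid v v.2)
  let Φ : (V →L[ℂ] V) →L[ℂ] (H →L[ℂ] H) :=
    (ContinuousLinearMap.compL ℂ H V H V.subtypeL).comp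
      ((ContinuousLinearMap.compL ℂ H V V).flip p)
  have hΦ : ∀ B x, Φ B x = (B (p x) : H) := fun B x => rfl
  have hΦU : ∀ n B, A ^ n * Φ B = Φ (U ^ n * B) := fun n B => by
    ext x
    change (A ^ n) (B (p x)) = ((U ^ n) (B (p x)) : H)
    rw [hU]
  have hpA : ∀ x, p (A x) = U (p x) := fun x => Subtype.ext (DFunLike.congr_fun hAP.symm x)
  have hΦ1 : Φ 1 = P := by ext x; rfl
  obtain ⟨M, hM0, hM⟩ : ∃ M : ℝ, 0 ≤ M ∧ ∀ B, ‖Φ B‖ ≤ M * ‖B‖ := by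
    refine ⟨‖V.subtypeL‖ * ‖p‖, by positivity, fun B => ?_⟩
    refine (ContinuousLinearMap.opNorm_comp_le V.subtypeL (B.comp p)).trans ?_
    rw [mul_assoc, mul_comm ‖p‖]
    exact mul_le_mul_of_nonneg_left (ContinuousLinearMap.opNorm_comp_le B p) (norm_nonneg _)
  refine ⟨Φ Q, max b 0 + C + M * C', max δ r, φ, ?_, ?_, ?_, by positivity,
    lt_max_of_lt_left hδ, max_lt hδ1 hr1, fun n => ?_, fun n => ?_, hφ, ?_⟩
  · ext x
    change (Q (p (Q (p x))) : H) = Q (p x)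
    rw [hpid]
    exact congrArg Subtype.val (DFunLike.congr_fun hQ (p x))
  · ext x
    have h1 := hΦU 1 Q
    simp only [pow_one] at h1
    rw [h1, hUQ]
    change (Q (U (p x)) : H) = Q (p (A x))
    rw [hpA]
  · refine Submodule.finiteDimensional_of_le (S₂ := V) ?_
    rintro _ ⟨x, rfl⟩
    exact (Q (p x)).2
  · have h1 : A ^ n = A ^ n * P + A ^ n * (1 - P) := by rw [← mul_add]; simp
    rw [h1]
    refine (norm_add_le _ _).trans ?_
    have h2 := (hcontr n).trans (mul_le_of_le_one_right hC.le (pow_le_one₀ hδ.le hδ1.le))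
    have h3 : 0 ≤ M * C' := by positivity
    have h4 : ‖A ^ n * P‖ ≤ max b 0 := (hb n).trans (le_max_left _ _)
    linarith
  · have h1 : A ^ n * (1 - Φ Q) = A ^ n * (1 - P) + Φ (U ^ n * (1 - Q)) := by
      rw [← hΦU, map_sub, hΦ1, ← mul_add]; simp
    rw [h1]
    refine (norm_add_le _ _).trans ?_
    have h2 : ‖Φ (U ^ n * (1 - Q))‖ ≤ M * (C' * r ^ n) :=
      (hM _).trans (mul_le_mul_of_nonneg_left (hQn n) hM0)
    have h3 : δ ^ n ≤ max δ r ^ n := pow_le_pow_left₀ hδ.le (le_max_left _ _) n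
    have h4 : r ^ n ≤ max δ r ^ n := pow_le_pow_left₀ hr.le (le_max_right _ _) n
    have h5 : 0 ≤ max b 0 * max δ r ^ n := by positivity
    calc _ ≤ C * δ ^ n + M * (C' * r ^ n) := add_le_add (hcontr n) h2
      _ ≤ C * max δ r ^ n + M * (C' * max δ r ^ n) := by gcongr
      _ ≤ _ := by linarith
  · have h1 : Tendsto (fun j => Φ (U ^ φ j * Q)) atTop (𝓝 (Φ (Q * Q))) :=
      (Φ.continuous.tendsto _).comp (hQφ.mul_const Q)
    rw [hQ] at h1
    exact h1.congr fun j => (hΦU _ _).symm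

end Peripheral

/-! ### Finite measures on a compact space, tested against a dense space of functions -/

section TestFunctions

variable {K : Type*} [TopologicalSpace K] [CompactSpace K] [T2Space K] [SecondCountableTopology K]
  [MeasurableSpace K] [BorelSpace K]
  {S : Type*} [AddCommGroup S] [Module ℝ S]

theorem integrable_continuousMap {E : Type*} [NormedAddCommGroup E] [SecondCountableTopology E]
    [MeasurableSpace E] [BorelSpace E] (m : Measure K) [IsFiniteMeasure m] (f : C(K, E)) :
    Integrable f m :=
  f.continuous.integrable_of_hasCompactSupport (HasCompactSupport.of_compactSpace f)

theorem exists_test_near {r : S →ₗ[ℝ] C(K, ℝ)} (hr : DenseRange r) (f : C(K, ℝ)) {ε : ℝ}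
    (hε : 0 < ε) : ∃ g : S, ∀ x, |f x - r g x| ≤ ε := by
  obtain ⟨g, hg⟩ := hr.exists_dist_lt f hε
  refine ⟨g, fun x => ?_⟩
  have := (ContinuousMap.dist_lt_iff hε).1 hg x
  rw [Real.dist_eq] at this
  exact this.le

/-- The Riesz–Markov–Kakutani theorem for a positive functional which is only defined on a dense
space of test functions containing the constants. -/
theorem exists_measure_of_pos_functional {r : S →ₗ[ℝ] C(K, ℝ)} (hr : DenseRange r)
    (h1 : ∃ e, r e = 1) (ℓ : S →ₗ[ℝ] ℝ) (hpos : ∀ g, 0 ≤ r g → 0 ≤ ℓ g) :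
    ∃ m : Measure K, IsFiniteMeasure m ∧ ∀ g, ℓ g = ∫ x, r g x ∂m := by
  obtain ⟨e, he⟩ := h1
  have hbd : ∀ g, ‖ℓ g‖ ≤ ℓ e * ‖r g‖ := fun g => by
    have hx : ∀ x, |r g x| ≤ ‖r g‖ := fun x => (r g).norm_coe_le_norm x
    have p1 : 0 ≤ ℓ (‖r g‖ • e - g) := hpos _ fun x => by
      have := (abs_le.1 (hx x)).2
      simp [he]; linarith
    have p2 : 0 ≤ ℓ (‖r g‖ • e + g) := hpos _ fun x => by
      have := (abs_le.1 (hx x)).1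
      simp [he]; linarith
    rw [map_sub, map_smul, smul_eq_mul] at p1
    rw [map_add, map_smul, smul_eq_mul] at p2
    rw [Real.norm_eq_abs, abs_le]
    constructor <;> linarith
  let Λ₀ : C(K, ℝ) →L[ℝ] ℝ := ℓ.extendOfNorm r
  have hΛ₀ : ∀ g, Λ₀ (r g) = ℓ g := fun g => LinearMap.extendOfNorm_eq hr ⟨_, hbd⟩ g
  have hΛpos : ∀ f : C(K, ℝ), 0 ≤ f → 0 ≤ Λ₀ f := by
    intro f hf
    have hlim : Tendsto (fun ε : ℝ => -(ℓ e * ε + ‖Λ₀‖ * ε)) (𝓝[>] 0) (𝓝 0) := by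
      have : Continuous fun ε : ℝ => -(ℓ e * ε + ‖Λ₀‖ * ε) := by fun_prop
      have h := this.tendsto 0
      simp only [mul_zero, add_zero, neg_zero] at h
      exact h.mono_left nhdsWithin_le_nhds
    refine le_of_tendsto hlim ?_
    filter_upwards [self_mem_nhdsWithin] with ε (hε : 0 < ε)
    obtain ⟨g, hg⟩ := exists_test_near hr f hε
    have q1 : 0 ≤ ℓ (g + ε • e) := hpos _ fun x => by
      have := (abs_le.1 (hg x)).2
      have h2 : 0 ≤ f x := hf x
      simp [he]; linarith
    rw [map_add, map_smul, smul_eq_mul] at q1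
    have q2 : ‖Λ₀ (f - r g)‖ ≤ ‖Λ₀‖ * ε := by
      refine (Λ₀.le_opNorm _).trans (mul_le_mul_of_nonneg_left ?_ (norm_nonneg _))
      exact (ContinuousMap.norm_le _ hε.le).2 hg
    rw [map_sub, hΛ₀, Real.norm_eq_abs] at q2
    have := (abs_le.1 q2).1
    linarith
  let c : CompactlySupportedContinuousMap K ℝ → C(K, ℝ) := fun f => f.toContinuousMap
  let Λ : CompactlySupportedContinuousMap K ℝ →ₚ[ℝ] ℝ := PositiveLinearMap.mk₀
    { toFun := fun f => Λ₀ f.toContinuousMap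
      map_add' := fun f g => by
        have : (f + g).toContinuousMap = f.toContinuousMap + g.toContinuousMap := rfl
        rw [this, map_add]
      map_smul' := fun a f => by
        have : (a • f).toContinuousMap = a • f.toContinuousMap := rfl
        rw [this, map_smul]; rfl }
    (fun f hf => hΛpos _ hf)
  refine ⟨RealRMK.rieszMeasure Λ, by infer_instance, fun g => ?_⟩
  have := RealRMK.integral_rieszMeasure Λ
    { toFun := r g, hasCompactSupport' := HasCompactSupport.of_compactSpace _ }
  rw [← hΛ₀]
  exact this.symm

/-- Convergence on test functions implies convergence on continuous functions, because the total
masses converge and hence are bounded. -/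
theorem tendsto_integral_continuousMap_of_test {r : S →ₗ[ℝ] C(K, ℝ)} (hr : DenseRange r)
    (h1 : ∃ e, r e = 1) {ι : Type*} {L : Filter ι} {m : ι → Measure K} {m₀ : Measure K}
    [∀ k, IsFiniteMeasure (m k)] [IsFiniteMeasure m₀]
    (h : ∀ g, Tendsto (fun k => ∫ x, r g x ∂m k) L (𝓝 (∫ x, r g x ∂m₀))) (f : C(K, ℝ)) :
    Tendsto (fun k => ∫ x, f x ∂m k) L (𝓝 (∫ x, f x ∂m₀)) := by
  obtain ⟨e, he⟩ := h1
  have hmass := h e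
  have hm : ∀ m' : Measure K, ∫ x, r e x ∂m' = m'.real univ := fun m' => by
    simp [he]
  simp only [hm] at hmass
  have key : ∀ ε, 0 < ε → ∃ g, ∀ m' : Measure K, IsFiniteMeasure m' →
      |∫ x, f x ∂m' - ∫ x, r g x ∂m'| ≤ ε * m'.real univ := by
    intro ε hε
    obtain ⟨g, hg⟩ := exists_test_near hr f hε
    refine ⟨g, fun m' _ => ?_⟩
    rw [← integral_sub (integrable_continuousMap m' f) (integrable_continuousMap m' _)]
    rw [← Real.norm_eq_abs]
    exact norm_integral_le_of_norm_le_const (Eventually.of_forall fun x => hg x)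
  rw [Metric.tendsto_nhds]
  intro ε hε
  set M := m₀.real univ with hM
  have hM0 : 0 ≤ M := measureReal_nonneg
  obtain ⟨g, hg⟩ := key (ε / (4 * (M + 1))) (by positivity)
  have e1 : ∀ᶠ k in L, (m k).real univ < M + 1 := hmass.eventually (gt_mem_nhds (by linarith))
  have e2 := Metric.tendsto_nhds.1 (h g) (ε / 4) (by positivity)
  filter_upwards [e1, e2] with k hk1 hk2
  rw [Real.dist_eq] at hk2 ⊢
  have a1 := hg (m k) inferInstance
  have a2 := hg m₀ inferInstance
  have b1 : ε / (4 * (M + 1)) * (m k).real univ ≤ ε / 4 := by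
    calc _ ≤ ε / (4 * (M + 1)) * (M + 1) := by gcongr
      _ = ε / 4 := by field_simp
  have b2 : ε / (4 * (M + 1)) * m₀.real univ ≤ ε / 4 := by
    calc _ ≤ ε / (4 * (M + 1)) * (M + 1) := by gcongr; linarith
      _ = ε / 4 := by field_simp
  have c1 := abs_le.1 (a1.trans b1)
  have c2 := abs_le.1 (a2.trans b2)
  have c3 := abs_lt.1 hk2
  rw [abs_lt]
  constructor <;> linarith [c1.1, c1.2, c2.1, c2.2, c3.1, c3.2]

theorem measure_eq_of_test {r : S →ₗ[ℝ] C(K, ℝ)} (hr : DenseRange r)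
    (h1 : ∃ e, r e = 1) {m m' : Measure K} [IsFiniteMeasure m] [IsFiniteMeasure m']
    (h : ∀ g, ∫ x, r g x ∂m = ∫ x, r g x ∂m') : m = m' := by
  refine ext_of_forall_integral_eq_of_IsFiniteMeasure fun f => ?_
  refine tendsto_nhds_unique (f := fun _ : ℕ => ∫ x, f x ∂m) (l := atTop) tendsto_const_nhds ?_
  exact tendsto_integral_continuousMap_of_test hr h1 (m := fun _ : ℕ => m) (m₀ := m')
    (fun g => by rw [h g]; exact tendsto_const_nhds) f.toContinuousMap

/-- The difference of the two functionals is positive, hence it is a measure. -/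
theorem measure_le_of_test {r : S →ₗ[ℝ] C(K, ℝ)} (hr : DenseRange r)
    (h1 : ∃ e, r e = 1) {m m' : Measure K} [IsFiniteMeasure m] [IsFiniteMeasure m']
    (h : ∀ g, 0 ≤ r g → ∫ x, r g x ∂m ≤ ∫ x, r g x ∂m') : m ≤ m' := by
  let ℓ : S →ₗ[ℝ] ℝ :=
    { toFun := fun g => ∫ x, r g x ∂m' - ∫ x, r g x ∂m
      map_add' := fun g g' => by
        simp only [map_add, ContinuousMap.add_apply]
        rw [integral_add (integrable_continuousMap m _) (integrable_continuousMap m _),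
          integral_add (integrable_continuousMap m' _) (integrable_continuousMap m' _)]
        ring
      map_smul' := fun a g => by
        simp only [map_smul, ContinuousMap.smul_apply, smul_eq_mul, RingHom.id_apply]
        rw [integral_const_mul, integral_const_mul]
        ring }
  obtain ⟨m'', hfin, hm''⟩ := exists_measure_of_pos_functional hr h1 ℓ
    fun g hg => sub_nonneg.2 (h g hg)
  have : m' = m + m'' := measure_eq_of_test hr h1 fun g => by
    rw [integral_add_measure (integrable_continuousMap m _) (integrable_continuousMap m'' _),
      ← hm'']
    change _ = _ + (∫ x, r g x ∂m' - ∫ x, r g x ∂m)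
    ring
  rw [this]
  exact Measure.le_add_right le_rfl

/-- The `n`-Lipschitz lower envelope of a bounded function. -/
noncomputable def lowerEnvelope {Y : Type*} [PseudoMetricSpace Y] (F : Y → ℝ) (n : ℕ) (x : Y) : ℝ :=
  ⨅ y, (F y + n * dist x y)

section Envelope

variable {Y : Type*} [PseudoMetricSpace Y] {F : Y → ℝ} {b : ℝ}

theorem bddBelow_lowerEnvelope (hF : ∀ x, |F x| ≤ b) (n : ℕ) (x : Y) :
    BddBelow (range fun y => F y + n * dist x y) := by
  refine ⟨-b, ?_⟩
  rintro _ ⟨y, rfl⟩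
  have := (abs_le.1 (hF y)).1
  have : 0 ≤ n * dist x y := by positivity
  simp only
  linarith

theorem lowerEnvelope_le (hF : ∀ x, |F x| ≤ b) (n : ℕ) (x : Y) : lowerEnvelope F n x ≤ F x := by
  have h := ciInf_le (bddBelow_lowerEnvelope hF n x) x
  rw [dist_self, mul_zero, add_zero] at h
  exact h

theorem neg_le_lowerEnvelope (hF : ∀ x, |F x| ≤ b) (n : ℕ) (x : Y) : -b ≤ lowerEnvelope F n x := by
  have : Nonempty Y := ⟨x⟩
  refine le_ciInf fun y => ?_
  have := (abs_le.1 (hF y)).1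
  have : 0 ≤ n * dist x y := by positivity
  linarith

theorem continuous_lowerEnvelope (hF : ∀ x, |F x| ≤ b) (n : ℕ) :
    Continuous (lowerEnvelope F n) := by
  have : LipschitzWith n (lowerEnvelope F n) := by
    refine LipschitzWith.of_le_add_mul _ fun x z => ?_
    have : Nonempty Y := ⟨x⟩
    rw [← sub_le_iff_le_add]
    refine le_ciInf fun y => ?_
    have h1 := ciInf_le (bddBelow_lowerEnvelope hF n x) y
    have h2 : (n : ℝ) * dist x y ≤ n * (dist x z + dist z y) := by
      gcongr; exact dist_triangle _ _ _
    simp only [lowerEnvelope] at *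
    push_cast
    linarith
  exact this.continuous

/-- The lower envelopes increase to the function at its points of continuity, which reduces
functions that are continuous almost everywhere to continuous ones. -/
theorem tendsto_lowerEnvelope (hF : ∀ x, |F x| ≤ b) {x : Y} (hx : ContinuousAt F x) :
    Tendsto (fun n => lowerEnvelope F n x) atTop (𝓝 (F x)) := by
  have : Nonempty Y := ⟨x⟩
  rw [Metric.tendsto_atTop]
  intro ε hε
  obtain ⟨δ, hδ, hδx⟩ := Metric.continuousAt_iff.1 hx (ε / 2) (by positivity)
  obtain ⟨N, hN⟩ := exists_nat_gt (2 * b / δ)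
  refine ⟨N, fun n hn => ?_⟩
  have hup := lowerEnvelope_le hF n x
  have hlow : F x - ε / 2 ≤ lowerEnvelope F n x := by
    refine le_ciInf fun y => ?_
    rcases lt_or_ge (dist y x) δ with hy | hy
    · have h1 := abs_lt.1 (hδx hy)
      have : 0 ≤ n * dist x y := by positivity
      linarith [h1.1]
    · have h1 := (abs_le.1 (hF y)).1
      have h2 := (abs_le.1 (hF x)).2
      have h3 : 2 * b ≤ n * dist x y := by
        rw [div_lt_iff₀ hδ] at hN
        rw [dist_comm] at hy
        have h4 : (N : ℝ) ≤ n := by exact_mod_cast hn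
        have h5 : (N : ℝ) * δ ≤ n * dist x y := by gcongr
        linarith
      linarith
  rw [Real.dist_eq, abs_lt]
  constructor <;> linarith

end Envelope

/-- A sequence of finite measures converging on test functions converges on all the bounded
measurable functions which are almost everywhere continuous for the limit. -/
theorem tendsto_integral_of_ae_continuousAt {r : S →ₗ[ℝ] C(K, ℝ)} (hr : DenseRange r)
    (h1 : ∃ e, r e = 1) {m : ℕ → Measure K} {m₀ : Measure K}
    [∀ k, IsFiniteMeasure (m k)] [IsFiniteMeasure m₀]
    (h : ∀ g, Tendsto (fun k => ∫ x, r g x ∂m k) atTop (𝓝 (∫ x, r g x ∂m₀))) {F : K → ℝ}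
    (hFm : Measurable F) {b : ℝ} (hFb : ∀ x, |F x| ≤ b) (hF : ∀ᵐ x ∂m₀, ContinuousAt F x) :
    Tendsto (fun k => ∫ x, F x ∂m k) atTop (𝓝 (∫ x, F x ∂m₀)) := by
  let _ : MetricSpace K := TopologicalSpace.metrizableSpaceMetric K
  have hint : ∀ m' : Measure K, IsFiniteMeasure m' → ∀ G : K → ℝ, Measurable G →
      (∀ x, |G x| ≤ b) → Integrable G m' := fun m' _ G hG hGb =>
    Integrable.of_bound hG.aestronglyMeasurable b (Eventually.of_forall hGb)
  have low : ∀ G : K → ℝ, Measurable G → (∀ x, |G x| ≤ b) → (∀ᵐ x ∂m₀, ContinuousAt G x) →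
      ∀ c < ∫ x, G x ∂m₀, ∀ᶠ k in atTop, c < ∫ x, G x ∂m k := by
    intro G hG hGb hGc c hc
    have hG' : ∀ n x, |lowerEnvelope G n x| ≤ b := fun n x => by
      have := (abs_le.1 (hGb x)).2
      have h3 := lowerEnvelope_le hGb n x
      exact abs_le.2 ⟨neg_le_lowerEnvelope hGb n x, by linarith⟩
    have hlim : Tendsto (fun n => ∫ x, lowerEnvelope G n x ∂m₀) atTop (𝓝 (∫ x, G x ∂m₀)) := by
      refine tendsto_integral_of_dominated_convergence (fun _ => b)
        (fun n => (continuous_lowerEnvelope hGb n).measurable.aestronglyMeasurable)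
        (integrable_const _) (fun n => Eventually.of_forall (hG' n)) ?_
      filter_upwards [hGc] with x hx using tendsto_lowerEnvelope hGb hx
    obtain ⟨n, hn⟩ := (hlim.eventually (lt_mem_nhds hc)).exists
    have := tendsto_integral_continuousMap_of_test hr h1 h
      ⟨lowerEnvelope G n, continuous_lowerEnvelope hGb n⟩
    filter_upwards [this.eventually (lt_mem_nhds hn)] with k hk
    refine hk.trans_le (integral_mono (hint _ inferInstance _
      (continuous_lowerEnvelope hGb n).measurable (hG' n)) (hint _ inferInstance _ hG hGb)
      fun x => lowerEnvelope_le hGb n x)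
  refine tendsto_order.2 ⟨low F hFm hFb hF, fun c hc => ?_⟩
  have := low (fun x => -F x) hFm.neg (fun x => by rw [abs_neg]; exact hFb x)
    (hF.mono fun x hx => hx.neg) (-c) (by rw [integral_neg]; linarith)
  filter_upwards [this] with k hk
  rw [integral_neg] at hk
  linarith

/-- Test functions are dense in `L¹`. -/
theorem exists_test_integral_sub_le {r : S →ₗ[ℝ] C(K, ℝ)} (hr : DenseRange r)
    {m : Measure K} [IsFiniteMeasure m] {f : K → ℝ} (hf : Integrable f m) {ε : ℝ} (hε : 0 < ε) :
    ∃ g, ∫ x, |f x - r g x| ∂m ≤ ε := by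
  let _ : MetricSpace K := TopologicalSpace.metrizableSpaceMetric K
  obtain ⟨c, hc, hci⟩ := hf.exists_boundedContinuous_integral_sub_le (half_pos hε)
  have hM : 0 ≤ m.real univ := measureReal_nonneg
  obtain ⟨g, hg⟩ := exists_test_near hr c.toContinuousMap
    (show 0 < ε / 2 / (m.real univ + 1) by positivity)
  refine ⟨g, ?_⟩
  have hgi := integrable_continuousMap m (r g)
  calc ∫ x, |f x - r g x| ∂m ≤ ∫ x, (‖f x - c x‖ + ε / 2 / (m.real univ + 1)) ∂m := by
        refine integral_mono (hf.sub hgi).abs ((hf.sub hci).norm.add (integrable_const _)) ?_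
        intro x
        have := hg x
        refine (abs_sub_le (f x) (c x) (r g x)).trans (add_le_add le_rfl ?_)
        exact this
    _ = ∫ x, ‖f x - c x‖ ∂m + ε / 2 / (m.real univ + 1) * m.real univ := by
        have hi : Integrable (fun x => ‖f x - c x‖) m := (hf.sub hci).norm
        rw [integral_add hi (integrable_const _), integral_const, smul_eq_mul,
          mul_comm]
    _ ≤ ε / 2 + ε / 2 / (m.real univ + 1) * (m.real univ + 1) := by
        gcongr; linarith
    _ = ε := by field_simp; ring

/-- Nonnegative integrable functions are approximated in `L¹` by nonnegative test functions: the
positive part of an approximation is approximated uniformly, and a small constant is added. -/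
theorem exists_nonneg_test_integral_sub_le {r : S →ₗ[ℝ] C(K, ℝ)} (hr : DenseRange r)
    (h1 : ∃ e, r e = 1) {m : Measure K} [IsFiniteMeasure m] {f : K → ℝ} (hf : Integrable f m)
    (hf0 : ∀ x, 0 ≤ f x) {ε : ℝ} (hε : 0 < ε) :
    ∃ g, 0 ≤ r g ∧ ∫ x, |f x - r g x| ∂m ≤ ε := by
  obtain ⟨e, he⟩ := h1
  obtain ⟨g₁, hg₁⟩ := exists_test_integral_sub_le hr hf (half_pos hε)
  have hM : 0 ≤ m.real univ := measureReal_nonneg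
  set η := ε / 4 / (m.real univ + 1) with hη
  have hη0 : 0 < η := by positivity
  obtain ⟨g, hg⟩ := exists_test_near hr (r g₁ ⊔ 0) hη0
  have hg' : ∀ x, |max (r g₁ x) 0 - r g x| ≤ η := hg
  refine ⟨g + η • e, fun x => ?_, ?_⟩
  · have := (abs_le.1 (hg' x)).2
    have h2 : 0 ≤ max (r g₁ x) 0 := le_max_right _ _
    simp [he]; linarith
  have hgi := integrable_continuousMap m (r (g + η • e))
  have hgi₁ := integrable_continuousMap m (r g₁)
  calc ∫ x, |f x - r (g + η • e) x| ∂m ≤ ∫ x, (|f x - r g₁ x| + 2 * η) ∂m := by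
        refine integral_mono (hf.sub hgi).abs ((hf.sub hgi₁).abs.add (integrable_const _)) ?_
        intro x
        have e1 : r (g + η • e) x = r g x + η := by simp [he]
        simp only [e1]
        have h3 : |f x - max (r g₁ x) 0| ≤ |f x - r g₁ x| := by
          have := abs_max_sub_max_le_abs (f x) (r g₁ x) 0
          rwa [max_eq_left (hf0 x)] at this
        have h4 := hg' x
        have h5 := abs_le.1 h3
        have h6 := abs_le.1 h4
        rw [abs_le]
        constructor <;> linarith [h5.1, h5.2, h6.1, h6.2]
    _ = ∫ x, |f x - r g₁ x| ∂m + 2 * η * m.real univ := by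
        have hi : Integrable (fun x => |f x - r g₁ x|) m := (hf.sub hgi₁).abs
        rw [integral_add hi (integrable_const _), integral_const, smul_eq_mul,
          mul_comm]
    _ ≤ ε / 2 + 2 * η * (m.real univ + 1) := by
        gcongr; linarith
    _ = ε := by rw [hη]; field_simp; ring

end TestFunctions

/-! ### Duality for the transfer operator -/

section TransferDuality

variable {Y : Type*} [MeasurableSpace Y] {T : Y → Y} {ν : Measure Y}

theorem integrable_transfer (T : Y → Y) (ν : Measure Y) (f : Y → ℂ) :
    Integrable (transfer T ν f) ν :=
  ComplexMeasure.integrable_rnDeriv _ _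

theorem integral_transfer_mul [IsFiniteMeasure ν] (hT : Measure.QuasiMeasurePreserving T ν ν)
    {f : Y → ℂ} (hf : Integrable f ν) {g : Y → ℂ} (hg : Measurable g) {b : ℝ}
    (hb : ∀ x, ‖g x‖ ≤ b) :
    ∫ x, transfer T ν f x * g x ∂ν = ∫ x, f x * g (T x) ∂ν := by
  have hL := integrable_transfer T ν f
  -- The case of simple functions, by linearity.
  have hsimple : ∀ s : SimpleFunc Y ℂ,
      ∫ x, transfer T ν f x * s x ∂ν = ∫ x, f x * s (T x) ∂ν := by
    intro s
    have hbs : ∀ s : SimpleFunc Y ℂ, ∃ c, ∀ x, ‖s x‖ ≤ c := fun s => s.exists_forall_norm_le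
    have hi1 : ∀ s : SimpleFunc Y ℂ, Integrable (fun x => transfer T ν f x * s x) ν := fun s => by
      obtain ⟨c, hc⟩ := hbs s
      exact hL.mul_bdd s.aestronglyMeasurable (Eventually.of_forall hc)
    have hi2 : ∀ s : SimpleFunc Y ℂ, Integrable (fun x => f x * s (T x)) ν := fun s => by
      obtain ⟨c, hc⟩ := hbs s
      exact hf.mul_bdd (s.measurable.comp hT.measurable).aestronglyMeasurable
        (Eventually.of_forall fun x => hc _)
    induction s using SimpleFunc.induction with
    | const c hs =>
      rename_i s
      have e1 : ∀ F : Y → ℂ, ∀ x, F x * (SimpleFunc.piecewise s hs (SimpleFunc.const Y c)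
          (SimpleFunc.const Y 0)) x = s.indicator (fun x => F x * c) x := fun F x => by
        by_cases hx : x ∈ s <;> simp [hx]
      have e2 : ∀ x, f x * (SimpleFunc.piecewise s hs (SimpleFunc.const Y c)
          (SimpleFunc.const Y 0)) (T x) = (T ⁻¹' s).indicator (fun x => f x * c) x := fun x => by
        by_cases hx : T x ∈ s <;> simp [hx]
      simp only [e1, e2]
      rw [integral_indicator hs, integral_indicator (hT.measurable hs), integral_mul_const,
        integral_mul_const, setIntegral_transfer hT hf hs]
    | add _ h1 h2 =>
      simp only [SimpleFunc.coe_add, Pi.add_apply, mul_add]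
      rw [integral_add (hi1 _) (hi1 _), integral_add (hi2 _) (hi2 _), h1, h2]
  have hsm := hg.stronglyMeasurable
  have hb0 : ∀ x, 0 ≤ b := fun x => (norm_nonneg _).trans (hb x)
  rcases isEmpty_or_nonempty Y with hY | ⟨⟨y⟩⟩
  · simp [integral_of_isEmpty]
  have hb0 := hb0 y
  have l1 : Tendsto (fun n => ∫ x, transfer T ν f x * hsm.approxBounded b n x ∂ν) atTop
      (𝓝 (∫ x, transfer T ν f x * g x ∂ν)) := by
    refine tendsto_integral_of_dominated_convergence (fun x => ‖transfer T ν f x‖ * b)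
      (fun n => hL.aestronglyMeasurable.mul (hsm.approxBounded b n).aestronglyMeasurable)
      (hL.norm.mul_const b) (fun n => Eventually.of_forall fun x => ?_)
      (Eventually.of_forall fun x => ?_)
    · rw [norm_mul]
      gcongr
      exact hsm.norm_approxBounded_le hb0 n x
    · exact (hsm.tendsto_approxBounded_of_norm_le (hb x)).const_mul _
  have l2 : Tendsto (fun n => ∫ x, f x * hsm.approxBounded b n (T x) ∂ν) atTop
      (𝓝 (∫ x, f x * g (T x) ∂ν)) := by
    refine tendsto_integral_of_dominated_convergence (fun x => ‖f x‖ * b)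
      (fun n => hf.aestronglyMeasurable.mul
        ((hsm.approxBounded b n).measurable.comp hT.measurable).aestronglyMeasurable)
      (hf.norm.mul_const b) (fun n => Eventually.of_forall fun x => ?_)
      (Eventually.of_forall fun x => ?_)
    · rw [norm_mul]
      gcongr
      exact hsm.norm_approxBounded_le hb0 n _
    · exact (hsm.tendsto_approxBounded_of_norm_le (hb _)).const_mul _
  simp only [hsimple] at l1
  exact tendsto_nhds_unique l1 l2

theorem integral_iterate_transfer_mul [IsFiniteMeasure ν]
    (hT : Measure.QuasiMeasurePreserving T ν ν) {f : Y → ℂ} (hf : Integrable f ν) {g : Y → ℂ}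
    (hg : Measurable g) {b : ℝ} (hb : ∀ x, ‖g x‖ ≤ b) (n : ℕ) :
    ∫ x, (transfer T ν)^[n] f x * g x ∂ν = ∫ x, f x * g (T^[n] x) ∂ν := by
  induction n generalizing f with
  | zero => rfl
  | succ n ih =>
    rw [Function.iterate_succ_apply, ih (integrable_transfer _ _ _)]
    exact integral_transfer_mul hT hf (hg.comp (hT.measurable.iterate n)) (fun x => hb _)

/-- The transfer operator preserves nonnegativity. -/
theorem exists_nonneg_ae_eq_transfer [IsFiniteMeasure ν]
    (hT : Measure.QuasiMeasurePreserving T ν ν) {φ : Y → ℝ} (hφ : ∀ x, 0 ≤ φ x)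
    (hi : Integrable (fun x => (φ x : ℂ)) ν) :
    ∃ ψ : Y → ℝ, (∀ x, 0 ≤ ψ x) ∧ transfer T ν (fun x => (φ x : ℂ)) =ᵐ[ν] fun x => (ψ x : ℂ) := by
  set L := transfer T ν (fun x => (φ x : ℂ)) with hL
  have hLi : Integrable L ν := integrable_transfer _ _ _
  have hset : ∀ s, MeasurableSet s → ∫ x in s, L x ∂ν = ((∫ x in T ⁻¹' s, φ x ∂ν : ℝ) : ℂ) :=
    fun s hs => by rw [hL, setIntegral_transfer hT hi hs, integral_complex_ofReal]
  have hre : 0 ≤ᵐ[ν] fun x => (L x).re := by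
    refine ae_nonneg_of_forall_setIntegral_nonneg hLi.re fun s hs _ => ?_
    have : ∫ x in s, (L x).re ∂ν = (∫ x in s, L x ∂ν).re := integral_re hLi.integrableOn
    rw [this, hset s hs, Complex.ofReal_re]
    exact integral_nonneg hφ
  have him : (fun x => (L x).im) =ᵐ[ν] 0 := by
    refine Integrable.ae_eq_zero_of_forall_setIntegral_eq_zero hLi.im fun s hs _ => ?_
    have : ∫ x in s, (L x).im ∂ν = (∫ x in s, L x ∂ν).im := integral_im hLi.integrableOn
    refine this.trans ?_
    rw [hset s hs, Complex.ofReal_im]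
  refine ⟨fun x => max (L x).re 0, fun x => le_max_right _ _, ?_⟩
  filter_upwards [hre, him] with x h1 h2
  apply Complex.ext
  · simpa using (max_eq_left h1).symm
  · simpa using h2

end TransferDuality

/-! ### Cones of measures in a space of distributions -/

/-- A space `H` of generalized complex measures on a compact space `K`: elements `u` of `H` are
determined by their pairings `ev g u` with the elements `g` of a space `S` of test functions. The
continuous function on `K` defined by `g` is `r g`; these functions are dense in `C(K, ℝ)` and
include the constants. The map `r` need not be injective: distinct smooth functions on a manifold
may agree on `K`. -/
structure TestPairing (K S H : Type*) [TopologicalSpace K] [CompactSpace K] [AddCommGroup S]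
    [Module ℝ S] [NormedAddCommGroup H] [NormedSpace ℂ H] where
  r : S →ₗ[ℝ] C(K, ℝ)
  dense : DenseRange r
  one : ∃ e, r e = 1
  ev : S → H →L[ℂ] ℂ
  sep : ∀ u, (∀ g, ev g u = 0) → u = 0
  ev_add : ∀ g g', ev (g + g') = ev g + ev g'
  ev_smul : ∀ (a : ℝ) g u, ev (a • g) u = a * ev g u

namespace TestPairing

variable {K S H : Type*} [TopologicalSpace K] [CompactSpace K] [T2Space K]
  [SecondCountableTopology K] [MeasurableSpace K] [BorelSpace K] [AddCommGroup S]
  [Module ℝ S] [NormedAddCommGroup H] [NormedSpace ℂ H]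
  (Θ : TestPairing K S H) (ν : Measure K)

/-- The element `u` is the bounded function `φ`, that is, the measure `φ dν`. -/
def IsBdd (u : H) (φ : K → ℂ) : Prop :=
  MemLp φ ∞ ν ∧ ∀ g, Θ.ev g u = ∫ x, φ x * (Θ.r g x : ℂ) ∂ν

/-- The closure of the set of bounded nonnegative functions. -/
def cone : Set H :=
  closure {u | ∃ φ : K → ℝ, (∀ x, 0 ≤ φ x) ∧ Θ.IsBdd ν u fun x => (φ x : ℂ)}

/-- The element `u` of the cone is the finite measure `m`. Membership in the cone is part of the
notion, since it is what allows approximation of `m` by bounded functions. -/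
structure Represents (u : H) (m : Measure K) : Prop where
  mem_cone : u ∈ Θ.cone ν
  finite : IsFiniteMeasure m
  ev_eq : ∀ g, Θ.ev g u = ((∫ x, Θ.r g x ∂m : ℝ) : ℂ)

/-- `M` is the multiplication by the function `f`, the product being the usual one on bounded
functions. -/
def IsMul (f : K → ℂ) (M : H →L[ℂ] H) : Prop :=
  ∀ u φ, Θ.IsBdd ν u φ → Θ.IsBdd ν (M u) fun x => f x * φ x

/-- `A` is the extension of the transfer operator of `T`, bounded functions are dense, test
functions act by multiplication, and the measures in the cone do not charge the discontinuities
of `T`. -/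
structure IsTransferSystem (T : K → K) (A : H →L[ℂ] H) : Prop where
  finite : IsFiniteMeasure ν
  qmp : Measure.QuasiMeasurePreserving T ν ν
  dense : Dense {u | ∃ φ, Θ.IsBdd ν u φ}
  mul : ∀ g, ∃ M, Θ.IsMul ν (fun x => (Θ.r g x : ℂ)) M
  transfer : ∀ u φ, Θ.IsBdd ν u φ → Θ.IsBdd ν (A u) (transfer T ν φ)
  noMass : ∀ u m, Θ.Represents ν u m → ∀ᵐ x ∂m, ContinuousAt T x

variable {Θ ν}

theorem eq_of_ev {u v : H} (h : ∀ g, Θ.ev g u = Θ.ev g v) : u = v :=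
  sub_eq_zero.1 (Θ.sep _ fun g => by rw [map_sub, h, sub_self])

theorem IsBdd.congr {u : H} {φ ψ : K → ℂ} (h : Θ.IsBdd ν u φ) (hφψ : φ =ᵐ[ν] ψ) :
    Θ.IsBdd ν u ψ :=
  ⟨(memLp_congr_ae hφψ).1 h.1, fun g => by
    rw [h.2 g]
    refine integral_congr_ae ?_
    filter_upwards [hφψ] with x hx
    rw [hx]⟩

theorem IsBdd.integrable [IsFiniteMeasure ν] {u : H} {φ : K → ℂ} (h : Θ.IsBdd ν u φ) :
    Integrable φ ν := h.1.integrable le_top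

theorem norm_r_le (g : S) (x : K) : ‖((Θ.r g x : ℝ) : ℂ)‖ ≤ ‖Θ.r g‖ := by
  rw [Complex.norm_real]
  exact (Θ.r g).norm_coe_le_norm x

theorem measurable_r (g : S) : Measurable fun x => ((Θ.r g x : ℝ) : ℂ) :=
  (Complex.continuous_ofReal.comp (Θ.r g).continuous).measurable

theorem IsBdd.integrable_mul_r [IsFiniteMeasure ν] {u : H} {φ : K → ℂ} (h : Θ.IsBdd ν u φ) (g : S) :
    Integrable (fun x => φ x * (Θ.r g x : ℂ)) ν :=
  h.integrable.mul_bdd (measurable_r g).aestronglyMeasurable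
    (Eventually.of_forall (norm_r_le g))

theorem IsBdd.add [IsFiniteMeasure ν] {u v : H} {φ ψ : K → ℂ} (hu : Θ.IsBdd ν u φ)
    (hv : Θ.IsBdd ν v ψ) : Θ.IsBdd ν (u + v) fun x => φ x + ψ x :=
  ⟨hu.1.add hv.1, fun g => by
    simp only [add_mul]
    rw [map_add, hu.2, hv.2, integral_add (hu.integrable_mul_r g) (hv.integrable_mul_r g)]⟩

theorem IsBdd.smul {u : H} {φ : K → ℂ} (hu : Θ.IsBdd ν u φ) (c : ℂ) :
    Θ.IsBdd ν (c • u) fun x => c * φ x :=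
  ⟨hu.1.const_mul c, fun g => by
    simp only [mul_assoc]
    rw [map_smul, hu.2, integral_const_mul, smul_eq_mul]⟩

theorem IsMul.one : Θ.IsMul ν (fun _ => 1) 1 := fun u φ h => by simpa using h

theorem isClosed_cone : IsClosed (Θ.cone ν) := isClosed_closure

theorem IsBdd.mem_cone {u : H} {φ : K → ℝ} (h : Θ.IsBdd ν u fun x => (φ x : ℂ))
    (hφ : ∀ x, 0 ≤ φ x) : u ∈ Θ.cone ν := subset_closure ⟨φ, hφ, h⟩

theorem cone_add [IsFiniteMeasure ν] {u v : H} (hu : u ∈ Θ.cone ν) (hv : v ∈ Θ.cone ν) :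
    u + v ∈ Θ.cone ν := by
  refine map_mem_closure₂ continuous_add hu hv ?_
  rintro a ⟨φ, hφ, ha⟩ b ⟨ψ, hψ, hb⟩
  exact ⟨fun x => φ x + ψ x, fun x => add_nonneg (hφ x) (hψ x), by simpa using ha.add hb⟩

theorem cone_smul {u : H} (hu : u ∈ Θ.cone ν) {c : ℝ} (hc : 0 ≤ c) : (c : ℂ) • u ∈ Θ.cone ν := by
  refine map_mem_closure (continuous_const_smul (c : ℂ)) hu ?_
  rintro a ⟨φ, hφ, ha⟩
  exact ⟨fun x => c * φ x, fun x => mul_nonneg hc (hφ x), by simpa using ha.smul (c : ℂ)⟩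

theorem cone_zero [IsFiniteMeasure ν] : (0 : H) ∈ Θ.cone ν :=
  IsBdd.mem_cone (φ := fun _ => 0) ⟨by simp, fun g => by simp⟩ fun _ => le_rfl

theorem IsMul.mem_cone {f : K → ℝ} {M : H →L[ℂ] H} (hM : Θ.IsMul ν (fun x => (f x : ℂ)) M)
    (hf : ∀ x, 0 ≤ f x) {u : H} (hu : u ∈ Θ.cone ν) : M u ∈ Θ.cone ν := by
  refine map_mem_closure M.continuous hu ?_
  rintro a ⟨φ, hφ, ha⟩
  exact ⟨fun x => f x * φ x, fun x => mul_nonneg (hf x) (hφ x), by simpa using hM _ _ ha⟩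

/-- An element of the cone is a positive distribution, hence a measure. -/
theorem exists_represents [IsFiniteMeasure ν] {u : H} (hu : u ∈ Θ.cone ν) :
    ∃ m, Θ.Represents ν u m := by
  have him : ∀ g, (Θ.ev g u).im = 0 := fun g => by
    refine closure_minimal (t := {u : H | (Θ.ev g u).im = 0}) ?_ (isClosed_eq
      (Complex.continuous_im.comp (Θ.ev g).continuous) continuous_const) hu
    rintro a ⟨φ, hφ, ha⟩
    have : ∀ x, (φ x : ℂ) * (Θ.r g x : ℂ) = ((φ x * Θ.r g x : ℝ) : ℂ) := fun x => by push_cast; rfl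
    simp only [Set.mem_ofPred_eq, ha.2 g, this]
    rw [integral_complex_ofReal, Complex.ofReal_im]
  have hre : ∀ g, 0 ≤ Θ.r g → 0 ≤ (Θ.ev g u).re := fun g hg => by
    refine closure_minimal (t := {u : H | 0 ≤ (Θ.ev g u).re}) ?_ (isClosed_le
      continuous_const (Complex.continuous_re.comp (Θ.ev g).continuous)) hu
    rintro a ⟨φ, hφ, ha⟩
    have : ∀ x, (φ x : ℂ) * (Θ.r g x : ℂ) = ((φ x * Θ.r g x : ℝ) : ℂ) := fun x => by push_cast; rfl
    simp only [Set.mem_ofPred_eq, ha.2 g, this]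
    rw [integral_complex_ofReal, Complex.ofReal_re]
    exact integral_nonneg fun x => mul_nonneg (hφ x) (hg x)
  let ℓ : S →ₗ[ℝ] ℝ :=
    { toFun := fun g => (Θ.ev g u).re
      map_add' := fun g g' => by rw [Θ.ev_add]; simp
      map_smul' := fun a g => by rw [Θ.ev_smul]; simp }
  obtain ⟨m, hm, hℓ⟩ := exists_measure_of_pos_functional Θ.dense Θ.one ℓ hre
  refine ⟨m, hu, hm, fun g => Complex.ext ?_ ?_⟩
  · rw [Complex.ofReal_re]; exact hℓ g
  · rw [Complex.ofReal_im]; exact him g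

theorem Represents.unique {u : H} {m m' : Measure K} (h : Θ.Represents ν u m)
    (h' : Θ.Represents ν u m') : m = m' := by
  have := h.finite
  have := h'.finite
  exact measure_eq_of_test Θ.dense Θ.one fun g => by
    have := (h.ev_eq g).symm.trans (h'.ev_eq g)
    exact_mod_cast this

theorem Represents.add [IsFiniteMeasure ν] {u v : H} {m m' : Measure K}
    (h : Θ.Represents ν u m) (h' : Θ.Represents ν v m') : Θ.Represents ν (u + v) (m + m') := by
  have := h.finite
  have := h'.finite
  refine ⟨cone_add h.mem_cone h'.mem_cone, inferInstance, fun g => ?_⟩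
  rw [map_add, h.ev_eq, h'.ev_eq, integral_add_measure (integrable_continuousMap _ _)
    (integrable_continuousMap _ _), Complex.ofReal_add]

theorem IsBdd.represents [IsFiniteMeasure ν] {u : H} {φ : K → ℝ}
    (h : Θ.IsBdd ν u fun x => (φ x : ℂ)) (hφ : ∀ x, 0 ≤ φ x) :
    Θ.Represents ν u (ν.withDensity fun x => ENNReal.ofReal (φ x)) := by
  have hi : Integrable φ ν := by simpa using h.integrable.re
  refine ⟨h.mem_cone hφ, isFiniteMeasure_withDensity_ofReal hi.2, fun g => ?_⟩
  rw [h.2 g, integral_withDensity_eq_integral_toReal_smul₀ hi.aemeasurable.ennreal_ofReal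
    (Eventually.of_forall fun x => ENNReal.ofReal_lt_top), ← integral_complex_ofReal]
  refine integral_congr_ae (Eventually.of_forall fun x => ?_)
  simp [ENNReal.toReal_ofReal (hφ x)]

/-- Approximation of a measure in the cone by bounded nonnegative functions, in `H` and against
bounded functions which are continuous almost everywhere. -/
theorem Represents.exists_seq [IsFiniteMeasure ν] {u : H} {m : Measure K}
    (h : Θ.Represents ν u m) : ∃ (v : ℕ → H) (φ : ℕ → K → ℝ), (∀ k x, 0 ≤ φ k x) ∧
      (∀ k, Θ.IsBdd ν (v k) fun x => (φ k x : ℂ)) ∧ Tendsto v atTop (𝓝 u) ∧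
      ∀ F : K → ℂ, Measurable F → ∀ b : ℝ, (∀ x, ‖F x‖ ≤ b) → (∀ᵐ x ∂m, ContinuousAt F x) →
        Tendsto (fun k => ∫ x, (φ k x : ℂ) * F x ∂ν) atTop (𝓝 (∫ x, F x ∂m)) := by
  obtain ⟨v, hv, hvu⟩ := mem_closure_iff_seq_limit.1 h.mem_cone
  choose φ hφ hvφ using hv
  refine ⟨v, φ, hφ, hvφ, hvu, fun F hF b hb hFc => ?_⟩
  have hm := h.finite
  have hrep := fun k => (hvφ k).represents (hφ k)
  have := fun k => (hrep k).finite
  have htest : ∀ g, Tendsto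
      (fun k => ∫ x, Θ.r g x ∂(ν.withDensity fun x => ENNReal.ofReal (φ k x))) atTop
      (𝓝 (∫ x, Θ.r g x ∂m)) := fun g => by
    have h1 : Tendsto (fun k => (Θ.ev g (v k)).re) atTop (𝓝 (Θ.ev g u).re) :=
      ((Complex.continuous_re.comp (Θ.ev g).continuous).tendsto u).comp hvu
    rw [h.ev_eq g, Complex.ofReal_re] at h1
    refine h1.congr fun k => ?_
    rw [(hrep k).ev_eq g, Complex.ofReal_re]
  have hreal : ∀ G : K → ℝ, Measurable G → (∀ x, |G x| ≤ b) → (∀ᵐ x ∂m, ContinuousAt G x) →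
      Tendsto (fun k => ∫ x, φ k x * G x ∂ν) atTop (𝓝 (∫ x, G x ∂m)) := by
    intro G hG hGb hGc
    refine (tendsto_integral_of_ae_continuousAt Θ.dense Θ.one htest hG hGb hGc).congr fun k => ?_
    have hi : Integrable (φ k) ν := by simpa using (hvφ k).integrable.re
    rw [integral_withDensity_eq_integral_toReal_smul₀ hi.aemeasurable.ennreal_ofReal
      (Eventually.of_forall fun x => ENNReal.ofReal_lt_top)]
    refine integral_congr_ae (Eventually.of_forall fun x => ?_)
    simp [ENNReal.toReal_ofReal (hφ k x)]
  have h1 := hreal (fun x => (F x).re) (Complex.measurable_re.comp hF)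
    (fun x => (Complex.abs_re_le_norm _).trans (hb x))
    (hFc.mono fun x hx => Complex.continuous_re.continuousAt.comp hx)
  have h2 := hreal (fun x => (F x).im) (Complex.measurable_im.comp hF)
    (fun x => (Complex.abs_im_le_norm _).trans (hb x))
    (hFc.mono fun x hx => Complex.continuous_im.continuousAt.comp hx)
  have hFi : ∀ m' : Measure K, IsFiniteMeasure m' → Integrable F m' := fun m' _ =>
    Integrable.of_bound hF.aestronglyMeasurable b (Eventually.of_forall hb)
  have h3 := ((Complex.continuous_ofReal.tendsto _).comp h1).add
    (((Complex.continuous_ofReal.tendsto _).comp h2).mul_const Complex.I)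
  have e1 : ∀ G : K → ℂ, ∀ m' : Measure K, Integrable G m' →
      ((∫ x, (G x).re ∂m' : ℝ) : ℂ) + ((∫ x, (G x).im ∂m' : ℝ) : ℂ) * Complex.I =
        ∫ x, G x ∂m' := fun G m' hG => integral_re_add_im hG
  rw [e1 F m (hFi m hm)] at h3
  refine h3.congr fun k => ?_
  have hFφ : Integrable (fun x => (φ k x : ℂ) * F x) ν :=
    (hvφ k).integrable.mul_bdd hF.aestronglyMeasurable (Eventually.of_forall hb)
  rw [← e1 _ _ hFφ]
  simp

end TestPairing

namespace TestPairing

variable {K S H : Type*} [TopologicalSpace K] [CompactSpace K] [T2Space K]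
  [SecondCountableTopology K] [MeasurableSpace K] [BorelSpace K] [AddCommGroup S]
  [Module ℝ S] [NormedAddCommGroup H] [NormedSpace ℂ H]
  {Θ : TestPairing K S H} {ν : Measure K} {T : K → K} {A : H →L[ℂ] H}

theorem Represents.smul {u : H} {m : Measure K} (h : Θ.Represents ν u m) {c : ℝ} (hc : 0 ≤ c) :
    Θ.Represents ν ((c : ℂ) • u) (ENNReal.ofReal c • m) := by
  have := h.finite
  refine ⟨cone_smul h.mem_cone hc, Measure.smul_finite m ENNReal.ofReal_ne_top, fun g => ?_⟩
  rw [map_smul, h.ev_eq, integral_smul_measure, ENNReal.toReal_ofReal hc]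
  simp

theorem represents_zero [IsFiniteMeasure ν] : Θ.Represents ν 0 0 :=
  ⟨cone_zero, inferInstance, fun g => by simp⟩

theorem represents_sum [IsFiniteMeasure ν] {ι : Type*} (s : Finset ι) {u : ι → H}
    {m : ι → Measure K} (h : ∀ i ∈ s, Θ.Represents ν (u i) (m i)) :
    Θ.Represents ν (∑ i ∈ s, u i) (∑ i ∈ s, m i) := by
  classical
  induction s using Finset.induction_on with
  | empty => simpa using represents_zero
  | insert i s hi ih =>
    rw [Finset.sum_insert hi, Finset.sum_insert hi]
    exact (h i (Finset.mem_insert_self _ _)).add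
      (ih fun j hj => h j (Finset.mem_insert_of_mem hj))

/-- The order of the cone implies the order of the measures. -/
theorem Represents.le [IsFiniteMeasure ν] {u v : H} {m m' : Measure K} (h : Θ.Represents ν u m)
    (h' : Θ.Represents ν v m') (huv : v - u ∈ Θ.cone ν) : m ≤ m' := by
  obtain ⟨m'', hm''⟩ := exists_represents huv
  have : m' = m + m'' := h'.unique (by simpa using h.add hm'')
  rw [this]
  exact Measure.le_add_right le_rfl

namespace IsTransferSystem

variable (hS : Θ.IsTransferSystem ν T A)

include hS

theorem isBdd_pow {u : H} {φ : K → ℂ} (h : Θ.IsBdd ν u φ) (n : ℕ) :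
    Θ.IsBdd ν ((A ^ n) u) ((PhysicalMeasures.transfer T ν)^[n] φ) := by
  induction n generalizing u φ with
  | zero => simpa using h
  | succ n ih =>
    rw [pow_succ, Function.iterate_succ_apply]
    exact ih (hS.transfer u φ h)

theorem map_mem_cone {u : H} (hu : u ∈ Θ.cone ν) : A u ∈ Θ.cone ν := by
  have := hS.finite
  refine map_mem_closure A.continuous hu ?_
  rintro a ⟨φ, hφ, ha⟩
  obtain ⟨ψ, hψ, hae⟩ := exists_nonneg_ae_eq_transfer hS.qmp hφ ha.integrable
  exact ⟨ψ, hψ, (hS.transfer _ _ ha).congr hae⟩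

theorem pow_mem_cone {u : H} (hu : u ∈ Θ.cone ν) (n : ℕ) : (A ^ n) u ∈ Θ.cone ν := by
  induction n with
  | zero => simpa using hu
  | succ n ih =>
    rw [pow_succ']
    exact hS.map_mem_cone ih

/-- The operator acts on the measures of the cone by push-forward. For bounded functions this is
duality, and it passes to limits since `g ∘ T` is continuous almost everywhere. -/
theorem represents_map {u : H} {m : Measure K} (h : Θ.Represents ν u m) :
    Θ.Represents ν (A u) (m.map T) := by
  have := hS.finite
  have := h.finite
  refine ⟨hS.map_mem_cone h.mem_cone, inferInstance, fun g => ?_⟩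
  obtain ⟨v, φ, hφ, hv, hvu, hlim⟩ := h.exists_seq
  have h1 : Tendsto (fun k => Θ.ev g (A (v k))) atTop (𝓝 (Θ.ev g (A u))) :=
    (((Θ.ev g).continuous.comp A.continuous).tendsto u).comp hvu
  have h2 := hlim (fun x => (Θ.r g (T x) : ℂ)) ((measurable_r g).comp hS.qmp.measurable) ‖Θ.r g‖
    (fun x => norm_r_le g _) (by
      filter_upwards [hS.noMass u m h] with x hx
      exact ((Complex.continuous_ofReal.comp (Θ.r g).continuous).continuousAt).comp hx)
  refine (tendsto_nhds_unique h1 (h2.congr fun k => ?_)).trans ?_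
  · rw [(hS.transfer _ _ (hv k)).2 g]
    exact (integral_transfer_mul hS.qmp (hv k).integrable (measurable_r g) (norm_r_le g)).symm
  · rw [integral_complex_ofReal, integral_map hS.qmp.measurable.aemeasurable
      (Θ.r g).continuous.aestronglyMeasurable]

theorem represents_pow {u : H} {m : Measure K} (h : Θ.Represents ν u m) (n : ℕ) :
    Θ.Represents ν ((A ^ n) u) (m.map T^[n]) := by
  induction n with
  | zero => simpa using h
  | succ n ih =>
    have := hS.represents_map ih
    rw [Measure.map_map hS.qmp.measurable (hS.qmp.measurable.iterate n),
      ← Function.iterate_succ'] at this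
    rw [pow_succ']
    exact this

theorem ae_continuousAt_iterate {u : H} {m : Measure K} (h : Θ.Represents ν u m) (n : ℕ) :
    ∀ᵐ x ∂m, ContinuousAt T^[n] x := by
  induction n with
  | zero => exact Eventually.of_forall fun x => continuousAt_id
  | succ n ih =>
    have h1 := ae_of_ae_map (hS.qmp.measurable.iterate n).aemeasurable
      (hS.noMass _ _ (hS.represents_pow h n))
    filter_upwards [ih, h1] with x hx hx1
    rw [Function.iterate_succ']
    exact ContinuousAt.comp hx1 hx

/-- The correlation of `f` and `g` for a measure of the cone, expressed by multiplication operators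
and powers of `A`. -/
theorem ev_mul_pow_mul {u : H} {m : Measure K} (h : Θ.Represents ν u m) {f g : C(K, ℂ)}
    {Mf Mg : H →L[ℂ] H} (hf : Θ.IsMul ν f Mf) (hg : Θ.IsMul ν g Mg) (n : ℕ) (e : S) :
    Θ.ev e (Mg ((A ^ n) (Mf u))) = ∫ x, f x * (g (T^[n] x) * (Θ.r e (T^[n] x) : ℂ)) ∂m := by
  have := hS.finite
  have := h.finite
  obtain ⟨v, φ, hφ, hv, hvu, hlim⟩ := h.exists_seq
  have h1 : Tendsto (fun k => Θ.ev e (Mg ((A ^ n) (Mf (v k))))) atTop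
      (𝓝 (Θ.ev e (Mg ((A ^ n) (Mf u))))) :=
    (((Θ.ev e).continuous.comp (Mg.continuous.comp
      ((A ^ n).continuous.comp Mf.continuous))).tendsto u).comp hvu
  have hTn := hS.qmp.measurable.iterate n
  have hgb : ∀ x, ‖g x * (Θ.r e x : ℂ)‖ ≤ ‖g‖ * ‖Θ.r e‖ := fun x => by
    rw [norm_mul]
    exact mul_le_mul (g.norm_coe_le_norm x) (norm_r_le e x) (norm_nonneg _) (norm_nonneg _)
  have hgc : Continuous fun x => g x * (Θ.r e x : ℂ) :=
    g.continuous.mul (Complex.continuous_ofReal.comp (Θ.r e).continuous)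
  have h2 := hlim (fun x => f x * (g (T^[n] x) * (Θ.r e (T^[n] x) : ℂ)))
    (f.continuous.measurable.mul (hgc.measurable.comp hTn)) (‖f‖ * (‖g‖ * ‖Θ.r e‖))
    (fun x => by
      rw [norm_mul]
      exact mul_le_mul (f.norm_coe_le_norm x) (hgb _) (norm_nonneg _) (norm_nonneg _)) (by
      filter_upwards [hS.ae_continuousAt_iterate h n] with x hx
      exact f.continuous.continuousAt.mul
        (ContinuousAt.comp (g := fun y => g y * (Θ.r e y : ℂ)) hgc.continuousAt hx))
  refine tendsto_nhds_unique h1 (h2.congr fun k => ?_)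
  have hfv := hf _ _ (hv k)
  rw [(hg _ _ (hS.isBdd_pow hfv n)).2 e]
  have e1 := integral_iterate_transfer_mul hS.qmp hfv.integrable hgc.measurable hgb n
  have e2 : ∀ x, g x * (PhysicalMeasures.transfer T ν)^[n] (fun x => f x * (φ k x : ℂ)) x *
      (Θ.r e x : ℂ) = (PhysicalMeasures.transfer T ν)^[n] (fun x => f x * (φ k x : ℂ)) x *
        (g x * (Θ.r e x : ℂ)) := fun x => by ring
  simp only [e2]
  rw [e1]
  refine integral_congr_ae (Eventually.of_forall fun x => ?_)
  simp only
  ring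

theorem ev_pow_mul {u : H} {m : Measure K} (h : Θ.Represents ν u m) {f : C(K, ℂ)}
    {Mf : H →L[ℂ] H} (hf : Θ.IsMul ν f Mf) (n : ℕ) (e : S) :
    Θ.ev e ((A ^ n) (Mf u)) = ∫ x, f x * (Θ.r e (T^[n] x) : ℂ) ∂m := by
  have := hS.ev_mul_pow_mul h hf (g := 1) (Mg := 1) IsMul.one n e
  simpa using this

/-- The transfer operator contracts the `L¹` norm, so the orbit of a bounded function is weakly
bounded. -/
theorem norm_ev_pow_le {u : H} {φ : K → ℂ} (h : Θ.IsBdd ν u φ) (n : ℕ) (g : S) :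
    ‖Θ.ev g ((A ^ n) u)‖ ≤ ‖Θ.r g‖ * ∫ x, ‖φ x‖ ∂ν := by
  have := hS.finite
  rw [(hS.isBdd_pow h n).2 g,
    integral_iterate_transfer_mul hS.qmp h.integrable (measurable_r g) (norm_r_le g) n]
  refine (norm_integral_le_integral_norm _).trans ?_
  rw [← integral_const_mul]
  refine integral_mono_of_nonneg (Eventually.of_forall fun x => norm_nonneg _)
    (h.integrable.norm.const_mul _) (Eventually.of_forall fun x => ?_)
  simp only
  rw [norm_mul, mul_comm]
  exact mul_le_mul_of_nonneg_right (norm_r_le g _) (norm_nonneg _)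

end IsTransferSystem

/-- A transfer system with a peripheral projection `P` and a function `f₀` which dominates the
images of bounded functions under a power of the transfer operator. -/
structure IsQuasicompactSystem (Θ : TestPairing K S H) (ν : Measure K) (T : K → K) (A : H →L[ℂ] H)
    (P : H →L[ℂ] H) (C δ : ℝ) (φ : ℕ → ℕ) (u₀ : H) (f₀ : K → ℝ) (N₀ : ℕ) : Prop extends
    Θ.IsTransferSystem ν T A, IsPeripheralProjection A P C δ φ where
  f₀_mem : ∀ x, f₀ x ∈ Icc (0 : ℝ) 1
  isBdd_f₀ : Θ.IsBdd ν u₀ fun x => (f₀ x : ℂ)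
  dominates : ∀ ψ : K → ℂ, MemLp ψ ∞ ν →
    ∀ᵐ x ∂ν, (PhysicalMeasures.transfer T ν)^[N₀] ψ x ≠ 0 → f₀ x = 1

end TestPairing

namespace IsPeripheralProjection

variable {H : Type*} [NormedAddCommGroup H] [NormedSpace ℂ H] {A P : H →L[ℂ] H} {C δ : ℝ}
  {φ : ℕ → ℕ} (hP : IsPeripheralProjection A P C δ φ)

include hP

theorem apply_of_mem_range {v : H} (hv : v ∈ P.range) : P v = v := by
  obtain ⟨x, rfl⟩ := hv
  exact DFunLike.congr_fun hP.idem x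

theorem pow_apply_comm (n : ℕ) (x : H) : (A ^ n) (P x) = P ((A ^ n) x) :=
  DFunLike.congr_fun (Commute.pow_left (show Commute A P from hP.comm) n).eq x

theorem pow_mem_range {v : H} (hv : v ∈ P.range) (n : ℕ) : (A ^ n) v ∈ P.range := by
  rw [← hP.apply_of_mem_range hv, hP.pow_apply_comm]
  exact ⟨_, rfl⟩

theorem tendsto_pow : Tendsto (fun j => A ^ φ j) atTop (𝓝 P) := by
  have h1 : Tendsto (fun j => A ^ φ j * (1 - P)) atTop (𝓝 0) := by
    refine squeeze_zero_norm (fun j => hP.contraction _) ?_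
    have := (tendsto_pow_atTop_nhds_zero_of_lt_one hP.δ_pos.le hP.δ_lt_one).comp
      hP.strictMono.tendsto_atTop
    simpa using this.const_mul C
  have := hP.recurrence.add h1
  rw [add_zero] at this
  refine this.congr fun j => ?_
  rw [← mul_add]; simp

theorem tendsto_pow_apply (x : H) : Tendsto (fun j => (A ^ φ j) x) atTop (𝓝 (P x)) :=
  ((ContinuousLinearMap.apply ℂ H x).continuous.tendsto P).comp hP.tendsto_pow

theorem isClosed_of_le {W : Submodule ℂ H} (hW : W ≤ P.range) : IsClosed (W : Set H) := by
  have := hP.finiteRange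
  have : FiniteDimensional ℂ W := Submodule.finiteDimensional_of_le hW
  exact W.closed_of_finiteDimensional

/-- The powers of `A` are invertible on the range of `P`, with bounded inverses. -/
theorem exists_preimage {v : H} (hv : v ∈ P.range) (n : ℕ) :
    ∃ v' ∈ P.range, (A ^ n) v' = v ∧ ‖v'‖ ≤ C * ‖v‖ := by
  have hle : P.range.map ((A ^ n : H →L[ℂ] H) : H →ₗ[ℂ] H) ≤ P.range := by
    rintro _ ⟨x, hx, rfl⟩
    exact hP.pow_mem_range hx n
  have hev := hP.strictMono.tendsto_atTop.eventually (eventually_ge_atTop n)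
  have hlim := hP.tendsto_pow_apply v
  rw [hP.apply_of_mem_range hv] at hlim
  have hmem : v ∈ P.range.map ((A ^ n : H →L[ℂ] H) : H →ₗ[ℂ] H) := by
    refine (hP.isClosed_of_le hle).mem_of_tendsto hlim ?_
    filter_upwards [hev] with j hj
    refine ⟨(A ^ (φ j - n)) v, hP.pow_mem_range hv _, ?_⟩
    change (A ^ n * A ^ (φ j - n)) v = _
    rw [← pow_add, Nat.add_sub_cancel' hj]
  obtain ⟨v', hv', hvv⟩ := hmem
  refine ⟨v', hv', hvv, ?_⟩
  have hlim' := (hP.tendsto_pow_apply v').norm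
  rw [hP.apply_of_mem_range hv'] at hlim'
  refine le_of_tendsto hlim' ?_
  filter_upwards [hev] with j hj
  have : (A ^ φ j) v' = (A ^ (φ j - n)) v := by
    rw [← hvv]
    change _ = (A ^ (φ j - n) * A ^ n) v'
    rw [← pow_add, Nat.sub_add_cancel hj]
  rw [this]
  exact ((A ^ (φ j - n)).le_opNorm v).trans
    (mul_le_mul_of_nonneg_right (hP.norm_pow_le _) (norm_nonneg _))

end IsPeripheralProjection

/-! ### The invariant measure dominating the range of the peripheral projection -/

/-- Pointwise bounds for a family of functionals on a finite-dimensional space are uniform. -/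
theorem exists_uniform_bound_of_finiteDimensional {H : Type*} [NormedAddCommGroup H]
    [NormedSpace ℂ H] (V : Submodule ℂ H) [FiniteDimensional ℂ V] {J : Type*} (L : J → H →L[ℂ] ℂ)
    (w : J → ℝ)
    (h : ∀ v ∈ V, ∃ c : ℝ, 0 ≤ c ∧ ∀ j, ‖L j v‖ ≤ c * w j) :
    ∃ c : ℝ, 0 ≤ c ∧ ∀ v ∈ V, ∀ j, ‖L j v‖ ≤ c * ‖v‖ * w j := by
  let b := Module.finBasis ℂ V
  choose c hc hcL using fun k => h (b k) (b k).2
  let coord : ∀ k, V →L[ℂ] ℂ := fun k => LinearMap.toContinuousLinearMap (b.coord k)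
  have ha : ∀ k, 0 ≤ ‖coord k‖ := fun k => (coord k).opNorm_nonneg
  refine ⟨∑ k, ‖coord k‖ * c k, Finset.sum_nonneg fun k _ => mul_nonneg (ha k) (hc k),
    fun v hv j => ?_⟩
  have hv' : v = ∑ k, coord k ⟨v, hv⟩ • (b k : H) := by
    have := congrArg V.subtype (b.sum_repr ⟨v, hv⟩)
    rw [map_sum] at this
    exact this.symm
  have hcoord : ∀ k, ‖coord k ⟨v, hv⟩‖ ≤ ‖coord k‖ * ‖v‖ := fun k => (coord k).le_opNorm ⟨v, hv⟩
  calc ‖L j v‖ = ‖∑ k, coord k ⟨v, hv⟩ * L j (b k)‖ := by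
        conv_lhs => rw [hv']
        simp
    _ ≤ ∑ k, ‖coord k‖ * ‖v‖ * (c k * w j) := by
        refine (norm_sum_le _ _).trans (Finset.sum_le_sum fun k _ => ?_)
        rw [norm_mul]
        exact mul_le_mul (hcoord k) (hcL k j) (norm_nonneg _)
          (mul_nonneg (ha k) (norm_nonneg _))
    _ = (∑ k, ‖coord k‖ * c k) * ‖v‖ * w j := by
        rw [Finset.sum_mul, Finset.sum_mul]
        exact Finset.sum_congr rfl fun k _ => by ring

namespace TestPairing

variable {K S H : Type*} [TopologicalSpace K] [CompactSpace K] [T2Space K]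
  [SecondCountableTopology K] [MeasurableSpace K] [BorelSpace K] [AddCommGroup S]
  [Module ℝ S] [NormedAddCommGroup H] [NormedSpace ℂ H]
  {Θ : TestPairing K S H} {ν : Measure K} {T : K → K} {A : H →L[ℂ] H}

/-- In the range of `P`, weak convergence implies convergence in norm. -/
theorem tendsto_of_weak {P : H →L[ℂ] H} (hP : FiniteDimensional ℂ P.range) {ι : Type*}
    {L : Filter ι} {x : ι → H} {v : H} (hx : ∀ i, x i ∈ P.range) (hv : v ∈ P.range)
    (h : ∀ g, Tendsto (fun i => Θ.ev g (x i)) L (𝓝 (Θ.ev g v))) : Tendsto x L (𝓝 v) := by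
  obtain ⟨I, c, hc, hI⟩ := exists_norm_le_sum_of_separating P.range Θ.ev fun v _ => Θ.sep v
  rw [tendsto_iff_norm_sub_tendsto_zero]
  have h1 : Tendsto (fun i => c * ∑ g ∈ I, ‖Θ.ev g (x i - v)‖) L (𝓝 (c * ∑ g ∈ I, 0)) := by
    refine (tendsto_finsetSum _ fun g _ => ?_).const_mul c
    have := (h g).sub_const (Θ.ev g v)
    rw [sub_self] at this
    simpa using this.norm
  simp only [Finset.sum_const_zero, mul_zero] at h1
  exact squeeze_zero (fun i => norm_nonneg _)
    (fun i => hI _ (Submodule.sub_mem _ (hx i) hv)) h1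

/-- An element of the range of `P` which is the weak limit of elements of a subspace of this range
belongs to the subspace. -/
theorem mem_of_weak_approx {C δ : ℝ} {φ : ℕ → ℕ} {P : H →L[ℂ] H}
    (hP : IsPeripheralProjection A P C δ φ) {W : Submodule ℂ H} (hW : W ≤ P.range) {v : H}
    (hv : v ∈ P.range)
    (h : ∀ ε > 0, ∃ w ∈ W, ∀ g, ‖Θ.ev g (v - w)‖ ≤ ε * ‖Θ.r g‖) : v ∈ W := by
  choose w hwW hw using fun n : ℕ => h (1 / ((n : ℝ) + 1)) (by positivity)
  refine (hP.isClosed_of_le hW).mem_of_tendsto (b := atTop) (f := w)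
    (tendsto_of_weak (Θ := Θ) hP.finiteRange (fun n => hW (hwW n)) hv fun g => ?_)
    (Eventually.of_forall hwW)
  rw [tendsto_iff_norm_sub_tendsto_zero]
  have h1 : Tendsto (fun n : ℕ => 1 / ((n : ℝ) + 1) * ‖Θ.r g‖) atTop (𝓝 0) := by
    simpa using tendsto_one_div_add_atTop_nhds_zero_nat.mul_const ‖Θ.r g‖
  refine squeeze_zero (fun n => norm_nonneg _) (fun n => ?_) h1
  rw [norm_sub_rev, ← map_sub]
  exact hw n g

/-- A quasicompact system with a fixed point `w` in the range of `P` which is an invariant measure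
`μ` dominating all the elements of this range: they are complex measures whose densities with
respect to `μ` are bounded by `c` times the norm. -/
structure IsPeripheralSystem (Θ : TestPairing K S H) (ν : Measure K) (T : K → K) (A : H →L[ℂ] H)
    (P : H →L[ℂ] H) (C δ : ℝ) (φ : ℕ → ℕ) (u₀ : H) (f₀ : K → ℝ) (N₀ : ℕ) (w : H) (μ : Measure K)
    (c : ℝ) : Prop extends Θ.IsQuasicompactSystem ν T A P C δ φ u₀ f₀ N₀ where
  mem_range : w ∈ P.range
  fixed : A w = w
  represents : Θ.Represents ν w μ
  map_eq : μ.map T = μ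
  c_nonneg : 0 ≤ c
  dominated : ∀ v ∈ P.range, ∀ g, ‖Θ.ev g v‖ ≤ c * ‖v‖ * ∫ x, |Θ.r g x| ∂μ

namespace IsQuasicompactSystem

variable {P : H →L[ℂ] H} {C δ : ℝ} {φ : ℕ → ℕ} {u₀ : H} {f₀ : K → ℝ} {N₀ : ℕ}
  (hQ : Θ.IsQuasicompactSystem ν T A P C δ φ u₀ f₀ N₀)

include hQ

/-- The range of the peripheral projection is spanned by the projections of nonnegative functions
dominated by `f₀`: a bounded function in the image of the `N₀`-th power of the transfer operator
can be approximated in `L¹` by products of `f₀` with test functions, and on the range of `P` weak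
approximation is enough. -/
theorem mem_span_of_mem_range {v : H} (hv : v ∈ P.range) :
    v ∈ Submodule.span ℂ {v | ∃ (w : H) (ψ : K → ℝ) (c : ℝ), (∀ x, 0 ≤ ψ x) ∧ 0 ≤ c ∧
      (∀ x, ψ x ≤ c * f₀ x) ∧ Θ.IsBdd ν w (fun x => (ψ x : ℂ)) ∧ v = P w} := by
  have := hQ.finite
  have hP := hQ.toIsPeripheralProjection
  set D : Set H := {v | ∃ (w : H) (ψ : K → ℝ) (c : ℝ), (∀ x, 0 ≤ ψ x) ∧ 0 ≤ c ∧
      (∀ x, ψ x ≤ c * f₀ x) ∧ Θ.IsBdd ν w (fun x => (ψ x : ℂ)) ∧ v = P w} with hD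
  have hWle : Submodule.span ℂ D ≤ P.range := by
    refine Submodule.span_le.2 ?_
    rintro _ ⟨w, -, -, -, -, -, -, rfl⟩
    exact ⟨w, rfl⟩
  have hf0 : ∀ x, 0 ≤ f₀ x := fun x => (hQ.f₀_mem x).1
  -- Products of test functions with `f₀`.
  have hmul : ∀ g M, Θ.IsMul ν (fun x => (Θ.r g x : ℂ)) M → P (M u₀) ∈ Submodule.span ℂ D := by
    intro g M hM
    set b := ‖Θ.r g‖ with hb
    have hb0 : 0 ≤ b := norm_nonneg _
    have hgb : ∀ x, |Θ.r g x| ≤ b := fun x => (Θ.r g).norm_coe_le_norm x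
    have h1 : P (M u₀ + (b : ℂ) • u₀) ∈ D := by
      refine ⟨_, fun x => (Θ.r g x + b) * f₀ x, 2 * b, fun x => ?_, by positivity, fun x => ?_, ?_,
        rfl⟩
      · have := (abs_le.1 (hgb x)).1
        exact mul_nonneg (by linarith) (hf0 x)
      · have := (abs_le.1 (hgb x)).2
        exact mul_le_mul_of_nonneg_right (by linarith) (hf0 x)
      · have := (hM _ _ hQ.isBdd_f₀).add (hQ.isBdd_f₀.smul (b : ℂ))
        refine this.congr (Eventually.of_forall fun x => ?_)
        push_cast
        ring
    have h2 : P ((b : ℂ) • u₀) ∈ D := by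
      refine ⟨_, fun x => b * f₀ x, b, fun x => mul_nonneg hb0 (hf0 x), hb0, fun x => le_rfl, ?_,
        rfl⟩
      simpa using hQ.isBdd_f₀.smul (b : ℂ)
    have := Submodule.sub_mem (Submodule.span ℂ D) (Submodule.subset_span h1)
      (Submodule.subset_span h2)
    simpa using this
  have hbdd : ∀ u ∈ {u | ∃ ψ, Θ.IsBdd ν u ψ}, P ((A ^ N₀) u) ∈ Submodule.span ℂ D := by
    rintro u ⟨ψ, hu⟩
    set y := (A ^ N₀) u with hy
    set b := (PhysicalMeasures.transfer T ν)^[N₀] ψ with hb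
    have hyb : Θ.IsBdd ν y b := hQ.isBdd_pow hu N₀
    refine mem_of_weak_approx (Θ := Θ) hP hWle ⟨y, rfl⟩ fun ε hε => ?_
    obtain ⟨g₁, hg₁⟩ := exists_test_integral_sub_le Θ.dense hyb.integrable.re (half_pos hε)
    obtain ⟨g₂, hg₂⟩ := exists_test_integral_sub_le Θ.dense hyb.integrable.im (half_pos hε)
    obtain ⟨M₁, hM₁⟩ := hQ.mul g₁
    obtain ⟨M₂, hM₂⟩ := hQ.mul g₂
    refine ⟨P (M₁ u₀) + Complex.I • P (M₂ u₀), Submodule.add_mem _ (hmul _ _ hM₁)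
      (Submodule.smul_mem _ _ (hmul _ _ hM₂)), fun g => ?_⟩
    set x := M₁ u₀ + Complex.I • M₂ u₀ with hx
    have hxP : P (M₁ u₀) + Complex.I • P (M₂ u₀) = P x := by rw [hx, map_add, map_smul]
    have hyx : Θ.IsBdd ν (y + (-1 : ℂ) • x) fun z => b z + -1 * ((Θ.r g₁ z : ℂ) * f₀ z +
        Complex.I * ((Θ.r g₂ z : ℂ) * f₀ z)) :=
      hyb.add (((hM₁ _ _ hQ.isBdd_f₀).add ((hM₂ _ _ hQ.isBdd_f₀).smul Complex.I)).smul (-1))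
    have hint : ∫ z, ‖b z + -1 * ((Θ.r g₁ z : ℂ) * f₀ z +
        Complex.I * ((Θ.r g₂ z : ℂ) * f₀ z))‖ ∂ν ≤ ε := by
      have hi₁ : Integrable (fun z => |(b z).re - Θ.r g₁ z|) ν :=
        (hyb.integrable.re.sub (integrable_continuousMap ν (Θ.r g₁))).abs
      have hi₂ : Integrable (fun z => |(b z).im - Θ.r g₂ z|) ν :=
        (hyb.integrable.im.sub (integrable_continuousMap ν (Θ.r g₂))).abs
      have hsum : ∫ z, (|(b z).re - Θ.r g₁ z| + |(b z).im - Θ.r g₂ z|) ∂ν ≤ ε := by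
        rw [integral_add hi₁ hi₂]
        exact (add_le_add hg₁ hg₂).trans (by linarith)
      refine (integral_mono_ae hyx.integrable.norm (hi₁.add hi₂) ?_).trans hsum
      filter_upwards [hQ.dominates ψ hu.1] with z hz
      have hbz : b z = b z * (f₀ z : ℂ) := by
        by_cases h0 : b z = 0
        · rw [h0, zero_mul]
        · rw [hz h0]; simp
      have e1 : b z + -1 * ((Θ.r g₁ z : ℂ) * f₀ z + Complex.I * ((Θ.r g₂ z : ℂ) * f₀ z)) =
          (b z - ((Θ.r g₁ z : ℂ) + Complex.I * (Θ.r g₂ z : ℂ))) * (f₀ z : ℂ) := by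
        conv_lhs => rw [hbz]
        ring
      rw [e1, norm_mul, Complex.norm_real, Real.norm_eq_abs, abs_of_nonneg (hf0 z)]
      refine (mul_le_of_le_one_right (norm_nonneg _) (hQ.f₀_mem z).2).trans ?_
      refine (Complex.norm_le_abs_re_add_abs_im _).trans ?_
      simp
    rw [hxP, ← map_sub]
    have hlim := (((Θ.ev g).continuous.tendsto _).comp (hP.tendsto_pow_apply (y - x))).norm
    refine le_of_tendsto hlim (Eventually.of_forall fun j => ?_)
    have e2 : y - x = y + (-1 : ℂ) • x := by simp [sub_eq_add_neg]
    simp only [Function.comp_apply]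
    rw [e2]
    refine (hQ.norm_ev_pow_le hyx (φ j) g).trans ?_
    rw [mul_comm]
    exact mul_le_mul_of_nonneg_right hint (norm_nonneg _)
  have hall : ∀ u, P ((A ^ N₀) u) ∈ Submodule.span ℂ D := fun u =>
    ((hP.isClosed_of_le hWle).preimage (P.continuous.comp (A ^ N₀).continuous)).closure_subset_iff.2
      hbdd (hQ.dense u)
  obtain ⟨v', hv', hvv, -⟩ := hP.exists_preimage hv N₀
  rw [← hvv, ← hP.apply_of_mem_range (hP.pow_mem_range hv' N₀)]
  exact hall v'

theorem proj_mem_cone {u : H} (hu : u ∈ Θ.cone ν) : P u ∈ Θ.cone ν :=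
  isClosed_cone.mem_of_tendsto (hQ.tendsto_pow_apply u)
    (Eventually.of_forall fun _ => hQ.pow_mem_cone hu _)

theorem u₀_mem_cone : u₀ ∈ Θ.cone ν := hQ.isBdd_f₀.mem_cone fun x => (hQ.f₀_mem x).1

/-- All the elements of the range of `P`, and their iterates, are dominated by the iterates of the
measure `P u₀`. -/
theorem exists_domination {m₀ : Measure K} (hm₀ : Θ.Represents ν (P u₀) m₀) :
    ∃ c : ℝ, 0 ≤ c ∧ ∀ v ∈ P.range, ∀ (i : ℕ) (g : S),
      ‖Θ.ev g ((A ^ i) v)‖ ≤ c * ‖v‖ * ∫ x, |Θ.r g x| ∂(m₀.map T^[i]) := by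
  have := hQ.finite
  have := hQ.finiteRange
  have := hm₀.finite
  suffices h : ∀ v ∈ P.range, ∃ c : ℝ, 0 ≤ c ∧ ∀ j : ℕ × S,
      ‖((Θ.ev j.2).comp (A ^ j.1)) v‖ ≤ c * ∫ x, |Θ.r j.2 x| ∂(m₀.map T^[j.1]) by
    obtain ⟨c, hc, h⟩ := exists_uniform_bound_of_finiteDimensional P.range (J := ℕ × S)
      (fun j => (Θ.ev j.2).comp (A ^ j.1)) (fun j => ∫ x, |Θ.r j.2 x| ∂(m₀.map T^[j.1])) h
    exact ⟨c, hc, fun v hv i g => h v hv (i, g)⟩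
  intro v hv
  induction hQ.mem_span_of_mem_range hv using Submodule.span_induction with
  | zero => exact ⟨0, le_rfl, fun j => by simp⟩
  | add x y hx hy hx' hy' =>
    have hle : ∀ z ∈ Submodule.span ℂ {v | ∃ (w : H) (ψ : K → ℝ) (c : ℝ), (∀ x, 0 ≤ ψ x) ∧ 0 ≤ c ∧
      (∀ x, ψ x ≤ c * f₀ x) ∧ Θ.IsBdd ν w (fun x => (ψ x : ℂ)) ∧ v = P w}, z ∈ P.range := by
      intro z hz
      refine Submodule.span_le.2 ?_ hz
      rintro _ ⟨w, -, -, -, -, -, -, rfl⟩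
      exact ⟨w, rfl⟩
    obtain ⟨c, hc, h⟩ := hx' (hle _ hx)
    obtain ⟨c', hc', h'⟩ := hy' (hle _ hy)
    refine ⟨c + c', add_nonneg hc hc', fun j => ?_⟩
    rw [map_add, add_mul]
    exact (norm_add_le _ _).trans (add_le_add (h j) (h' j))
  | smul a x hx hx' =>
    have hxr : x ∈ P.range := by
      refine Submodule.span_le.2 ?_ hx
      rintro _ ⟨w, -, -, -, -, -, -, rfl⟩
      exact ⟨w, rfl⟩
    obtain ⟨c, hc, h⟩ := hx' hxr
    refine ⟨‖a‖ * c, by positivity, fun j => ?_⟩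
    rw [map_smul, norm_smul, mul_assoc]
    exact mul_le_mul_of_nonneg_left (h j) (norm_nonneg _)
  | mem d hd =>
    obtain ⟨w, ψ, c, hψ, hc, hψc, hw, rfl⟩ := hd
    refine ⟨c, hc, fun ⟨i, g⟩ => ?_⟩
    obtain ⟨m, hm⟩ := exists_represents (hQ.proj_mem_cone (hw.mem_cone hψ))
    have hfin := hm.finite
    have hle : m ≤ ENNReal.ofReal c • m₀ := by
      refine hm.le (hm₀.smul hc) ?_
      have : (c : ℂ) • P u₀ - P w = P ((c : ℂ) • u₀ + (-1 : ℂ) • w) := by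
        simp [sub_eq_add_neg]
      rw [this]
      refine hQ.proj_mem_cone (IsBdd.mem_cone (φ := fun x => c * f₀ x - ψ x) ?_
        fun x => sub_nonneg.2 (hψc x))
      refine ((hQ.isBdd_f₀.smul (c : ℂ)).add (hw.smul (-1))).congr
        (Eventually.of_forall fun x => ?_)
      push_cast
      ring
    have hTi := hQ.qmp.measurable.iterate i
    have hle' : m.map T^[i] ≤ ENNReal.ofReal c • m₀.map T^[i] := by
      rw [← Measure.map_smul]
      exact Measure.map_mono hle hTi
    have habs : ∀ m' : Measure K, IsFiniteMeasure m' → Integrable (fun x => |Θ.r g x|) m' :=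
      fun m' _ => (integrable_continuousMap m' (Θ.r g)).abs
    have hfin' : IsFiniteMeasure (ENNReal.ofReal c • m₀.map T^[i]) :=
      Measure.smul_finite _ ENNReal.ofReal_ne_top
    change ‖Θ.ev g ((A ^ i) (P w))‖ ≤ c * ∫ x, |Θ.r g x| ∂(m₀.map T^[i])
    rw [(hQ.represents_pow hm i).ev_eq g, Complex.norm_real]
    refine (norm_integral_le_integral_norm _).trans ?_
    refine (integral_mono_measure hle' (Eventually.of_forall fun x => abs_nonneg _)
      (habs _ inferInstance)).trans ?_
    rw [integral_smul_measure, ENNReal.toReal_ofReal hc, smul_eq_mul]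

/-- There is a fixed point `w` of `A` in the range of `P`, a limit of averages of the orbit of
`P u₀`, which is an invariant measure dominating the whole range of `P`. -/
theorem exists_isPeripheralSystem :
    ∃ w μ c, Θ.IsPeripheralSystem ν T A P C δ φ u₀ f₀ N₀ w μ c := by
  have := hQ.finite
  have := hQ.finiteRange
  obtain ⟨m₀, hm₀⟩ := exists_represents (hQ.proj_mem_cone hQ.u₀_mem_cone)
  have hfin₀ := hm₀.finite
  obtain ⟨c, hc, hdom⟩ := hQ.exists_domination hm₀
  set y := P u₀ with hy
  have hyr : y ∈ P.range := ⟨u₀, rfl⟩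
  let w' : ℕ → H := fun n => ((n : ℝ)⁻¹ : ℂ) • ∑ i ∈ Finset.range n, (A ^ i) y
  have hw'r : ∀ n, w' n ∈ P.range := fun n =>
    Submodule.smul_mem _ _ (Submodule.sum_mem _ fun i _ => hQ.pow_mem_range hyr i)
  have hb : ∀ i : ℕ, ‖(A ^ i) y‖ ≤ C * ‖y‖ := fun i =>
    ((A ^ i).le_opNorm y).trans (mul_le_mul_of_nonneg_right (hQ.norm_pow_le i) (norm_nonneg _))
  have hCy : 0 ≤ C * ‖y‖ := mul_nonneg hQ.C_pos.le (norm_nonneg _)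
  have hw'b : ∀ n, ‖w' n‖ ≤ C * ‖y‖ := fun n => by
    rcases Nat.eq_zero_or_pos n with rfl | hn
    · simpa [w'] using hCy
    have hn' : (0 : ℝ) < n := by exact_mod_cast hn
    have : ‖∑ i ∈ Finset.range n, (A ^ i) y‖ ≤ n * (C * ‖y‖) := by
      refine (norm_sum_le_of_le _ fun i _ => hb i).trans ?_
      simp
    simp only [w', norm_smul]
    rw [norm_inv, Complex.norm_real, Real.norm_of_nonneg hn'.le, inv_mul_le_iff₀ hn']
    exact this
  have hprop : ProperSpace P.range := FiniteDimensional.proper ℂ _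
  obtain ⟨w, -, χ, hχ, hw⟩ := (isCompact_closedBall (0 : P.range) (C * ‖y‖)).tendsto_subseq
    (x := fun n => ⟨w' n, hw'r n⟩) fun n => by
      rw [mem_closedBall_zero_iff]
      exact hw'b n
  have hw : Tendsto (fun n => w' (χ n)) atTop (𝓝 (w : H)) :=
    (continuous_subtype_val.tendsto w).comp hw
  have hw'cone : ∀ n, Θ.Represents ν (w' n)
      (ENNReal.ofReal (n : ℝ)⁻¹ • ∑ i ∈ Finset.range n, m₀.map T^[i]) := fun n => by
    have h1 := represents_sum (Finset.range n) fun i _ => hQ.represents_pow hm₀ i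
    have := h1.smul (c := (n : ℝ)⁻¹) (by positivity)
    simpa [w'] using this
  have hwcone : (w : H) ∈ Θ.cone ν :=
    isClosed_cone.mem_of_tendsto hw (Eventually.of_forall fun n => (hw'cone _).mem_cone)
  obtain ⟨μ, hμ⟩ := exists_represents hwcone
  have hfinμ := hμ.finite
  have hAw : A w = w := by
    have h1 : Tendsto (fun n => A (w' (χ n)) - w' (χ n)) atTop (𝓝 (A w - w)) :=
      ((A.continuous.tendsto _).comp hw).sub hw
    have h2 : Tendsto (fun n => A (w' n) - w' n) atTop (𝓝 0) := by
      have h3 : ∀ n, A (w' n) - w' n = ((n : ℝ)⁻¹ : ℂ) • ((A ^ n) y - y) := fun n => by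
        have h4 : A (∑ i ∈ Finset.range n, (A ^ i) y) = ∑ i ∈ Finset.range n, (A ^ (i + 1)) y := by
          rw [map_sum]
          exact Finset.sum_congr rfl fun i _ => by rw [pow_succ']; rfl
        simp only [w', map_smul]
        rw [h4, ← smul_sub, ← Finset.sum_sub_distrib, Finset.sum_range_sub (fun i => (A ^ i) y)]
        simp
      simp only [h3]
      refine squeeze_zero_norm (a := fun n : ℕ => (n : ℝ)⁻¹ * (C * ‖y‖ + ‖y‖)) (fun n => ?_) ?_
      · rw [norm_smul, norm_inv, Complex.norm_real, Real.norm_of_nonneg (Nat.cast_nonneg n)]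
        exact mul_le_mul_of_nonneg_left ((norm_sub_le _ _).trans (add_le_add (hb n) le_rfl))
          (by positivity)
      · simpa using tendsto_inv_atTop_nhds_zero_nat.mul_const (C * ‖y‖ + ‖y‖)
    exact sub_eq_zero.1 (tendsto_nhds_unique h1 (h2.comp hχ.tendsto_atTop))
  have hinv : μ.map T = μ := by
    have := hQ.represents_map hμ
    rw [hAw] at this
    exact this.unique hμ
  have hlim : ∀ f : C(K, ℝ), Tendsto (fun n => ∫ x, f x
      ∂(ENNReal.ofReal (χ n : ℝ)⁻¹ • ∑ i ∈ Finset.range (χ n), m₀.map T^[i])) atTop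
      (𝓝 (∫ x, f x ∂μ)) := by
    have := fun n => (hw'cone (χ n)).finite
    refine tendsto_integral_continuousMap_of_test Θ.dense Θ.one fun g => ?_
    have h1 := (Complex.continuous_re.tendsto _).comp (((Θ.ev g).continuous.tendsto _).comp hw)
    rw [hμ.ev_eq g, Complex.ofReal_re] at h1
    refine h1.congr fun n => ?_
    simp only [Function.comp_apply]
    rw [(hw'cone _).ev_eq g, Complex.ofReal_re]
  refine ⟨w, μ, c * C, hQ, w.2, hAw, hμ, hinv, mul_nonneg hc hQ.C_pos.le, fun v hv g => ?_⟩
  -- Average the bounds obtained by writing `v` as the image of a bounded vector under `A ^ i`.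
  have hi : ∀ i, ‖Θ.ev g v‖ ≤ c * C * ‖v‖ * ∫ x, |Θ.r g x| ∂(m₀.map T^[i]) := fun i => by
    obtain ⟨v', hv', hvv, hn⟩ := hQ.exists_preimage hv i
    have := hdom v' hv' i g
    rw [hvv] at this
    refine this.trans (mul_le_mul_of_nonneg_right ?_ (integral_nonneg fun x => abs_nonneg _))
    rw [mul_assoc]
    exact mul_le_mul_of_nonneg_left hn hc
  have h2 := (hlim |Θ.r g|).const_mul (c * C * ‖v‖)
  refine ge_of_tendsto h2 ?_
  filter_upwards [hχ.tendsto_atTop.eventually (eventually_ge_atTop 1)] with n hn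
  have hn' : (0 : ℝ) < χ n := by exact_mod_cast hn
  rw [integral_smul_measure, ENNReal.toReal_ofReal (by positivity),
    integral_finsetSum_measure fun i _ => integrable_continuousMap _ _, smul_eq_mul,
    mul_left_comm, ← div_eq_inv_mul, le_div_iff₀ hn', Finset.mul_sum]
  have h3 := Finset.card_nsmul_le_sum (Finset.range (χ n)) (fun i => c * C * ‖v‖ *
    ∫ x, |Θ.r g x| ∂(m₀.map T^[i])) ‖Θ.ev g v‖ fun i _ => hi i
  rw [Finset.card_range, nsmul_eq_mul, mul_comm] at h3
  exact h3

end IsQuasicompactSystem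

end TestPairing

/-! ### Rigid sets -/

section Rigid

variable {K : Type*} [MeasurableSpace K] {T : K → K} {μ : Measure K} {φ : ℕ → ℕ}

/-- Measurable sets which come back to themselves along the times `φ j`, up to sets of measure
tending to zero. -/
def IsRigid (T : K → K) (μ : Measure K) (φ : ℕ → ℕ) (B : Set K) : Prop :=
  MeasurableSet B ∧ Tendsto (fun j => μ (symmDiff (T^[φ j] ⁻¹' B) B)) atTop (𝓝 0)

theorem IsRigid.compl {B : Set K} (hB : IsRigid T μ φ B) : IsRigid T μ φ Bᶜ := by
  refine ⟨hB.1.compl, ?_⟩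
  simpa only [preimage_compl, compl_symmDiff_compl] using hB.2

theorem IsRigid.inter {B B' : Set K} (hB : IsRigid T μ φ B) (hB' : IsRigid T μ φ B') :
    IsRigid T μ φ (B ∩ B') := by
  refine ⟨hB.1.inter hB'.1, ?_⟩
  have h := hB.2.add hB'.2
  rw [add_zero] at h
  refine tendsto_of_tendsto_of_tendsto_of_le_of_le tendsto_const_nhds h (fun j => zero_le)
    fun j => ?_
  refine (measure_mono ?_).trans (measure_union_le _ _)
  intro x hx
  simp only [mem_symmDiff, mem_union, mem_inter_iff, mem_preimage] at hx ⊢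
  tauto

theorem IsRigid.diff {B B' : Set K} (hB : IsRigid T μ φ B) (hB' : IsRigid T μ φ B') :
    IsRigid T μ φ (B \ B') := hB.inter hB'.compl

theorem IsRigid.preimage (hT : MeasurePreserving T μ μ) {B : Set K} (hB : IsRigid T μ φ B) :
    IsRigid T μ φ (T ⁻¹' B) := by
  refine ⟨hT.measurable hB.1, hB.2.congr fun j => ?_⟩
  have hm : MeasurableSet (symmDiff (T^[φ j] ⁻¹' B) B) :=
    ((hT.measurable.iterate _) hB.1).symmDiff hB.1
  rw [← hT.measure_preimage hm.nullMeasurableSet, preimage_symmDiff, ← preimage_comp,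
    ← preimage_comp, ← Function.iterate_succ, Function.iterate_succ']

theorem isRigid_of_invariant {B : Set K} (hm : MeasurableSet B) (hB : T ⁻¹' B = B) :
    IsRigid T μ φ B := by
  refine ⟨hm, ?_⟩
  have : ∀ n, T^[n] ⁻¹' B = B := fun n => by
    induction n with
    | zero => rfl
    | succ n ih => rw [Function.iterate_succ, preimage_comp, ih, hB]
  simp [this]

/-- If the integrals of a positive function over sets tend to zero, so do the measures of the
sets. -/
theorem tendsto_measure_zero_of_tendsto_setIntegral [IsFiniteMeasure μ] {f : K → ℝ}
    (hf : Measurable f) (hfi : Integrable f μ) (hpos : ∀ᵐ x ∂μ, 0 < f x) {D : ℕ → Set K}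
    (hD : ∀ j, MeasurableSet (D j)) (h : Tendsto (fun j => ∫ x in D j, f x ∂μ) atTop (𝓝 0)) :
    Tendsto (fun j => μ (D j)) atTop (𝓝 0) := by
  set F : K → ℝ≥0∞ := fun x => ENNReal.ofReal (f x) with hF
  have hFm : Measurable F := hf.ennreal_ofReal
  have hF0 : ∀ᵐ x ∂μ, F x ≠ 0 := hpos.mono fun x hx => by simpa [hF] using hx
  have e : (μ.withDensity F).withDensity F⁻¹ = μ :=
    withDensity_inv_same hFm hF0 (Eventually.of_forall fun x => ENNReal.ofReal_ne_top)
  have h1 : Tendsto (fun j => (μ.withDensity F) (D j)) atTop (𝓝 0) := by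
    have : ∀ j, (μ.withDensity F) (D j) = ENNReal.ofReal (∫ x in D j, f x ∂μ) := fun j => by
      rw [withDensity_apply _ (hD j), ofReal_integral_eq_lintegral_ofReal hfi.integrableOn
        (ae_restrict_of_ae (hpos.mono fun x hx => hx.le))]
    simp only [this]
    simpa [Function.comp_def] using (ENNReal.continuous_ofReal.tendsto _).comp h
  have h2 : ∫⁻ x, F⁻¹ x ∂(μ.withDensity F) ≠ ⊤ := by
    rw [← setLIntegral_univ, ← withDensity_apply _ MeasurableSet.univ, e]
    exact measure_ne_top _ _
  refine (tendsto_setLIntegral_zero h2 h1).congr fun j => ?_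
  rw [← withDensity_apply _ (hD j), e]

end Rigid

/-- A finite partition of a finite measure space into atoms of a family of sets stable under
differences and intersections, as soon as the number of disjoint nonnull sets of the family is
bounded. -/
theorem exists_atoms {K : Type*} [MeasurableSpace K] {μ : Measure K} (𝒜 : Set K → Prop)
    (hu : 𝒜 univ) (hdiff : ∀ B B', 𝒜 B → 𝒜 B' → 𝒜 (B \ B')) {b : ℕ}
    (hb : ∀ (n : ℕ) (B : Fin n → Set K), (∀ i, 𝒜 (B i) ∧ μ (B i) ≠ 0) →
      Pairwise (Function.onFun Disjoint B) → n ≤ b) :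
    ∃ (n : ℕ) (B : Fin n → Set K), (∀ i, 𝒜 (B i) ∧ μ (B i) ≠ 0) ∧
      Pairwise (Function.onFun Disjoint B) ∧ μ (⋃ i, B i)ᶜ = 0 ∧
      ∀ i D, 𝒜 D → μ (B i ∩ D) = 0 ∨ μ (B i \ D) = 0 := by
  classical
  let p : ℕ → Prop := fun n => ∃ B : Fin n → Set K, (∀ i, 𝒜 (B i) ∧ μ (B i) ≠ 0) ∧
    Pairwise (Function.onFun Disjoint B)
  have hp : ∀ n, p n → n ≤ b := fun n ⟨B, h1, h2⟩ => hb n B h1 h2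
  have h0 : p 0 := ⟨Fin.elim0, fun i => i.elim0, fun i => i.elim0⟩
  set n := Nat.findGreatest p b with hn
  obtain ⟨B, hB, hdis⟩ : p n := Nat.findGreatest_spec (Nat.zero_le b) h0
  have hmax : ¬ p (n + 1) := fun h => by
    have := Nat.le_findGreatest (hp _ h) h
    omega
  have hinter : ∀ B B', 𝒜 B → 𝒜 B' → 𝒜 (B ∩ B') := fun B B' h h' => by
    have := hdiff _ _ h (hdiff _ _ h h')
    rwa [show B \ (B \ B') = B ∩ B' from sdiff_sdiff_right_self] at this
  -- A family with one more member than `B` is impossible.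
  have hcons : ∀ (D : Set K) (B' : Fin n → Set K), 𝒜 D → μ D ≠ 0 →
      (∀ i, 𝒜 (B' i) ∧ μ (B' i) ≠ 0) → Pairwise (Function.onFun Disjoint B') →
      (∀ i, Disjoint D (B' i)) → False := by
    intro D B' hD hD0 hB' hdis' hDB
    refine hmax ⟨Fin.cons D B', fun i => ?_, ?_⟩
    · refine Fin.cases ?_ (fun i => ?_) i
      · exact ⟨hD, hD0⟩
      · exact hB' i
    · intro i j
      refine Fin.cases ?_ (fun i => ?_) i <;> refine Fin.cases ?_ (fun j => ?_) j <;> intro hij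
      · exact absurd rfl hij
      · exact hDB j
      · exact (hDB i).symm
      · exact hdis' fun h => hij (congrArg Fin.succ h)
  have hdiffs : ∀ s : Finset (Fin n), 𝒜 (⋃ i ∈ s, B i)ᶜ := fun s => by
    induction s using Finset.induction_on with
    | empty => simpa using hu
    | insert i s hi ih =>
      rw [Finset.set_biUnion_insert, compl_union, inter_comm, ← sdiff_eq]
      exact hdiff _ _ ih (hB i).1
  refine ⟨n, B, hB, hdis, ?_, fun i D hD => ?_⟩
  · by_contra h
    refine hcons _ B (by simpa using hdiffs Finset.univ) h hB hdis fun i => ?_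
    exact disjoint_compl_left.mono_right (subset_iUnion B i)
  · by_contra! h
    have hsub : ∀ j, Function.update B i (B i \ D) j ⊆ B j := fun j => by
      by_cases hj : j = i
      · subst hj; simp
      · simp [hj]
    refine hcons (B i ∩ D) (Function.update B i (B i \ D)) (hinter _ _ (hB i).1 hD) h.1
      (fun j => ?_) (fun j k hjk => (hdis hjk).mono (hsub j) (hsub k)) fun j => ?_
    · by_cases hj : j = i
      · subst hj
        simpa using ⟨hdiff _ _ (hB j).1 hD, h.2⟩
      · simpa [hj] using hB j
    · by_cases hj : j = i
      · subst hj
        simpa using disjoint_sdiff_right.mono_left inter_subset_right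
      · simpa [hj] using (hdis (Ne.symm hj)).mono_left inter_subset_left

/-! ### Rigid sets and the range of the peripheral projection -/

namespace TestPairing

variable {K S H : Type*} [TopologicalSpace K] [CompactSpace K] [T2Space K]
  [SecondCountableTopology K] [MeasurableSpace K] [BorelSpace K] [AddCommGroup S]
  [Module ℝ S] [NormedAddCommGroup H] [NormedSpace ℂ H]
  {Θ : TestPairing K S H} {ν : Measure K} {T : K → K} {A : H →L[ℂ] H}

/-- In a finite-dimensional subspace, a sequence all of whose pairings with test functions converge
is convergent. -/
theorem exists_tendsto_of_weak (V : Submodule ℂ H) [FiniteDimensional ℂ V] {x : ℕ → H}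
    (hx : ∀ i, x i ∈ V) {ℓ : S → ℂ} (h : ∀ g, Tendsto (fun i => Θ.ev g (x i)) atTop (𝓝 (ℓ g))) :
    ∃ v ∈ V, Tendsto x atTop (𝓝 v) := by
  obtain ⟨I, c, hc, hI⟩ := exists_norm_le_sum_of_separating V Θ.ev fun v _ => Θ.sep v
  let F : V →ₗ[ℂ] (I → ℂ) := LinearMap.pi fun g => (Θ.ev g : H →ₗ[ℂ] ℂ).comp V.subtype
  have hF : LinearMap.ker F = ⊥ := by
    refine (Submodule.eq_bot_iff _).2 fun v hv => ?_
    have h0 : ∀ g ∈ I, ‖Θ.ev g (v : H)‖ = 0 := fun g hg => by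
      have : F v ⟨g, hg⟩ = 0 := by rw [LinearMap.mem_ker.1 hv]; rfl
      rw [show Θ.ev g (v : H) = 0 from this, norm_zero]
    have := hI v v.2
    rw [Finset.sum_eq_zero h0, mul_zero] at this
    exact Subtype.ext (norm_le_zero_iff.1 this)
  have hemb := LinearMap.isClosedEmbedding_of_injective hF
  have hlim : Tendsto (fun i => F ⟨x i, hx i⟩) atTop (𝓝 fun g => ℓ g) :=
    tendsto_pi_nhds.2 fun g => h g
  obtain ⟨v, hv⟩ := hemb.isClosed_range.mem_of_tendsto hlim (Eventually.of_forall fun i => ⟨_, rfl⟩)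
  refine ⟨v, v.2, ?_⟩
  rw [← hv] at hlim
  exact (continuous_subtype_val.tendsto v).comp (hemb.isInducing.tendsto_nhds_iff.2 hlim)

namespace IsPeripheralSystem

variable {P : H →L[ℂ] H} {C δ : ℝ} {φ : ℕ → ℕ} {u₀ : H} {f₀ : K → ℝ} {N₀ : ℕ} {w : H}
  {μ : Measure K} {c : ℝ} (hR : Θ.IsPeripheralSystem ν T A P C δ φ u₀ f₀ N₀ w μ c)

include hR

theorem measurePreserving : MeasurePreserving T μ μ := ⟨hR.qmp.measurable, hR.map_eq⟩

/-- Two measures represented by elements of the range of `P` differ by at most a multiple of `μ`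
which is proportional to the distance of the elements. -/
theorem le_add {v v' : H} {m m' : Measure K} (hv : v ∈ P.range) (hv' : v' ∈ P.range)
    (h : Θ.Represents ν v m) (h' : Θ.Represents ν v' m') :
    m ≤ m' + ENNReal.ofReal (c * ‖v - v'‖) • μ := by
  have := h.finite
  have := h'.finite
  have := hR.represents.finite
  have : IsFiniteMeasure (ENNReal.ofReal (c * ‖v - v'‖) • μ) :=
    Measure.smul_finite _ ENNReal.ofReal_ne_top
  refine measure_le_of_test Θ.dense Θ.one fun g hg => ?_
  have hκ : 0 ≤ c * ‖v - v'‖ := mul_nonneg hR.c_nonneg (norm_nonneg _)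
  rw [integral_add_measure (integrable_continuousMap _ _) (integrable_continuousMap _ _),
    integral_smul_measure, ENNReal.toReal_ofReal hκ, smul_eq_mul]
  have h1 := hR.dominated _ (Submodule.sub_mem _ hv hv') g
  have h2 : ∀ x, |Θ.r g x| = Θ.r g x := fun x => abs_of_nonneg (hg x)
  simp only [h2] at h1
  rw [map_sub, h.ev_eq, h'.ev_eq, ← Complex.ofReal_sub, Complex.norm_real] at h1
  have := (abs_le.1 h1).2
  linarith

theorem le_smul {v : H} {m : Measure K} (hv : v ∈ P.range) (h : Θ.Represents ν v m) :
    m ≤ ENNReal.ofReal (c * ‖v‖) • μ := by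
  have := hR.finite
  simpa using hR.le_add hv (Submodule.zero_mem _) h represents_zero

theorem absolutelyContinuous {v : H} {m : Measure K} (hv : v ∈ P.range)
    (h : Θ.Represents ν v m) : m ≪ μ :=
  Measure.absolutelyContinuous_of_le_smul (hR.le_smul hv h)

/-- Since `A ^ φ j` converges to the identity on the range of `P`, the push-forwards of the measure
under `T^[φ j]` converge to the measure on every set. -/
theorem tendsto_measureReal_preimage {v : H} {m : Measure K} (hv : v ∈ P.range)
    (h : Θ.Represents ν v m) {B : Set K} (hB : MeasurableSet B) :
    Tendsto (fun j => m.real (T^[φ j] ⁻¹' B)) atTop (𝓝 (m.real B)) := by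
  have hμ := hR.represents.finite
  have key : ∀ {v v' : H} {m m' : Measure K}, v ∈ P.range → v' ∈ P.range → Θ.Represents ν v m →
      Θ.Represents ν v' m' → m.real B ≤ m'.real B + c * ‖v - v'‖ * μ.real B := by
    intro v v' m m' hv hv' h h'
    have := h'.finite
    have hfin : IsFiniteMeasure (ENNReal.ofReal (c * ‖v - v'‖) • μ) :=
      Measure.smul_finite _ ENNReal.ofReal_ne_top
    have h1 := ENNReal.toReal_mono (measure_ne_top _ _) (hR.le_add hv hv' h h' B)
    have h2 := measureReal_add_apply (μ₁ := m') (μ₂ := ENNReal.ofReal (c * ‖v - v'‖) • μ) (s := B)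
    rw [measureReal_ennreal_smul_apply,
      ENNReal.toReal_ofReal (mul_nonneg hR.c_nonneg (norm_nonneg _))] at h2
    rw [← h2]
    exact h1
  have h0 : Tendsto (fun j => c * ‖(A ^ φ j) v - v‖ * μ.real B) atTop (𝓝 0) := by
    have := hR.tendsto_pow_apply v
    rw [hR.apply_of_mem_range hv, tendsto_iff_norm_sub_tendsto_zero] at this
    simpa using (this.const_mul c).mul_const (μ.real B)
  rw [tendsto_iff_norm_sub_tendsto_zero]
  refine squeeze_zero (fun j => norm_nonneg _) (fun j => ?_) h0
  have h1 := hR.represents_pow h (φ j)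
  have h2 := hR.pow_mem_range hv (φ j)
  have e : (m.map T^[φ j]).real B = m.real (T^[φ j] ⁻¹' B) :=
    map_measureReal_apply (hR.qmp.measurable.iterate _) hB
  rw [← e, Real.norm_eq_abs, abs_le]
  have h3 := key h2 hv h1 h
  have h4 := key hv h2 h h1
  rw [norm_sub_rev] at h4
  constructor <;> linarith

/-- The superlevel sets of the density of an element of the range of `P` are rigid: the push-forward
of the density under `T ^ φ j` is close to the density, hence it can not move mass across the
level. Levels charged by `μ` are excluded, because the density has to differ from `t` almost
everywhere. -/
theorem isRigid_superlevel {v : H} {m : Measure K} (hv : v ∈ P.range)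
    (h : Θ.Represents ν v m) {t : ℝ} (ht : μ {x | (m.rnDeriv μ x).toReal = t} = 0) :
    IsRigid T μ φ {x | t < (m.rnDeriv μ x).toReal} := by
  have hμ := hR.represents.finite
  have hm := h.finite
  have hψm : Measurable fun x => (m.rnDeriv μ x).toReal :=
    (Measure.measurable_rnDeriv m μ).ennreal_toReal
  have hψi : Integrable (fun x => (m.rnDeriv μ x).toReal) μ := Measure.integrable_toReal_rnDeriv
  have hset := Measure.setIntegral_toReal_rnDeriv (hR.absolutelyContinuous hv h)
  set ψ := fun x => (m.rnDeriv μ x).toReal with hψ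
  set B := {x | t < ψ x} with hB
  have hBm : MeasurableSet B := measurableSet_lt measurable_const hψm
  have hTB : ∀ n, MeasurableSet (T^[n] ⁻¹' B) := fun n => hR.qmp.measurable.iterate n hBm
  have habs : Integrable (fun x => |ψ x - t|) μ := (hψi.sub (integrable_const t)).abs
  refine ⟨hBm, tendsto_measure_zero_of_tendsto_setIntegral (f := fun x => |ψ x - t|)
    (hψm.sub_const t).abs habs ?_ (fun j => (hTB _).symmDiff hBm) ?_⟩
  · have : ∀ᵐ x ∂μ, ψ x ≠ t := by
      rw [ae_iff]
      simpa using ht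
    filter_upwards [this] with x hx
    exact abs_pos.2 (sub_ne_zero.2 hx)
  have hlim := (hR.tendsto_measureReal_preimage hv h hBm).const_sub (m.real B)
  rw [sub_self] at hlim
  refine hlim.congr fun j => ?_
  set B' := T^[φ j] ⁻¹' B with hB'
  have hB'm : MeasurableSet B' := hTB _
  rw [symmDiff_def, show B' \ B ⊔ B \ B' = B' \ B ∪ B \ B' from rfl,
    setIntegral_union disjoint_sdiff_sdiff (hBm.diff hB'm) habs.integrableOn habs.integrableOn]
  have e1 : ∫ x in B \ B', |ψ x - t| ∂μ = m.real (B \ B') - t * μ.real (B \ B') := by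
    rw [setIntegral_congr_fun (g := fun x => ψ x - t) (hBm.diff hB'm) fun x hx =>
      abs_of_pos (sub_pos.2 hx.1), integral_sub hψi.integrableOn (integrable_const t), hset,
      setIntegral_const, smul_eq_mul, mul_comm]
  have e2 : ∫ x in B' \ B, |ψ x - t| ∂μ = t * μ.real (B' \ B) - m.real (B' \ B) := by
    rw [setIntegral_congr_fun (g := fun x => t - ψ x) (hB'm.diff hBm) fun x hx => by
      simp only
      rw [abs_of_nonpos (sub_nonpos.2 (not_lt.1 hx.2)), neg_sub],
      integral_sub (integrable_const t) hψi.integrableOn, hset,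
      setIntegral_const, smul_eq_mul, mul_comm]
  have e3 : μ.real B' = μ.real B :=
    (hR.measurePreserving.iterate _).measureReal_preimage hBm.nullMeasurableSet
  have a1 := measureReal_sdiff_add_inter (μ := m) (s := B) hB'm
  have a2 := measureReal_sdiff_add_inter (μ := m) (s := B') hBm
  have a3 := measureReal_sdiff_add_inter (μ := μ) (s := B) hB'm
  have a4 := measureReal_sdiff_add_inter (μ := μ) (s := B') hBm
  rw [inter_comm] at a2 a4
  have a5 : μ.real (B \ B') = μ.real (B' \ B) := by linarith
  rw [e1, e2, a5]
  linarith

/-- On an atom of the family of rigid sets, the density of an element of the range of `P` is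
constant: each superlevel set is null or conull in the atom, for a dense set of levels. -/
theorem restrict_eq_smul_of_atom {v : H} {m : Measure K} (hv : v ∈ P.range)
    (h : Θ.Represents ν v m) {D : Set K} (hD : MeasurableSet D)
    (hatom : ∀ D', IsRigid T μ φ D' → μ (D ∩ D') = 0 ∨ μ (D \ D') = 0) :
    ∃ t : ℝ, 0 ≤ t ∧ m.restrict D = ENNReal.ofReal t • μ.restrict D := by
  have hμ := hR.represents.finite
  have hm := h.finite
  set ψ := fun x => (m.rnDeriv μ x).toReal with hψ
  have hψm : Measurable ψ := (Measure.measurable_rnDeriv m μ).ennreal_toReal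
  have hcount := Measure.countable_meas_level_set_pos (μ := μ) hψm
  obtain ⟨s, hs, hsc, hsd⟩ := (hcount.dense_compl ℝ).exists_countable_dense_subset
  have hsep : HasCountableSeparatingOn ℝ (fun U => ∃ t ∈ s, U = Ioi t) univ := by
    refine ⟨Ioi '' s, hsc.image _, ?_, ?_⟩
    · rintro _ ⟨t, ht, rfl⟩
      exact ⟨t, ht, rfl⟩
    · intro x _ y _ hxy
      have hlt : ∀ x y : ℝ, (∀ U ∈ Ioi '' s, x ∈ U ↔ y ∈ U) → ¬ x < y := fun x y hxy h => by
        obtain ⟨t, ht, h1, h2⟩ := hsd.exists_between h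
        exact absurd ((hxy _ ⟨t, ht, rfl⟩).2 h2) (not_lt.2 h1.le)
      exact le_antisymm (not_lt.1 (hlt y x fun U hU => (hxy U hU).symm)) (not_lt.1 (hlt x y hxy))
  obtain ⟨t, ht⟩ := exists_eventuallyEq_const_of_forall_separating (l := ae (μ.restrict D))
    (f := ψ) (fun U => ∃ t ∈ s, U = Ioi t) (by
      rintro _ ⟨t, hts, rfl⟩
      have h0 : μ {x | ψ x = t} = 0 := by simpa using hs hts
      have hr := hR.isRigid_superlevel hv h h0
      rcases hatom _ hr with h1 | h1
      · right
        rw [ae_restrict_iff' hD]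
        have : ∀ᵐ x ∂μ, x ∉ D ∩ {x | t < ψ x} := measure_eq_zero_iff_ae_notMem.1 h1
        filter_upwards [this] with x hx hxD hlt
        exact hx ⟨hxD, hlt⟩
      · left
        rw [ae_restrict_iff' hD]
        have : ∀ᵐ x ∂μ, x ∉ D \ {x | t < ψ x} := measure_eq_zero_iff_ae_notMem.1 h1
        filter_upwards [this] with x hx hxD
        by_contra hlt
        exact hx ⟨hxD, hlt⟩)
  refine ⟨max t 0, le_max_right _ _, ?_⟩
  have hae : m.rnDeriv μ =ᵐ[μ.restrict D] fun _ => ENNReal.ofReal (max t 0) := by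
    filter_upwards [ht, ae_restrict_of_ae (Measure.rnDeriv_ne_top m μ)] with x hx hx'
    have hx : ψ x = t := hx
    rw [← hx, max_eq_left ENNReal.toReal_nonneg, ENNReal.ofReal_toReal hx']
  conv_lhs => rw [← Measure.withDensity_rnDeriv_eq m μ (hR.absolutelyContinuous hv h)]
  rw [restrict_withDensity hD, withDensity_congr_ae hae, withDensity_const]

/-- The restriction of the invariant measure to a rigid set belongs to the range of `P`: it is the
limit of the projections of the products of `w` with test functions approximating the indicator
function of the set in `L¹`. -/
theorem exists_represents_restrict {B : Set K} (hB : IsRigid T μ φ B) :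
    ∃ v ∈ P.range, Θ.Represents ν v (μ.restrict B) := by
  have hν := hR.finite
  have hμ := hR.represents.finite
  have hfd := hR.finiteRange
  have hind : Integrable (B.indicator fun _ => (1 : ℝ)) μ := (integrable_const 1).indicator hB.1
  choose g hg0 hg using fun p : ℕ => exists_nonneg_test_integral_sub_le Θ.dense Θ.one hind
    (fun x => indicator_nonneg (fun _ _ => zero_le_one) x)
    (show (0 : ℝ) < 1 / ((p : ℝ) + 1) by positivity)
  choose M hM using fun p => hR.mul (g p)
  have hcone : ∀ p, P (M p w) ∈ Θ.cone ν := fun p =>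
    hR.proj_mem_cone ((hM p).mem_cone (hg0 p) hR.represents.mem_cone)
  have hest : ∀ p e, ‖Θ.ev e (P (M p w)) - ((∫ x in B, Θ.r e x ∂μ : ℝ) : ℂ)‖ ≤
      ‖Θ.r e‖ * (1 / ((p : ℝ) + 1)) := by
    intro p e
    have hlim : Tendsto (fun j => ‖Θ.ev e ((A ^ φ j) (M p w)) - ((∫ x in B, Θ.r e x ∂μ : ℝ) : ℂ)‖)
        atTop (𝓝 ‖Θ.ev e (P (M p w)) - ((∫ x in B, Θ.r e x ∂μ : ℝ) : ℂ)‖) :=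
      ((((Θ.ev e).continuous.tendsto _).comp (hR.tendsto_pow_apply (M p w))).sub_const _).norm
    have hlim' : Tendsto (fun j => ‖Θ.r e‖ * (1 / ((p : ℝ) + 1) +
        μ.real (symmDiff (T^[φ j] ⁻¹' B) B))) atTop (𝓝 (‖Θ.r e‖ * (1 / ((p : ℝ) + 1) + 0))) :=
      (((ENNReal.tendsto_toReal ENNReal.zero_ne_top).comp hB.2).const_add _).const_mul _
    rw [add_zero] at hlim'
    refine le_of_tendsto_of_tendsto hlim hlim' (Eventually.of_forall fun j => ?_)
    beta_reduce
    set n := φ j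
    have hTn := hR.qmp.measurable.iterate n
    have hmp := hR.measurePreserving.iterate n
    let gc : C(K, ℂ) := ⟨fun x => (Θ.r (g p) x : ℂ), by fun_prop⟩
    have e1 : Θ.ev e ((A ^ n) (M p w)) = ((∫ x, Θ.r (g p) x * Θ.r e (T^[n] x) ∂μ : ℝ) : ℂ) := by
      rw [hR.ev_pow_mul hR.represents (f := gc) (hM p), ← integral_complex_ofReal]
      simp [gc]
    have hre : AEStronglyMeasurable (fun x => Θ.r e (T^[n] x)) μ :=
      ((Θ.r e).continuous.measurable.comp hTn).aestronglyMeasurable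
    have hreb : ∀ᵐ x ∂μ, ‖Θ.r e (T^[n] x)‖ ≤ ‖Θ.r e‖ :=
      Eventually.of_forall fun x => (Θ.r e).norm_coe_le_norm _
    have hind' : Integrable ((T^[n] ⁻¹' B).indicator fun _ => (1 : ℝ)) μ :=
      (integrable_const 1).indicator (hTn hB.1)
    have e2 : ∫ x in B, Θ.r e x ∂μ =
        ∫ x, (T^[n] ⁻¹' B).indicator (fun _ => (1 : ℝ)) x * Θ.r e (T^[n] x) ∂μ := by
      rw [← integral_indicator hB.1, ← hmp.map_eq, integral_map hTn.aemeasurable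
        (((Θ.r e).continuous.measurable.indicator hB.1).aestronglyMeasurable), hmp.map_eq]
      refine integral_congr_ae (Eventually.of_forall fun x => ?_)
      by_cases hx : T^[n] x ∈ B
      · simp [hx]
      · simp [hx]
    have hgi := integrable_continuousMap μ (Θ.r (g p))
    have hsd : MeasurableSet (symmDiff (T^[n] ⁻¹' B) B) := (hTn hB.1).symmDiff hB.1
    have hsi : Integrable ((symmDiff (T^[n] ⁻¹' B) B).indicator fun _ => (1 : ℝ)) μ :=
      (integrable_const 1).indicator hsd
    have hdi : Integrable (fun x => |B.indicator (fun _ => (1 : ℝ)) x - Θ.r (g p) x|) μ :=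
      (hind.sub hgi).abs
    rw [e1, e2, ← Complex.ofReal_sub, Complex.norm_real, ← integral_sub
      (hgi.mul_bdd hre hreb) (hind'.mul_bdd hre hreb)]
    refine (norm_integral_le_integral_norm _).trans ?_
    calc _ ≤ ∫ x, ‖Θ.r e‖ * (|B.indicator (fun _ => (1 : ℝ)) x - Θ.r (g p) x| +
          (symmDiff (T^[n] ⁻¹' B) B).indicator (fun _ => (1 : ℝ)) x) ∂μ := by
          refine integral_mono_of_nonneg (Eventually.of_forall fun x => norm_nonneg _)
            ((hdi.add hsi).const_mul _) (Eventually.of_forall fun x => ?_)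
          simp only
          rw [← sub_mul, norm_mul, mul_comm]
          refine mul_le_mul ((Θ.r e).norm_coe_le_norm _) ?_ (norm_nonneg _) (norm_nonneg _)
          have : |(T^[n] ⁻¹' B).indicator (fun _ => (1 : ℝ)) x - B.indicator (fun _ => (1 : ℝ)) x| =
              (symmDiff (T^[n] ⁻¹' B) B).indicator (fun _ => (1 : ℝ)) x := by
            by_cases h1 : x ∈ T^[n] ⁻¹' B <;> by_cases h2 : x ∈ B <;>
              simp [h1, h2, mem_symmDiff]
          rw [← this, Real.norm_eq_abs, abs_sub_comm, add_comm]
          exact abs_sub_le _ _ _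
      _ = ‖Θ.r e‖ * (∫ x, |B.indicator (fun _ => (1 : ℝ)) x - Θ.r (g p) x| ∂μ +
          μ.real (symmDiff (T^[n] ⁻¹' B) B)) := by
          rw [integral_const_mul, integral_add hdi hsi, integral_indicator hsd,
            setIntegral_const, smul_eq_mul, mul_one]
      _ ≤ _ := mul_le_mul_of_nonneg_left (add_le_add (hg p) le_rfl) (norm_nonneg _)
  have hweak : ∀ e, Tendsto (fun p => Θ.ev e (P (M p w))) atTop
      (𝓝 ((∫ x in B, Θ.r e x ∂μ : ℝ) : ℂ)) := fun e => by
    rw [tendsto_iff_norm_sub_tendsto_zero]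
    refine squeeze_zero (fun _ => norm_nonneg _) (fun p => hest p e) ?_
    simpa using tendsto_one_div_add_atTop_nhds_zero_nat.const_mul ‖Θ.r e‖
  obtain ⟨v, hv, hlim⟩ := exists_tendsto_of_weak (Θ := Θ) P.range (fun p => ⟨M p w, rfl⟩) hweak
  exact ⟨v, hv, isClosed_cone.mem_of_tendsto hlim (Eventually.of_forall hcone), inferInstance,
    fun e => tendsto_nhds_unique (((Θ.ev e).continuous.tendsto v).comp hlim) (hweak e)⟩

end IsPeripheralSystem

/-- If a combination of restrictions of `μ` to disjoint sets is dominated by `μ` on some set, then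
the coefficients of the members disjoint from that set vanish. -/
theorem coeff_eq_zero {μ : Measure K} [IsFiniteMeasure μ] {ι : Type*} [Fintype ι] {B : ι → Set K}
    (hB : ∀ i, MeasurableSet (B i)) (hdis : Pairwise (Function.onFun Disjoint B)) {v : ι → H}
    (hv : ∀ i, Θ.Represents ν (v i) (μ.restrict (B i))) {s : ι → ℂ} {E : Set K}
    (hE : MeasurableSet E) {κ : ℝ} (hκ : 0 ≤ κ)
    (h : ∀ g, ‖Θ.ev g (∑ i, s i • v i)‖ ≤ κ * ∫ x in E, |Θ.r g x| ∂μ) {b : ι}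
    (hb : Disjoint E (B b)) (hb0 : μ (B b) ≠ 0) : s b = 0 := by
  classical
  set F : K → ℝ := (B b).indicator fun _ => (1 : ℝ) with hF
  have hFi : Integrable F μ := (integrable_const 1).indicator (hB b)
  have hmass : 0 < μ.real (B b) := ENNReal.toReal_pos hb0 (measure_ne_top _ _)
  have key : ∀ ε > 0, ‖s b‖ * μ.real (B b) ≤ (κ + ∑ i, ‖s i‖) * ε := by
    intro ε hε
    obtain ⟨g, hg⟩ := exists_test_integral_sub_le Θ.dense hFi hε
    have hgi := integrable_continuousMap μ (Θ.r g)
    have hdi : Integrable (fun x => |F x - Θ.r g x|) μ := (hFi.sub hgi).abs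
    have hle : ∀ D : Set K, ∫ x in D, |F x - Θ.r g x| ∂μ ≤ ε := fun D =>
      (setIntegral_le_integral hdi (Eventually.of_forall fun x => abs_nonneg _)).trans hg
    have hFint : ∀ i, ∫ x in B i, F x ∂μ = if i = b then μ.real (B b) else 0 := fun i => by
      rw [hF, setIntegral_indicator (hB b), setIntegral_const, smul_eq_mul, mul_one]
      split_ifs with hi
      · rw [hi, inter_self]
      · rw [(hdis hi).inter_eq, measureReal_empty]
    have h1 : s b * (μ.real (B b) : ℂ) = Θ.ev g (∑ i, s i • v i) +
        ∑ i, s i * ((∫ x in B i, (F x - Θ.r g x) ∂μ : ℝ) : ℂ) := by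
      have e1 : ∀ i, ∫ x in B i, (F x - Θ.r g x) ∂μ =
          (if i = b then μ.real (B b) else 0) - ∫ x in B i, Θ.r g x ∂μ := fun i => by
        rw [integral_sub hFi.integrableOn hgi.integrableOn, hFint]
      simp only [map_sum, map_smul, (hv _).ev_eq g, e1, smul_eq_mul, Complex.ofReal_sub, mul_sub,
        Finset.sum_sub_distrib]
      rw [add_sub_cancel]
      simp [apply_ite]
    have h2 : ‖Θ.ev g (∑ i, s i • v i)‖ ≤ κ * ε := by
      refine (h g).trans (mul_le_mul_of_nonneg_left ?_ hκ)
      refine le_trans (le_of_eq ?_) (hle E)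
      refine setIntegral_congr_fun hE fun x hx => ?_
      have : F x = 0 := indicator_of_notMem (fun hx' => disjoint_left.1 hb hx hx') _
      simp [this]
    have h3 : ‖∑ i, s i * ((∫ x in B i, (F x - Θ.r g x) ∂μ : ℝ) : ℂ)‖ ≤ (∑ i, ‖s i‖) * ε := by
      rw [Finset.sum_mul]
      refine norm_sum_le_of_le _ fun i _ => ?_
      rw [norm_mul, Complex.norm_real]
      exact mul_le_mul_of_nonneg_left ((norm_integral_le_integral_norm _).trans (hle _))
        (norm_nonneg _)
    have h4 : ‖s b‖ * μ.real (B b) = ‖s b * (μ.real (B b) : ℂ)‖ := by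
      rw [norm_mul, Complex.norm_real, Real.norm_of_nonneg hmass.le]
    rw [h4, h1, add_mul]
    exact (norm_add_le _ _).trans (add_le_add h2 h3)
  have hlim : Tendsto (fun ε : ℝ => (κ + ∑ i, ‖s i‖) * ε) (𝓝[>] 0) (𝓝 ((κ + ∑ i, ‖s i‖) * 0)) :=
    (tendsto_nhdsWithin_of_tendsto_nhds tendsto_id).const_mul _
  rw [mul_zero] at hlim
  have h0 : ‖s b‖ * μ.real (B b) ≤ 0 :=
    ge_of_tendsto hlim (eventually_nhdsWithin_of_forall fun ε hε => key ε hε)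
  have : ‖s b‖ ≤ 0 := by
    by_contra hs
    exact absurd h0 (not_le.2 (mul_pos (not_le.1 hs) hmass))
  exact norm_le_zero_iff.1 this

end TestPairing

/-! ### The basis of atoms -/

namespace TestPairing

variable {K S H : Type*} [TopologicalSpace K] [CompactSpace K] [T2Space K]
  [SecondCountableTopology K] [MeasurableSpace K] [BorelSpace K] [AddCommGroup S]
  [Module ℝ S] [NormedAddCommGroup H] [NormedSpace ℂ H]
  {Θ : TestPairing K S H} {ν : Measure K} {T : K → K} {A : H →L[ℂ] H}

/-- The restrictions of the invariant measure to a finite partition form a basis of the range of `P`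
which is permuted by the operator, and invariant sets are unions of members of the partition. -/
structure IsAtomBasis (Θ : TestPairing K S H) (ν : Measure K) (T : K → K) (A P : H →L[ℂ] H)
    (μ : Measure K) {n : ℕ} (B : Fin n → Set K) (v : Fin n → H) (τ : Equiv.Perm (Fin n)) :
    Prop where
  measurable : ∀ i, MeasurableSet (B i)
  ne_zero : ∀ i, μ (B i) ≠ 0
  disjoint : Pairwise (Function.onFun Disjoint B)
  compl : μ (⋃ i, B i)ᶜ = 0
  mem_range : ∀ i, v i ∈ P.range
  represents : ∀ i, Θ.Represents ν (v i) (μ.restrict (B i))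
  map_eq : ∀ i, A (v i) = v (τ i)
  span : ∀ x ∈ P.range, ∃ s : Fin n → ℂ, x = ∑ i, s i • v i
  atom : ∀ i D, MeasurableSet D → T ⁻¹' D = D → μ (B i ∩ D) = 0 ∨ μ (B i \ D) = 0

theorem linearIndependent_of_represents_restrict {μ : Measure K} [IsFiniteMeasure μ] {ι : Type*}
    [Fintype ι] {B : ι → Set K} (hB : ∀ i, MeasurableSet (B i))
    (hdis : Pairwise (Function.onFun Disjoint B)) {v : ι → H}
    (hv : ∀ i, Θ.Represents ν (v i) (μ.restrict (B i))) (h0 : ∀ i, μ (B i) ≠ 0) :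
    LinearIndependent ℂ v := by
  refine Fintype.linearIndependent_iff.2 fun s hs i => ?_
  refine coeff_eq_zero hB hdis hv MeasurableSet.empty le_rfl (fun g => ?_) (empty_disjoint _) (h0 i)
  simp [hs]

namespace IsPeripheralSystem

variable {P : H →L[ℂ] H} {C δ : ℝ} {φ : ℕ → ℕ} {u₀ : H} {f₀ : K → ℝ} {N₀ : ℕ} {w : H}
  {μ : Measure K} {c : ℝ} (hR : Θ.IsPeripheralSystem ν T A P C δ φ u₀ f₀ N₀ w μ c)

include hR

/-- The operator is injective on the range of `P`, because `A ^ φ j` converges to the identity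
there. -/
theorem eq_zero_of_map_eq_zero {x : H} (hx : x ∈ P.range) (h : A x = 0) : x = 0 := by
  have hlim := hR.tendsto_pow_apply x
  rw [hR.apply_of_mem_range hx] at hlim
  refine tendsto_nhds_unique (hlim.congr' ?_) (tendsto_const_nhds (x := (0 : H)) (f := atTop))
  filter_upwards [hR.strictMono.tendsto_atTop.eventually (eventually_ge_atTop 1)] with j hj
  obtain ⟨k, hk⟩ := Nat.exists_eq_add_of_le' hj
  rw [hk, pow_succ]
  change (A ^ k) (A x) = 0
  rw [h, map_zero]

/-- An element of the range of `P` in the cone is a nonnegative combination of the restrictions of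
`μ` to the atoms. -/
theorem eq_sum_of_atoms {n : ℕ} {B : Fin n → Set K} {v : Fin n → H}
    (hB : ∀ i, MeasurableSet (B i)) (hdis : Pairwise (Function.onFun Disjoint B))
    (hcompl : μ (⋃ i, B i)ᶜ = 0) (hv : ∀ i, Θ.Represents ν (v i) (μ.restrict (B i)))
    (hatom : ∀ i D, IsRigid T μ φ D → μ (B i ∩ D) = 0 ∨ μ (B i \ D) = 0) {x : H}
    {m : Measure K} (hx : x ∈ P.range) (hm : Θ.Represents ν x m) :
    ∃ t : Fin n → ℝ, (∀ i, m (B i) = ENNReal.ofReal (t i) * μ (B i)) ∧ (∀ i, 0 ≤ t i) ∧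
      x = ∑ i, (t i : ℂ) • v i := by
  have hν := hR.finite
  choose t ht0 ht using fun i => hR.restrict_eq_smul_of_atom hx hm (hB i) (hatom i)
  refine ⟨t, fun i => ?_, ht0, ?_⟩
  · have := congrArg (fun m' => m' (B i)) (ht i)
    simpa using this
  · have h1 := represents_sum (Θ := Θ) Finset.univ fun i _ => (hv i).smul (ht0 i)
    have h2 : m = ∑ i, ENNReal.ofReal (t i) • μ.restrict (B i) := by
      simp only [← ht]
      rw [← Measure.sum_fintype, ← Measure.restrict_iUnion hdis hB, Measure.restrict_eq_self_of_ae_mem]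
      exact mem_ae_iff.2 ((hR.absolutelyContinuous hx hm) hcompl)
    rw [← h2] at h1
    exact eq_of_ev fun g => by rw [hm.ev_eq, h1.ev_eq]

/-- The number of disjoint nonnull rigid sets is at most the dimension of the range of `P`, since
the restrictions of `μ` to such sets are linearly independent. Hence there are finitely many atoms.
The operator maps the restriction of `μ` to an atom to a multiple of another one, and the factors
are one because the sum `w` of these restrictions is fixed. -/
theorem exists_isAtomBasis : ∃ (n : ℕ) (B : Fin n → Set K) (v : Fin n → H)
    (τ : Equiv.Perm (Fin n)), Θ.IsAtomBasis ν T A P μ B v τ := by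
  have hν := hR.finite
  have hμ := hR.represents.finite
  have hfd := hR.finiteRange
  obtain ⟨n, B, hB, hdis, hcompl, hatom⟩ := exists_atoms (μ := μ) (IsRigid T μ φ)
    (isRigid_of_invariant MeasurableSet.univ preimage_univ) (fun B B' h h' => h.diff h')
    (b := Module.finrank ℂ P.range) (fun n B hB hdis => by
      choose v hvr hv using fun i => hR.exists_represents_restrict (hB i).1
      have hli := linearIndependent_of_represents_restrict (fun i => (hB i).1.1) hdis hv
        fun i => (hB i).2
      have hli' : LinearIndependent ℂ fun i => (⟨v i, hvr i⟩ : P.range) :=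
        LinearIndependent.of_comp P.range.subtype hli
      simpa using hli'.fintype_card_le_finrank)
  have hBm : ∀ i, MeasurableSet (B i) := fun i => (hB i).1.1
  choose v hvr hv using fun i => hR.exists_represents_restrict (hB i).1
  have hli := linearIndependent_of_represents_restrict hBm hdis hv fun i => (hB i).2
  have hsum := fun {x : H} {m : Measure K} (hx : x ∈ P.range) (hm : Θ.Represents ν x m) =>
    hR.eq_sum_of_atoms hBm hdis hcompl hv hatom hx hm
  -- The image of an atom is contained in an atom.
  have himage : ∀ i, ∃ j, ∃ t : ℝ, A (v i) = (t : ℂ) • v j := by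
    intro i
    have hmeas : ∀ j, (μ.restrict (B i)).map T (B j) = μ (B i ∩ T ⁻¹' B j) := fun j => by
      rw [Measure.map_apply hR.qmp.measurable (hBm j),
        Measure.restrict_apply (hR.qmp.measurable (hBm j)), inter_comm]
    obtain ⟨j, hj⟩ : ∃ j, μ (B i ∩ T ⁻¹' B j) ≠ 0 := by
      by_contra! h
      refine (hB i).2 (measure_mono_null (t := (⋃ j, B i ∩ T ⁻¹' B j) ∪ T ⁻¹' (⋃ j, B j)ᶜ) ?_ ?_)
      · intro x hx
        by_cases hx' : T x ∈ ⋃ j, B j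
        · obtain ⟨j, hj⟩ := mem_iUnion.1 hx'
          exact Or.inl (mem_iUnion.2 ⟨j, hx, hj⟩)
        · exact Or.inr hx'
      · refine measure_union_null (measure_iUnion_null h) ?_
        exact hR.measurePreserving.quasiMeasurePreserving.preimage_null hcompl
    have hj' : μ (B i \ T ⁻¹' B j) = 0 :=
      (hatom i _ ((hB j).1.preimage hR.measurePreserving)).resolve_left hj
    obtain ⟨t, ht, ht0, hAv⟩ := hsum (by simpa using hR.pow_mem_range (hvr i) 1)
      (hR.represents_map (hv i))
    refine ⟨j, t j, hAv.trans (Finset.sum_eq_single j (fun k _ hk => ?_) (by simp))⟩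
    have h0 : (μ.restrict (B i)).map T (B k) = 0 := by
      rw [hmeas]
      refine measure_mono_null (t := B i \ T ⁻¹' B j) (fun x hx => ⟨hx.1, fun hxj => ?_⟩) hj'
      exact disjoint_left.1 (hdis hk) hx.2 hxj
    have := ht k
    rw [h0, eq_comm, mul_eq_zero, or_iff_left (hB k).2, ENNReal.ofReal_eq_zero] at this
    rw [le_antisymm this (ht0 k), Complex.ofReal_zero, zero_smul]
  choose τ t hτ using himage
  have ht0 : ∀ i, (t i : ℂ) ≠ 0 := fun i h => by
    refine hli.ne_zero i (hR.eq_zero_of_map_eq_zero (hvr i) ?_)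
    rw [hτ, h, zero_smul]
  have hinj : Function.Injective τ := by
    intro i j hij
    by_contra hne
    have h0 : A ((t j : ℂ) • v i - (t i : ℂ) • v j) = 0 := by
      rw [map_sub, map_smul, map_smul, hτ i, hτ j, hij, smul_comm, sub_self]
    have h1 := hR.eq_zero_of_map_eq_zero (Submodule.sub_mem _ (Submodule.smul_mem _ _ (hvr i))
      (Submodule.smul_mem _ _ (hvr j))) h0
    have hpair : Function.Injective ![i, j] := by
      intro a b hab
      fin_cases a <;> fin_cases b <;> simp_all
    have h2 := Fintype.linearIndependent_iff.1 (hli.comp _ hpair) ![(t j : ℂ), -(t i : ℂ)]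
      (by simpa [← sub_eq_add_neg] using h1) 0
    exact ht0 j h2
  let τ' : Equiv.Perm (Fin n) := Equiv.ofBijective τ (Finite.injective_iff_bijective.1 hinj)
  have hw : w = ∑ i, v i := by
    have h1 := represents_sum (Θ := Θ) Finset.univ fun i _ => hv i
    have h2 : μ = ∑ i, μ.restrict (B i) := by
      rw [← Measure.sum_fintype, ← Measure.restrict_iUnion hdis hBm,
        Measure.restrict_eq_self_of_ae_mem]
      exact mem_ae_iff.2 hcompl
    rw [← h2] at h1
    exact eq_of_ev fun g => by rw [hR.represents.ev_eq, h1.ev_eq]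
  have ht1 : ∀ i, (t i : ℂ) = 1 := by
    have h1 : ∑ i, (t i : ℂ) • v (τ i) = ∑ i, v (τ i) := by
      have := hR.fixed
      rw [hw, map_sum] at this
      simp only [hτ] at this
      exact this.trans (Equiv.sum_comp τ' v).symm
    have h2 : ∑ i, ((t i : ℂ) - 1) • v (τ i) = 0 := by
      simp only [sub_smul, one_smul, Finset.sum_sub_distrib, h1, sub_self]
    exact fun i => sub_eq_zero.1
      (Fintype.linearIndependent_iff.1 (hli.comp τ hinj) (fun i => (t i : ℂ) - 1) h2 i)
  refine ⟨n, B, v, τ', hBm, fun i => (hB i).2, hdis, hcompl, hvr, hv, fun i => ?_, fun x hx => ?_,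
    fun i D hD hTD => hatom i D (isRigid_of_invariant hD hTD)⟩
  · rw [hτ, ht1, one_smul]
    rfl
  · have hmem : x ∈ Submodule.span ℂ (range v) := by
      refine Submodule.span_le.2 ?_ (hR.mem_span_of_mem_range hx)
      rintro _ ⟨u, ψ, b, hψ, -, -, hu, rfl⟩
      obtain ⟨m, hm⟩ := exists_represents (hR.proj_mem_cone (hu.mem_cone hψ))
      obtain ⟨s, -, -, hs⟩ := hsum ⟨u, rfl⟩ hm
      change P u = _ at hs
      rw [hs]
      exact Submodule.sum_mem _ fun i _ =>
        Submodule.smul_mem _ _ (Submodule.subset_span ⟨i, rfl⟩)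
    obtain ⟨s, hs⟩ := (Submodule.mem_span_range_iff_exists_fun ℂ).1 hmem
    exact ⟨s, hs.symm⟩

end IsPeripheralSystem

end TestPairing

/-! ### Mixing -/

namespace TestPairing

variable {K S H : Type*} [TopologicalSpace K] [CompactSpace K] [T2Space K]
  [SecondCountableTopology K] [MeasurableSpace K] [BorelSpace K] [AddCommGroup S]
  [Module ℝ S] [NormedAddCommGroup H] [NormedSpace ℂ H]
  {Θ : TestPairing K S H} {ν : Measure K} {T : K → K} {A : H →L[ℂ] H}

/-- A basis `v` of the range of `P` made of probability measures `m` which are permuted by the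
operator, are separated by nonnegative test functions, and for which the projection of the product
of a basis vector with a function is a multiple of the same basis vector. The field `atom` is the
ergodicity of each `m i` with respect to invariant sets, although `m i` need not be invariant
itself. -/
structure IsMixingBasis (Θ : TestPairing K S H) (ν : Measure K) (T : K → K) (A P : H →L[ℂ] H)
    {n : ℕ} (m : Fin n → Measure K) (v : Fin n → H) (τ : Equiv.Perm (Fin n)) : Prop where
  prob : ∀ i, IsProbabilityMeasure (m i)
  represents : ∀ i, Θ.Represents ν (v i) (m i)
  map_eq : ∀ i, A (v i) = v (τ i)
  mem_range : ∀ i, v i ∈ P.range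
  span : ∀ x ∈ P.range, ∃ s : Fin n → ℂ, x = ∑ i, s i • v i
  proj_mul : ∀ (f : C(K, ℂ)) M, Θ.IsMul ν f M → ∀ i, P (M (v i)) = (∫ x, f x ∂m i) • v i
  atom : ∀ i D, MeasurableSet D → T ⁻¹' D = D → m i D = 0 ∨ m i Dᶜ = 0
  approx : ∀ i, ∀ ε > 0, ∃ g, 0 ≤ Θ.r g ∧ ∀ j, |(if j = i then 1 else 0) - ∫ x, Θ.r g x ∂m j| ≤ ε

namespace IsPeripheralSystem

variable {P : H →L[ℂ] H} {C δ : ℝ} {φ : ℕ → ℕ} {u₀ : H} {f₀ : K → ℝ} {N₀ : ℕ} {w : H}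
  {μ : Measure K} {c : ℝ} (hR : Θ.IsPeripheralSystem ν T A P C δ φ u₀ f₀ N₀ w μ c)

include hR

/-- The product of a function with the restriction of `μ` to an atom projects to a multiple of this
restriction: along the times `φ j` which fix the atom, the iterates of the product are dominated by
the restriction of `μ` to the atom. -/
theorem proj_mul_restrict {n : ℕ} {B : Fin n → Set K} {v : Fin n → H} {τ : Equiv.Perm (Fin n)}
    (hB : Θ.IsAtomBasis ν T A P μ B v τ) {f : C(K, ℂ)} {M : H →L[ℂ] H} (hM : Θ.IsMul ν f M)
    (i : Fin n) : (μ.real (B i) : ℂ) • P (M (v i)) = (∫ x in B i, f x ∂μ) • v i := by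
  have hν := hR.finite
  have hμ := hR.represents.finite
  have hpow : ∀ k : ℕ, (A ^ k) (v i) = v ((τ ^ k) i) := fun k => by
    induction k with
    | zero => rfl
    | succ k ih =>
      rw [pow_succ', pow_succ']
      change A ((A ^ k) (v i)) = _
      rw [ih, hB.map_eq]
      rfl
  -- The atom is fixed by `T ^ φ j` for large `j`.
  have hfix : ∀ᶠ j in atTop, (A ^ φ j) (v i) = v i := by
    have hlim := hR.tendsto_pow_apply (v i)
    rw [hR.apply_of_mem_range (hB.mem_range i)] at hlim
    have hcl : IsClosed (range v \ {v i}) := ((finite_range v).subset sdiff_subset).isClosed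
    have hmem : (range v \ {v i})ᶜ ∈ 𝓝 (v i) := hcl.isOpen_compl.mem_nhds (by simp)
    filter_upwards [hlim.eventually hmem] with j hj
    by_contra h
    exact hj ⟨⟨_, (hpow _).symm⟩, h⟩
  have hlimev : ∀ g, Tendsto (fun j => Θ.ev g ((A ^ φ j) (M (v i)))) atTop
      (𝓝 (Θ.ev g (P (M (v i))))) := fun g =>
    ((Θ.ev g).continuous.tendsto _).comp (hR.tendsto_pow_apply _)
  obtain ⟨s, hs⟩ := hB.span (P (M (v i))) ⟨_, rfl⟩
  have hbound : ∀ g, ‖Θ.ev g (∑ b, s b • v b)‖ ≤ ‖f‖ * ∫ x in B i, |Θ.r g x| ∂μ := fun g => by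
    rw [← hs]
    refine le_of_tendsto (hlimev g).norm ?_
    filter_upwards [hfix] with j hj
    have hT := hR.qmp.measurable.iterate (φ j)
    have hmap : (μ.restrict (B i)).map T^[φ j] = μ.restrict (B i) := by
      have := hR.represents_pow (hB.represents i) (φ j)
      rw [hj] at this
      exact this.unique (hB.represents i)
    rw [hR.ev_pow_mul (hB.represents i) hM]
    have hi : ∫ x in B i, |Θ.r g x| ∂μ = ∫ x in B i, |Θ.r g (T^[φ j] x)| ∂μ := by
      conv_lhs => rw [← hmap]
      exact integral_map hT.aemeasurable (Θ.r g).continuous.abs.aestronglyMeasurable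
    rw [hi, ← integral_const_mul]
    refine (norm_integral_le_integral_norm _).trans (integral_mono_of_nonneg
      (Eventually.of_forall fun x => norm_nonneg _) ?_ (Eventually.of_forall fun x => ?_))
    · refine (Integrable.of_bound (((Θ.r g).continuous.measurable.comp hT).norm.aestronglyMeasurable)
        ‖Θ.r g‖ (Eventually.of_forall fun x => ?_)).const_mul _
      rw [norm_norm]
      exact (Θ.r g).norm_coe_le_norm _
    · simp only
      rw [norm_mul, Complex.norm_real]
      exact mul_le_mul_of_nonneg_right (f.norm_coe_le_norm x) (norm_nonneg _)
  have hzero : ∀ b, b ≠ i → s b = 0 := fun b hb =>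
    coeff_eq_zero hB.measurable hB.disjoint hB.represents (hB.measurable i) (norm_nonneg f) hbound
      (hB.disjoint (Ne.symm hb)) (hB.ne_zero b)
  have hs' : P (M (v i)) = s i • v i :=
    hs.trans (Finset.sum_eq_single i (fun b _ hb => by rw [hzero b hb, zero_smul]) (by simp))
  obtain ⟨e, he⟩ := Θ.one
  have h1 : Θ.ev e (P (M (v i))) = ∫ x in B i, f x ∂μ := by
    refine tendsto_nhds_unique (hlimev e) (tendsto_const_nhds.congr fun j => ?_)
    rw [hR.ev_pow_mul (hB.represents i) hM]
    simp [he]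
  have h2 : Θ.ev e (v i) = (μ.real (B i) : ℂ) := by
    rw [(hB.represents i).ev_eq e]
    simp [he]
  rw [← h1, hs', map_smul, h2, smul_smul, smul_eq_mul, mul_comm]

/-- The basis consists of `μ` conditioned on the atoms. -/
theorem exists_isMixingBasis : ∃ (n : ℕ) (m : Fin n → Measure K) (v : Fin n → H)
    (τ : Equiv.Perm (Fin n)), Θ.IsMixingBasis ν T A P m v τ := by
  have hν := hR.finite
  have hμ := hR.represents.finite
  obtain ⟨n, B, v, τ, hB⟩ := hR.exists_isAtomBasis
  have hpos : ∀ i, 0 < μ.real (B i) := fun i =>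
    ENNReal.toReal_pos (hB.ne_zero i) (measure_ne_top _ _)
  have hmap : ∀ i, (μ.restrict (B i)).map T = μ.restrict (B (τ i)) := fun i => by
    have := hR.represents_map (hB.represents i)
    rw [hB.map_eq] at this
    exact this.unique (hB.represents _)
  have hmass : ∀ i, μ.real (B (τ i)) = μ.real (B i) := fun i => by
    have := congrArg (fun m' : Measure K => m'.real univ) (hmap i)
    simp only [measureReal_restrict_apply_univ] at this
    rw [← this, map_measureReal_apply hR.qmp.measurable MeasurableSet.univ, preimage_univ,
      measureReal_restrict_apply_univ]
  have hne : ∀ i, (μ.real (B i) : ℂ) ≠ 0 := fun i => by exact_mod_cast (hpos i).ne'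
  have hcond : ∀ i, ProbabilityTheory.cond μ (B i) =
      ENNReal.ofReal (μ.real (B i))⁻¹ • μ.restrict (B i) := fun i => by
    rw [ProbabilityTheory.cond, ENNReal.ofReal_inv_of_pos (hpos i), Measure.real,
      ENNReal.ofReal_toReal (measure_ne_top _ _)]
  have hint : ∀ i (f : C(K, ℂ)), ∫ x, f x ∂(ProbabilityTheory.cond μ (B i)) =
      (μ.real (B i) : ℂ)⁻¹ * ∫ x in B i, f x ∂μ := fun i f => by
    rw [hcond, integral_smul_measure, ENNReal.toReal_ofReal (inv_nonneg.2 (hpos i).le)]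
    simp
  have hprob : ∀ i, IsProbabilityMeasure (ProbabilityTheory.cond μ (B i)) := fun i =>
    ProbabilityTheory.cond_isProbabilityMeasure (hB.ne_zero i)
  refine ⟨n, fun i => ProbabilityTheory.cond μ (B i), fun i => ((μ.real (B i))⁻¹ : ℝ) • v i, τ,
    hprob, fun i => ?_, fun i => ?_, fun i => ?_, fun x hx => ?_, fun f M hM i => ?_,
    fun i D hD hTD => ?_, fun i ε hε => ?_⟩
  · rw [hcond]
    exact (hB.represents i).smul (inv_nonneg.2 (hpos i).le)
  · rw [← Complex.coe_smul, map_smul, hB.map_eq, hmass]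
    rfl
  · rw [← Complex.coe_smul]
    exact Submodule.smul_mem _ _ (hB.mem_range i)
  · obtain ⟨s, hs⟩ := hB.span x hx
    refine ⟨fun i => s i * μ.real (B i), hs.trans (Finset.sum_congr rfl fun i _ => ?_)⟩
    rw [← Complex.coe_smul, smul_smul, Complex.ofReal_inv, mul_assoc, mul_inv_cancel₀ (hne i),
      mul_one]
  · rw [← Complex.coe_smul, map_smul, map_smul, hint, smul_smul, mul_right_comm, mul_smul,
      ← hR.proj_mul_restrict hB hM i, smul_smul, Complex.ofReal_inv, mul_assoc,
      inv_mul_cancel₀ (hne i), mul_one]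
  · rcases hB.atom i D hD hTD with h | h
    · left
      rw [ProbabilityTheory.cond_apply (hB.measurable i), h, mul_zero]
    · right
      rw [ProbabilityTheory.cond_apply (hB.measurable i), ← sdiff_eq, h, mul_zero]
  · set m := fun i => ProbabilityTheory.cond μ (B i) with hm
    set F : K → ℝ := (B i).indicator fun _ => (1 : ℝ) with hF
    have hFi : ∀ m' : Measure K, IsFiniteMeasure m' → Integrable F m' := fun m' _ =>
      (integrable_const 1).indicator (hB.measurable i)
    obtain ⟨g, hg0, hg⟩ := exists_nonneg_test_integral_sub_le Θ.dense Θ.one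
      (hFi (∑ j, m j) inferInstance) (fun x => indicator_nonneg (fun _ _ => zero_le_one) x) hε
    refine ⟨g, hg0, fun j => ?_⟩
    have hFj : ∫ x, F x ∂m j = if j = i then 1 else 0 := by
      rw [hF, integral_indicator (hB.measurable i), setIntegral_const, smul_eq_mul, mul_one, hm,
        Measure.real, ProbabilityTheory.cond_apply (hB.measurable j)]
      split_ifs with h
      · rw [h, inter_self, ENNReal.inv_mul_cancel (hB.ne_zero i) (measure_ne_top _ _),
          ENNReal.toReal_one]
      · rw [(hB.disjoint h).inter_eq, measure_empty, mul_zero, ENNReal.toReal_zero]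
    have hgi := integrable_continuousMap (m j) (Θ.r g)
    rw [← hFj, ← integral_sub (hFi _ inferInstance) hgi]
    refine (abs_integral_le_integral_abs).trans (le_trans ?_ hg)
    refine integral_mono_measure ?_ (Eventually.of_forall fun x => abs_nonneg _)
      ((hFi _ inferInstance).sub (integrable_continuousMap _ (Θ.r g))).abs
    exact Finset.single_le_sum (f := m) (fun _ _ => Measure.zero_le _) (Finset.mem_univ j)

end IsPeripheralSystem

namespace IsMixingBasis

variable {P : H →L[ℂ] H} {C δ : ℝ} {φ : ℕ → ℕ} {n : ℕ} {m : Fin n → Measure K} {v : Fin n → H}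
  {τ : Equiv.Perm (Fin n)} (hB : Θ.IsMixingBasis ν T A P m v τ)

include hB

theorem pow_apply (k : ℕ) (i : Fin n) : (A ^ k) (v i) = v ((τ ^ k) i) := by
  induction k with
  | zero => rfl
  | succ k ih =>
    rw [pow_succ', pow_succ']
    change A ((A ^ k) (v i)) = _
    rw [ih, hB.map_eq]
    rfl

theorem measure_map (hS : Θ.IsTransferSystem ν T A) (i : Fin n) : (m i).map T = m (τ i) := by
  have := hS.represents_map (hB.represents i)
  rw [hB.map_eq] at this
  exact this.unique (hB.represents _)

/-- Exponential decay of correlations for a basis measure and the power of the map which fixes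
it. -/
theorem norm_correlation_le (hS : Θ.IsTransferSystem ν T A)
    (hP : IsPeripheralProjection A P C δ φ) {k : ℕ} {i : Fin n} (hk : (τ ^ k) i = i) :
    ∃ c : ℝ, 0 ≤ c ∧ ∀ (f g : C(K, ℂ)) (Mf Mg : H →L[ℂ] H), Θ.IsMul ν f Mf → Θ.IsMul ν g Mg →
      ∀ j : ℕ, ‖∫ x, f x * g (T^[k * j] x) ∂m i - (∫ x, f x ∂m i) * ∫ x, g x ∂m i‖ ≤
        c * ‖Mf‖ * ‖Mg‖ * δ ^ (k * j) := by
  obtain ⟨e, he⟩ := Θ.one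
  refine ⟨‖Θ.ev e‖ * C * ‖v i‖,
    mul_nonneg (mul_nonneg (norm_nonneg _) hP.C_pos.le) (norm_nonneg _),
    fun f g Mf Mg hf hg j => ?_⟩
  have hkj : (τ ^ (k * j)) i = i := by
    rw [pow_mul]
    induction j with
    | zero => rfl
    | succ j ih => rw [pow_succ, Equiv.Perm.mul_apply, hk, ih]
  have h1 : Θ.ev e (Mg ((A ^ (k * j)) (Mf (v i)))) = ∫ x, f x * g (T^[k * j] x) ∂m i := by
    rw [hS.ev_mul_pow_mul (hB.represents i) hf hg]
    simp [he]
  have h2 : Θ.ev e (Mg (v i)) = ∫ x, g x ∂m i := by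
    have := hS.ev_pow_mul (hB.represents i) hg 0 e
    simpa [he] using this
  have h3 : (A ^ (k * j)) (P (Mf (v i))) = (∫ x, f x ∂m i) • v i := by
    rw [hB.proj_mul f Mf hf, map_smul, hB.pow_apply, hkj]
  have h4 : (A ^ (k * j)) (Mf (v i)) =
      (∫ x, f x ∂m i) • v i + (A ^ (k * j) * (1 - P)) (Mf (v i)) := by
    rw [← h3]
    change _ = _ + (A ^ (k * j)) (Mf (v i) - P (Mf (v i)))
    rw [← map_add]
    congr 1
    abel
  have h5 : ∫ x, f x * g (T^[k * j] x) ∂m i - (∫ x, f x ∂m i) * ∫ x, g x ∂m i =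
      Θ.ev e (Mg ((A ^ (k * j) * (1 - P)) (Mf (v i)))) := by
    rw [← h1, ← h2, h4, map_add, map_add, map_smul, map_smul, smul_eq_mul, add_sub_cancel_left]
  have hδ : 0 ≤ C * δ ^ (k * j) := mul_nonneg hP.C_pos.le (pow_nonneg hP.δ_pos.le _)
  rw [h5]
  calc ‖Θ.ev e (Mg ((A ^ (k * j) * (1 - P)) (Mf (v i))))‖
      ≤ ‖Θ.ev e‖ * (‖Mg‖ * ((C * δ ^ (k * j)) * (‖Mf‖ * ‖v i‖))) := by
        refine (ContinuousLinearMap.le_opNorm _ _).trans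
          (mul_le_mul_of_nonneg_left ?_ (norm_nonneg _))
        refine (ContinuousLinearMap.le_opNorm _ _).trans
          (mul_le_mul_of_nonneg_left ?_ (norm_nonneg _))
        exact (ContinuousLinearMap.le_opNorm _ _).trans (mul_le_mul (hP.contraction _)
          (ContinuousLinearMap.le_opNorm _ _) (norm_nonneg _) hδ)
    _ = _ := by ring

end IsMixingBasis

end TestPairing

/-! ### Almost sure convergence of averages from a quadratic estimate -/

section Averages

/-- The averages of a bounded sequence converge as soon as they converge along fourth powers,
because the quotients of consecutive fourth powers tend to one. -/
theorem tendsto_average_of_pow {x : ℕ → ℝ} {b y : ℝ} (hb : ∀ n, |x n| ≤ b)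
    (h : Tendsto (fun k : ℕ => (((k + 1) ^ 4 : ℕ) : ℝ)⁻¹ * ∑ n ∈ Finset.range ((k + 1) ^ 4), x n)
      atTop (𝓝 y)) :
    Tendsto (fun N : ℕ => (N : ℝ)⁻¹ * ∑ n ∈ Finset.range N, x n) atTop (𝓝 y) := by
  -- Adding a constant makes the sums monotone.
  set u : ℕ → ℝ := fun N => ∑ n ∈ Finset.range N, (x n + b) with hu
  have hsum : ∀ N : ℕ, u N = ∑ n ∈ Finset.range N, x n + N * b := fun N => by
    simp [hu, Finset.sum_add_distrib]
  have hdiv : ∀ N : ℕ, N ≠ 0 → u N / N = (N : ℝ)⁻¹ * ∑ n ∈ Finset.range N, x n + b := fun N hN => by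
    have : (N : ℝ) ≠ 0 := by exact_mod_cast hN
    rw [hsum]
    field_simp
  have hmono : Monotone u := monotone_nat_of_le_succ fun N => by
    have := (abs_le.1 (hb N)).1
    simp only [hu, Finset.sum_range_succ]
    linarith
  have hlim := tendsto_div_of_monotone_of_exists_subseq_tendsto_div u (y + b) hmono fun a ha => by
    refine ⟨fun k => (k + 1) ^ 4, ?_, ?_, ?_⟩
    · have h1 : Tendsto (fun k : ℕ => (1 + 1 / ((k : ℝ) + 1)) ^ 4) atTop (𝓝 ((1 + 0) ^ 4)) :=
        (tendsto_one_div_add_atTop_nhds_zero_nat.const_add 1).pow 4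
      have h2 : ((1 : ℝ) + 0) ^ 4 < a := by simpa using ha
      filter_upwards [h1.eventually_lt_const h2] with k hk
      have hk0 : (0 : ℝ) < (k : ℝ) + 1 := by positivity
      push_cast
      calc ((k : ℝ) + 1 + 1) ^ 4 = (1 + 1 / ((k : ℝ) + 1)) ^ 4 * ((k : ℝ) + 1) ^ 4 := by
            rw [← mul_pow]
            congr 1
            field_simp
        _ ≤ a * ((k : ℝ) + 1) ^ 4 := by gcongr
    · exact tendsto_atTop_mono (fun k => (Nat.le_succ k).trans (Nat.le_self_pow (by norm_num) _))
        tendsto_id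
    · refine (h.add_const b).congr fun k => ?_
      rw [hdiv _ (by positivity)]
  have := hlim.sub_const b
  rw [add_sub_cancel_right] at this
  refine this.congr' ?_
  filter_upwards [eventually_ge_atTop 1] with N hN
  rw [hdiv N (by omega), add_sub_cancel_right]

/-- If the second moments of the sums of `L` consecutive terms of a bounded sequence of functions
are equal to `L ^ 2 * β + O(L)`, then the averages of the sequence converge almost surely: the
square of the distance in mean square of the averages at times `N ≤ M` is `O(1 / N)`, which is
summable along the fourth powers even after taking square roots. -/
theorem exists_tendsto_average_of_sum_sq {K : Type*} [MeasurableSpace K] {m : Measure K}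
    [IsFiniteMeasure m] {X : ℕ → K → ℝ} (hX : ∀ n, Measurable (X n)) {b : ℝ}
    (hb : ∀ n x, |X n x| ≤ b) {β D : ℝ}
    (h : ∀ N L : ℕ, |∫ x, (∑ n ∈ Finset.range L, X (N + n) x) ^ 2 ∂m - (L : ℝ) ^ 2 * β| ≤ D * L) :
    ∃ Y : K → ℝ, Measurable Y ∧ (∀ᵐ x ∂m, Tendsto (fun N : ℕ => (N : ℝ)⁻¹ *
      ∑ n ∈ Finset.range N, X n x) atTop (𝓝 (Y x))) ∧ (∀ᵐ x ∂m, |Y x| ≤ b) ∧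
      ∫ x, Y x ^ 2 ∂m = β := by
  set Z : ℕ → K → ℝ := fun N x => (N : ℝ)⁻¹ * ∑ n ∈ Finset.range N, X n x with hZ
  have hSm : ∀ N L : ℕ, Measurable fun x => ∑ n ∈ Finset.range L, X (N + n) x := fun N L =>
    Finset.measurable_sum _ fun n _ => hX _
  have hSb : ∀ N L x, |∑ n ∈ Finset.range L, X (N + n) x| ≤ L * b := fun N L x => by
    refine (Finset.abs_sum_le_sum_abs _ _).trans ((Finset.sum_le_sum fun n _ => hb _ x).trans ?_)
    simp
  have hS2 : ∀ N L : ℕ, Integrable (fun x => (∑ n ∈ Finset.range L, X (N + n) x) ^ 2) m :=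
    fun N L => Integrable.of_bound ((hSm N L).pow_const 2).aestronglyMeasurable ((L * b) ^ 2)
      (Eventually.of_forall fun x => by
        rw [Real.norm_eq_abs, abs_pow]
        exact pow_le_pow_left₀ (abs_nonneg _) (hSb N L x) 2)
  have hZm : ∀ N, Measurable (Z N) := fun N => by
    have := (hSm 0 N).const_mul (N : ℝ)⁻¹
    simpa [hZ] using this
  have hZb : ∀ N x, N ≠ 0 → |Z N x| ≤ b := fun N x hN => by
    have hN' : (0 : ℝ) < N := by exact_mod_cast Nat.pos_of_ne_zero hN
    have := hSb 0 N x
    simp only [zero_add] at this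
    rw [hZ, abs_mul, abs_inv, abs_of_pos hN', inv_mul_le_iff₀ hN']
    exact this
  have hD : 0 ≤ D := by
    have := (abs_nonneg _).trans (h 0 1)
    simpa using this
  have hlin : ∀ (c₁ c₂ c₃ : ℝ) (f₁ f₂ f₃ : K → ℝ), Integrable f₁ m → Integrable f₂ m →
      Integrable f₃ m → ∫ x, (c₁ * f₁ x + c₂ * f₂ x + c₃ * f₃ x) ∂m =
        c₁ * ∫ x, f₁ x ∂m + c₂ * ∫ x, f₂ x ∂m + c₃ * ∫ x, f₃ x ∂m := by
    intro c₁ c₂ c₃ f₁ f₂ f₃ h₁ h₂ h₃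
    have h₁₂ : Integrable (fun x => c₁ * f₁ x + c₂ * f₂ x) m := (h₁.const_mul _).add (h₂.const_mul _)
    rw [integral_add h₁₂ (h₃.const_mul _), integral_add (h₁.const_mul _) (h₂.const_mul _),
      integral_const_mul, integral_const_mul, integral_const_mul]
  -- The averages form a Cauchy sequence in mean square.
  have hcauchy : ∀ N M : ℕ, 0 < N → N ≤ M → ∫ x, (Z N x - Z M x) ^ 2 ∂m ≤ 4 * D / N := by
    intro N M hN hNM
    obtain ⟨L, rfl⟩ := Nat.exists_eq_add_of_le hNM
    have hN' : (0 : ℝ) < N := by exact_mod_cast hN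
    have hL' : (0 : ℝ) ≤ L := Nat.cast_nonneg _
    have hM' : (0 : ℝ) < ((N + L : ℕ) : ℝ) := by exact_mod_cast Nat.lt_of_lt_of_le hN hNM
    set a := ∫ x, (∑ n ∈ Finset.range N, X (0 + n) x) ^ 2 ∂m with ha
    set a' := ∫ x, (∑ n ∈ Finset.range (N + L), X (0 + n) x) ^ 2 ∂m with ha'
    set r := ∫ x, (∑ n ∈ Finset.range L, X (N + n) x) ^ 2 ∂m with hr
    have e1 : ∀ x, (Z N x - Z (N + L) x) ^ 2 =
        ((N : ℝ)⁻¹ ^ 2 - (N : ℝ)⁻¹ * ((N + L : ℕ) : ℝ)⁻¹) *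
          (∑ n ∈ Finset.range N, X (0 + n) x) ^ 2 +
        (((N + L : ℕ) : ℝ)⁻¹ ^ 2 - (N : ℝ)⁻¹ * ((N + L : ℕ) : ℝ)⁻¹) *
          (∑ n ∈ Finset.range (N + L), X (0 + n) x) ^ 2 +
        (N : ℝ)⁻¹ * ((N + L : ℕ) : ℝ)⁻¹ * (∑ n ∈ Finset.range L, X (N + n) x) ^ 2 := fun x => by
      simp only [hZ, zero_add, Finset.sum_range_add]
      ring
    have e2 : ∫ x, (Z N x - Z (N + L) x) ^ 2 ∂m =
        ((N : ℝ)⁻¹ ^ 2 - (N : ℝ)⁻¹ * ((N + L : ℕ) : ℝ)⁻¹) * a +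
        (((N + L : ℕ) : ℝ)⁻¹ ^ 2 - (N : ℝ)⁻¹ * ((N + L : ℕ) : ℝ)⁻¹) * a' +
        (N : ℝ)⁻¹ * ((N + L : ℕ) : ℝ)⁻¹ * r := by
      simp only [e1]
      exact hlin _ _ _ _ _ _ (hS2 0 N) (hS2 0 (N + L)) (hS2 N L)
    have h1 := (abs_le.1 (h 0 N)).2
    have h2 := (abs_le.1 (h 0 (N + L))).1
    have h3 := (abs_le.1 (h N L)).2
    have h2' := (abs_le.1 (h 0 (N + L))).2
    rw [← ha] at h1
    rw [← ha'] at h2 h2'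
    rw [← hr] at h3
    rw [e2]
    push_cast at h2 h2' hM' ⊢
    have e3 : ((N : ℝ)⁻¹ ^ 2 - (N : ℝ)⁻¹ * ((N : ℝ) + L)⁻¹) * a +
        (((N : ℝ) + L)⁻¹ ^ 2 - (N : ℝ)⁻¹ * ((N : ℝ) + L)⁻¹) * a' +
        (N : ℝ)⁻¹ * ((N : ℝ) + L)⁻¹ * r =
        (L * (N + L) * (a - N ^ 2 * β) - L * N * (a' - (N + L) ^ 2 * β) +
          N * (N + L) * (r - L ^ 2 * β)) / (N ^ 2 * (N + L) ^ 2) := by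
      field_simp
      ring
    have hM : (0 : ℝ) < (N : ℝ) + L := hM'
    rw [e3, div_le_div_iff₀ (by positivity) hN']
    have k1 : L * (N + L) * (a - N ^ 2 * β) ≤ L * (N + L) * (D * N) :=
      mul_le_mul_of_nonneg_left h1 (by positivity)
    have k2 : -(L * N * (a' - (N + L) ^ 2 * β)) ≤ L * N * (D * (N + L)) := by
      rw [← mul_neg]
      exact mul_le_mul_of_nonneg_left (by linarith) (by positivity)
    have k3 : N * (N + L) * (r - L ^ 2 * β) ≤ N * (N + L) * (D * L) :=
      mul_le_mul_of_nonneg_left h3 (by positivity)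
    have k4 : L * (N + L) * (a - N ^ 2 * β) - L * N * (a' - (N + L) ^ 2 * β) +
        N * (N + L) * (r - L ^ 2 * β) ≤ 3 * D * N * L * (N + L) := by linarith
    calc _ ≤ 3 * D * N * L * (N + L) * N := mul_le_mul_of_nonneg_right k4 hN'.le
      _ = D * N ^ 2 * (N + L) * (3 * L) := by ring
      _ ≤ D * N ^ 2 * (N + L) * (4 * (N + L)) := by
          refine mul_le_mul_of_nonneg_left ?_ (by positivity)
          linarith
      _ = _ := by ring
  have hZi : ∀ N M : ℕ, N ≠ 0 → M ≠ 0 → Integrable (fun x => Z N x - Z M x) m := fun N M hN hM =>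
    (Integrable.of_bound (hZm N).aestronglyMeasurable b (Eventually.of_forall (hZb N · hN))).sub
      (Integrable.of_bound (hZm M).aestronglyMeasurable b (Eventually.of_forall (hZb M · hM)))
  have hL1 : ∀ k : ℕ, ∫ x, |Z ((k + 1) ^ 4) x - Z ((k + 2) ^ 4) x| ∂m ≤
      (m.real univ + 4 * D) / ((k : ℝ) + 1) ^ 2 := by
    intro k
    have hk : (0 : ℝ) < (k : ℝ) + 1 := by positivity
    have h1 := hcauchy ((k + 1) ^ 4) ((k + 2) ^ 4) (by positivity)
      (Nat.pow_le_pow_left (Nat.le_succ _) 4)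
    have hi := hZi ((k + 1) ^ 4) ((k + 2) ^ 4) (by positivity) (by positivity)
    have hi2 : Integrable (fun x => (Z ((k + 1) ^ 4) x - Z ((k + 2) ^ 4) x) ^ 2) m := by
      refine Integrable.of_bound (hi.aestronglyMeasurable.pow 2) ((b + b) ^ 2)
        (Eventually.of_forall fun x => ?_)
      rw [Real.norm_eq_abs, abs_pow]
      refine pow_le_pow_left₀ (abs_nonneg _) ((abs_sub _ _).trans (add_le_add ?_ ?_)) 2
      · exact hZb _ _ (by positivity)
      · exact hZb _ _ (by positivity)
    calc _ ≤ ∫ x, ((((k : ℝ) + 1) ^ 2)⁻¹ + ((k : ℝ) + 1) ^ 2 *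
          (Z ((k + 1) ^ 4) x - Z ((k + 2) ^ 4) x) ^ 2) ∂m := by
          refine integral_mono hi.abs ((integrable_const _).add (hi2.const_mul _)) fun x => ?_
          simp only
          set t := Z ((k + 1) ^ 4) x - Z ((k + 2) ^ 4) x
          have h2 := sq_nonneg (((k : ℝ) + 1)⁻¹ - ((k : ℝ) + 1) * |t|)
          have h3 : ((k : ℝ) + 1)⁻¹ * ((k : ℝ) + 1) = 1 := inv_mul_cancel₀ hk.ne'
          have h4 : (((k : ℝ) + 1)⁻¹ - ((k : ℝ) + 1) * |t|) ^ 2 =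
              (((k : ℝ) + 1) ^ 2)⁻¹ + ((k : ℝ) + 1) ^ 2 * t ^ 2 - 2 * |t| := by
            rw [← sq_abs t]
            field_simp
            ring
          have h5 := abs_nonneg t
          linarith
      _ = (((k : ℝ) + 1) ^ 2)⁻¹ * m.real univ + ((k : ℝ) + 1) ^ 2 *
          ∫ x, (Z ((k + 1) ^ 4) x - Z ((k + 2) ^ 4) x) ^ 2 ∂m := by
          rw [integral_add (integrable_const _) (hi2.const_mul _), integral_const_mul,
            integral_const, smul_eq_mul, mul_comm]
      _ ≤ (((k : ℝ) + 1) ^ 2)⁻¹ * m.real univ + ((k : ℝ) + 1) ^ 2 *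
          (4 * D / ((k : ℝ) + 1) ^ 4) := by
          gcongr
          exact_mod_cast h1
      _ = _ := by field_simp
  have hconv4 : ∀ᵐ x ∂m, ∃ y, Tendsto (fun k : ℕ => Z ((k + 1) ^ 4) x) atTop (𝓝 y) := by
    set d : ℕ → K → ℝ≥0∞ := fun k x => ENNReal.ofReal |Z ((k + 1) ^ 4) x - Z ((k + 2) ^ 4) x|
    have hdm : ∀ k, Measurable (d k) := fun k => ((hZm _).sub (hZm _)).abs.ennreal_ofReal
    have hsummable : Summable fun k : ℕ => (m.real univ + 4 * D) / ((k : ℝ) + 1) ^ 2 := by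
      have := (summable_nat_add_iff 1).2 (Real.summable_one_div_nat_pow.2 one_lt_two)
      simpa [div_eq_mul_inv] using this.mul_left (m.real univ + 4 * D)
    have hfin : ∫⁻ x, ∑' k, d k x ∂m ≠ ⊤ := by
      rw [lintegral_tsum fun k => (hdm k).aemeasurable]
      refine ne_top_of_le_ne_top hsummable.tsum_ofReal_ne_top (ENNReal.tsum_le_tsum fun k => ?_)
      have hi := hZi ((k + 1) ^ 4) ((k + 2) ^ 4) (by positivity) (by positivity)
      rw [← ofReal_integral_eq_lintegral_ofReal hi.abs (Eventually.of_forall fun x => abs_nonneg _)]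
      exact ENNReal.ofReal_le_ofReal (hL1 k)
    filter_upwards [ae_lt_top (Measurable.tsum hdm) hfin] with x hx
    refine cauchySeq_tendsto_of_complete
      (cauchySeq_of_edist_le_of_tsum_ne_top (fun k => d k x) (fun k => ?_) hx.ne)
    rw [edist_dist, Real.dist_eq]
  have hconv : ∀ᵐ x ∂m, ∃ y, Tendsto (fun N => Z N x) atTop (𝓝 y) := by
    filter_upwards [hconv4] with x ⟨y, hy⟩
    exact ⟨y, tendsto_average_of_pow (fun n => hb n x) hy⟩
  obtain ⟨Y, hYm, hY⟩ := measurable_limit_of_tendsto_metrizable_ae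
    (fun N => (hZm N).aemeasurable) hconv
  refine ⟨Y, hYm, hY, ?_, ?_⟩
  · filter_upwards [hY] with x hx
    refine le_of_tendsto hx.abs ?_
    filter_upwards [eventually_ne_atTop 0] with N hN
    exact hZb N x hN
  · have hlim : Tendsto (fun N => ∫ x, Z N x ^ 2 ∂m) atTop (𝓝 (∫ x, Y x ^ 2 ∂m)) := by
      refine tendsto_integral_filter_of_dominated_convergence (fun _ => b ^ 2)
        (Eventually.of_forall fun N => ((hZm N).pow_const 2).aestronglyMeasurable) ?_
        (integrable_const _) (hY.mono fun x hx => hx.pow 2)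
      filter_upwards [eventually_ne_atTop 0] with N hN
      refine Eventually.of_forall fun x => ?_
      rw [Real.norm_eq_abs, abs_pow]
      exact pow_le_pow_left₀ (abs_nonneg _) (hZb N x hN) 2
    refine tendsto_nhds_unique hlim ?_
    rw [tendsto_iff_norm_sub_tendsto_zero]
    refine squeeze_zero' (Eventually.of_forall fun _ => norm_nonneg _) (g := fun N : ℕ => D * (N : ℝ)⁻¹)
      ?_ (by simpa using tendsto_inv_atTop_nhds_zero_nat.const_mul D)
    filter_upwards [eventually_ne_atTop 0] with N hN
    have hN' : (0 : ℝ) < N := by exact_mod_cast Nat.pos_of_ne_zero hN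
    have h1 := h 0 N
    simp only [zero_add] at h1
    have e1 : ∫ x, Z N x ^ 2 ∂m - β = ((N : ℝ)⁻¹) ^ 2 *
        (∫ x, (∑ n ∈ Finset.range N, X n x) ^ 2 ∂m - (N : ℝ) ^ 2 * β) := by
      simp only [hZ, mul_pow]
      rw [integral_const_mul]
      field_simp
    rw [e1, Real.norm_eq_abs, abs_mul, abs_of_nonneg (by positivity)]
    calc _ ≤ ((N : ℝ)⁻¹) ^ 2 * (D * N) := mul_le_mul_of_nonneg_left h1 (by positivity)
      _ = _ := by field_simp

end Averages

/-! ### The projection on the invariant elements -/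

namespace TestPairing

variable {K S H : Type*} [TopologicalSpace K] [CompactSpace K] [T2Space K]
  [SecondCountableTopology K] [MeasurableSpace K] [BorelSpace K] [AddCommGroup S]
  [Module ℝ S] [NormedAddCommGroup H] [NormedSpace ℂ H]
  {Θ : TestPairing K S H} {ν : Measure K} {T : K → K} {A : H →L[ℂ] H}

/-- An operator `Q` to which the averages of the powers of `A` converge, together with a basis of
its range made of invariant ergodic probability measures. -/
structure IsErgodicBasis (Θ : TestPairing K S H) (ν : Measure K) (T : K → K) (A Q : H →L[ℂ] H)
    (D C : ℝ) {ι : Type*} [Fintype ι] [DecidableEq ι] (m : ι → Measure K) (w : ι → H) : Prop where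
  norm_sum_le : ∀ L : ℕ, ‖∑ n ∈ Finset.range L, A ^ n - (L : ℂ) • Q‖ ≤ D
  norm_pow_le : ∀ n : ℕ, ‖A ^ n‖ ≤ C
  mul_right : Q * A = Q
  prob : ∀ i, IsProbabilityMeasure (m i)
  represents : ∀ i, Θ.Represents ν (w i) (m i)
  ergodic : ∀ i, Ergodic T (m i)
  span : ∀ x, ∃ s : ι → ℂ, Q x = ∑ i, s i • w i
  proj_mul : ∀ (f : C(K, ℂ)) M, Θ.IsMul ν f M → ∀ i, Q (M (w i)) = (∫ x, f x ∂m i) • w i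
  approx : ∀ i, ∀ ε > 0, ∃ g, 0 ≤ Θ.r g ∧ ∀ j, |(if j = i then 1 else 0) - ∫ x, Θ.r g x ∂m j| ≤ ε

namespace IsMixingBasis

variable {P : H →L[ℂ] H} {C δ : ℝ} {φ : ℕ → ℕ} {n : ℕ} {m : Fin n → Measure K} {v : Fin n → H}
  {τ : Equiv.Perm (Fin n)} (hB : Θ.IsMixingBasis ν T A P m v τ)

include hB

theorem proj_apply (hP : IsPeripheralProjection A P C δ φ) (i : Fin n) : P (v i) = v i :=
  hP.apply_of_mem_range (hB.mem_range i)

theorem pow_orderOf_mul : A ^ orderOf τ * P = P := by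
  ext x
  change (A ^ orderOf τ) (P x) = P x
  obtain ⟨s, hs⟩ := hB.span (P x) ⟨x, rfl⟩
  rw [hs, map_sum]
  simp only [map_smul, hB.pow_apply, pow_orderOf_eq_one, Equiv.Perm.one_apply]

/-- The operator `Q` is the average of the powers over a period, composed with `P`. The sums of
powers stay at bounded distance from the multiples of `Q`: on the range of `P` the difference is
periodic, and on the kernel of `P` the powers are summable. -/
theorem exists_average (hP : IsPeripheralProjection A P C δ φ) : ∃ (Q : H →L[ℂ] H) (D : ℝ),
    (∀ L : ℕ, ‖∑ k ∈ Finset.range L, A ^ k - (L : ℂ) • Q‖ ≤ D) ∧ Q * A = Q ∧ Q * P = Q ∧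
    ∀ x, Q x = ((orderOf τ : ℂ)⁻¹) • ∑ k ∈ Finset.range (orderOf τ), (A ^ k) (P x) := by
  set k₀ := orderOf τ with hk₀
  have hpos : 0 < k₀ := orderOf_pos τ
  have hne : (k₀ : ℂ) ≠ 0 := by exact_mod_cast hpos.ne'
  have hper : A ^ k₀ * P = P := hB.pow_orderOf_mul
  have hcomm : Commute A P := hP.comm
  set Z := ∑ k ∈ Finset.range k₀, A ^ k * P with hZ
  set Q : H →L[ℂ] H := ((k₀ : ℂ)⁻¹) • Z with hQ
  have hZA : A * Z = Z := by
    have h1 : A * Z = ∑ k ∈ Finset.range k₀, A ^ (k + 1) * P := by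
      rw [hZ, Finset.mul_sum]
      exact Finset.sum_congr rfl fun k _ => by rw [← mul_assoc, ← pow_succ']
    have h2 := Finset.sum_range_succ (fun k => A ^ k * P) k₀
    rw [Finset.sum_range_succ', hper, pow_zero, one_mul, ← h1] at h2
    exact add_right_cancel h2
  have hZP : Z * P = Z := by
    rw [hZ, Finset.sum_mul]
    exact Finset.sum_congr rfl fun k _ => by rw [mul_assoc, hP.idem]
  have hZA' : Z * A = A * Z := by
    rw [hZ, Finset.sum_mul, Finset.mul_sum]
    refine Finset.sum_congr rfl fun k _ => ?_
    rw [mul_assoc, ← hcomm.eq, ← mul_assoc, ← mul_assoc, ← pow_succ, ← pow_succ']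
  have hpowZ : ∀ L : ℕ, A ^ L * Z = Z := fun L => by
    induction L with
    | zero => rw [pow_zero, one_mul]
    | succ L ih => rw [pow_succ, mul_assoc, hZA, ih]
  -- On the range of `P` the difference is periodic.
  set R : ℕ → H →L[ℂ] H := fun L => ∑ k ∈ Finset.range L, A ^ k * P - (L : ℂ) • Q with hR
  have hRper : Function.Periodic R k₀ := fun L => by
    have h1 : ∑ k ∈ Finset.range k₀, A ^ (L + k) * P = Z := by
      rw [← hpowZ L, hZ, Finset.mul_sum]
      exact Finset.sum_congr rfl fun k _ => by rw [pow_add, mul_assoc]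
    have h2 : (k₀ : ℂ) • Q = Z := by rw [hQ, smul_smul, mul_inv_cancel₀ hne, one_smul]
    simp only [hR]
    rw [Finset.sum_range_add, h1, Nat.cast_add, add_smul, h2]
    abel
  refine ⟨Q, ∑ k ∈ Finset.range k₀, ‖R k‖ + C * (1 - δ)⁻¹, fun L => ?_, ?_, ?_, fun x => ?_⟩
  · have h1 : ∑ k ∈ Finset.range L, A ^ k - (L : ℂ) • Q =
        R L + ∑ k ∈ Finset.range L, A ^ k * (1 - P) := by
      simp only [hR, mul_sub, mul_one, Finset.sum_sub_distrib]
      abel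
    rw [h1]
    refine (norm_add_le _ _).trans (add_le_add ?_ ?_)
    · rw [← hRper.map_mod_nat]
      exact Finset.single_le_sum (f := fun k => ‖R k‖) (fun k _ => norm_nonneg _)
        (Finset.mem_range.2 (Nat.mod_lt _ hpos))
    · refine (norm_sum_le_of_le _ fun k _ => hP.contraction k).trans ?_
      rw [← Finset.mul_sum]
      refine mul_le_mul_of_nonneg_left ?_ hP.C_pos.le
      rw [← tsum_geometric_of_lt_one hP.δ_pos.le hP.δ_lt_one]
      exact (summable_geometric_of_lt_one hP.δ_pos.le hP.δ_lt_one).sum_le_tsum _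
        fun k _ => pow_nonneg hP.δ_pos.le _
  · rw [hQ, smul_mul_assoc, hZA', hZA]
  · rw [hQ, smul_mul_assoc, hZP]
  · simp [hQ, hZ]

/-- The averages of the basis measures along the cycles of the permutation are ergodic. Here `a q`
is a representative of the cycle `q`, and the average is taken over the order of `τ`, a common
multiple of the lengths of all cycles. -/
theorem exists_isErgodicBasis (hS : Θ.IsTransferSystem ν T A)
    (hP : IsPeripheralProjection A P C δ φ) :
    ∃ (Q : H →L[ℂ] H) (D : ℝ) (l : ℕ) (a : Fin l → Fin n) (w : Fin l → H),
      Θ.IsErgodicBasis ν T A Q D C (fun q => ENNReal.ofReal (orderOf τ : ℝ)⁻¹ •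
        ∑ k ∈ Finset.range (orderOf τ), m ((τ ^ k) (a q))) w := by
  classical
  have hν := hS.finite
  have hprob := hB.prob
  obtain ⟨Q, D, hD, hQA, hQP, hQx⟩ := hB.exists_average hP
  set k₀ := orderOf τ with hk₀
  have hpos : 0 < k₀ := orderOf_pos τ
  have hpos' : (0 : ℝ) < k₀ := by exact_mod_cast hpos
  have hne : (k₀ : ℂ) ≠ 0 := by exact_mod_cast hpos.ne'
  let _ : Setoid (Fin n) := Equiv.Perm.SameCycle.setoid τ
  let ι := Quotient (Equiv.Perm.SameCycle.setoid τ)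
  let eι := Fintype.equivFin ι
  let a : Fin (Fintype.card ι) → Fin n := fun q => (eι.symm q).out
  let cls : Fin n → Fin (Fintype.card ι) := fun i => eι (Quotient.mk _ i)
  have hcls_a : ∀ q, cls (a q) = q := fun q => by simp [cls, a]
  have hcls : ∀ i (k : ℕ), cls ((τ ^ k) i) = cls i := fun i k => by
    refine congrArg eι (Quotient.sound ?_)
    exact (show τ.SameCycle i ((τ ^ k) i) from ⟨k, by simp⟩).symm
  have hsame : ∀ i, ∃ k : ℕ, (τ ^ k) (a (cls i)) = i := fun i => by
    have h1 : τ.SameCycle (a (cls i)) i := by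
      have : Quotient.mk (Equiv.Perm.SameCycle.setoid τ) (a (cls i)) = Quotient.mk _ i := by
        simp [a, cls]
      exact Quotient.exact this
    obtain ⟨k, -, hk⟩ := h1.exists_pow_eq'
    exact ⟨k, hk⟩
  set w : Fin (Fintype.card ι) → H := fun q => Q (v (a q)) with hw
  have hQpow : ∀ k x, Q ((A ^ k) x) = Q x := fun k x => by
    induction k with
    | zero => rfl
    | succ k ih =>
      rw [pow_succ']
      change (Q * A) ((A ^ k) x) = _
      rw [hQA, ih]
  have hQv : ∀ i, Q (v i) = w (cls i) := fun i => by
    obtain ⟨k, hk⟩ := hsame i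
    rw [hw]
    simp only
    conv_lhs => rw [← hk, ← hB.pow_apply, hQpow]
  have hwsum : ∀ q, w q = ((k₀ : ℂ)⁻¹) • ∑ k ∈ Finset.range k₀, v ((τ ^ k) (a q)) := fun q => by
    simp only [hw, hQx, hB.proj_apply hP, hB.pow_apply]
  have hrep : ∀ q, Θ.Represents ν (w q) (ENNReal.ofReal (k₀ : ℝ)⁻¹ •
      ∑ k ∈ Finset.range k₀, m ((τ ^ k) (a q))) := fun q => by
    have h1 := represents_sum (Θ := Θ) (Finset.range k₀) fun k _ => hB.represents ((τ ^ k) (a q))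
    have h2 := h1.smul (inv_nonneg.2 hpos'.le)
    rw [Complex.ofReal_inv, Complex.ofReal_natCast, ← hwsum] at h2
    exact h2
  have hint : ∀ q {E : Type} [NormedAddCommGroup E] [NormedSpace ℝ E] [SecondCountableTopology E]
      [MeasurableSpace E] [BorelSpace E] (f : C(K, E)), ∫ x, f x ∂(ENNReal.ofReal (k₀ : ℝ)⁻¹ •
      ∑ k ∈ Finset.range k₀, m ((τ ^ k) (a q))) = (k₀ : ℝ)⁻¹ •
        ∑ k ∈ Finset.range k₀, ∫ x, f x ∂m ((τ ^ k) (a q)) := fun q E _ _ _ _ _ f => by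
    rw [integral_smul_measure, ENNReal.toReal_ofReal (inv_nonneg.2 hpos'.le),
      integral_finsetSum_measure fun k _ => integrable_continuousMap _ f]
  have hprobq : ∀ q, IsProbabilityMeasure (ENNReal.ofReal (k₀ : ℝ)⁻¹ •
      ∑ k ∈ Finset.range k₀, m ((τ ^ k) (a q))) := fun q => by
    refine ⟨?_⟩
    simp only [Measure.smul_apply, Measure.coe_finsetSum, Finset.sum_apply, measure_univ,
      Finset.sum_const, Finset.card_range, nsmul_eq_mul, mul_one, smul_eq_mul]
    rw [ENNReal.ofReal_inv_of_pos hpos', ENNReal.ofReal_natCast]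
    exact ENNReal.inv_mul_cancel (by exact_mod_cast hpos.ne') (ENNReal.natCast_ne_top _)
  have hfixed : ∀ q, A (w q) = w q := fun q => by
    have h1 : A * Q = Q := by
      have h2 : ∀ x, A (Q x) = Q (A x) := fun x => by
        simp only [hQx, map_smul, map_sum]
        congr 1
        refine Finset.sum_congr rfl fun k _ => ?_
        have := hP.pow_apply_comm 1 x
        simp only [pow_one] at this
        rw [← this]
        change (A * A ^ k) (P x) = (A ^ k * A) (P x)
        rw [← pow_succ, ← pow_succ']
      ext x
      change A (Q x) = Q x
      rw [h2]
      exact DFunLike.congr_fun hQA x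
    exact DFunLike.congr_fun h1 _
  refine ⟨Q, D, Fintype.card ι, a, w, hD, hP.norm_pow_le, hQA, hprobq, hrep, fun q => ?_, fun x => ?_,
    fun f M hM q => ?_, fun q ε hε => ?_⟩
  · refine ⟨⟨hS.qmp.measurable, ?_⟩, ⟨fun D hD hTD => ?_⟩⟩
    · have := hS.represents_map (hrep q)
      rw [hfixed] at this
      exact this.unique (hrep q)
    · have hmeas : ∀ k, (m ((τ ^ k) (a q))) D = m (a q) D := fun k => by
        induction k with
        | zero => rfl
        | succ k ih =>
          rw [pow_succ', Equiv.Perm.mul_apply, ← hB.measure_map hS,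
            Measure.map_apply hS.qmp.measurable hD, hTD, ih]
      have hmeas' : ∀ k, (m ((τ ^ k) (a q))) Dᶜ = m (a q) Dᶜ := fun k => by
        rw [prob_compl_eq_one_sub hD, prob_compl_eq_one_sub hD, hmeas]
      rw [eventuallyConst_set']
      rcases hB.atom (a q) D hD hTD with h | h
      · left
        refine ae_eq_empty.2 ?_
        simp [hmeas, h]
      · right
        refine ae_eq_univ.2 ?_
        simp [hmeas', h]
  · obtain ⟨s, hs⟩ := hB.span (P x) ⟨x, rfl⟩
    refine ⟨fun q => ∑ i, if cls i = q then s i else 0, ?_⟩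
    have h1 : Q x = Q (P x) := (DFunLike.congr_fun hQP x).symm
    rw [h1, hs, map_sum]
    simp only [map_smul, hQv, Finset.sum_smul]
    rw [Finset.sum_comm]
    exact Finset.sum_congr rfl fun i _ => by simp [ite_smul]
  · have h1 : Q (M (w q)) = Q (P (M (w q))) := (DFunLike.congr_fun hQP _).symm
    rw [h1, hwsum, map_smul, map_smul, map_smul, map_sum, map_sum, map_sum, hint]
    simp only [hB.proj_mul f M hM, map_smul, hQv, hcls, hcls_a]
    rw [← Finset.sum_smul, smul_smul, ← hwsum]
    congr 1
    rw [Complex.real_smul, Complex.ofReal_inv, Complex.ofReal_natCast]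
  · have hn : 0 < n := (Nat.zero_le _).trans_lt (a q).2
    have hn' : (0 : ℝ) < n := by exact_mod_cast hn
    choose g hg0 hg using fun i => hB.approx i (ε / n) (by positivity)
    refine ⟨∑ i, if cls i = q then g i else 0, ?_, fun q' => ?_⟩
    · rw [map_sum]
      refine Finset.sum_nonneg fun i _ => ?_
      split_ifs
      · exact hg0 i
      · rw [map_zero]
    · have hj : ∀ j, |(if cls j = q then 1 else 0) -
          ∫ x, Θ.r (∑ i, if cls i = q then g i else 0) x ∂m j| ≤ ε := fun j => by
        have e1 : ∫ x, Θ.r (∑ i, if cls i = q then g i else 0) x ∂m j =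
            ∑ i, if cls i = q then ∫ x, Θ.r (g i) x ∂m j else 0 := by
          have : ∀ x, Θ.r (∑ i, if cls i = q then g i else 0) x =
              ∑ i, (if cls i = q then Θ.r (g i) x else 0) := fun x => by
            rw [map_sum, ContinuousMap.sum_apply]
            refine Finset.sum_congr rfl fun i _ => ?_
            split_ifs
            · rfl
            · simp
          simp only [this]
          rw [integral_finsetSum]
          · refine Finset.sum_congr rfl fun i _ => ?_
            split_ifs
            · rfl
            · simp
          · intro i _
            split_ifs
            · exact integrable_continuousMap _ _
            · exact integrable_zero _ _ _
        have e2 : (if cls j = q then (1 : ℝ) else 0) =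
            ∑ i, if cls i = q then (if j = i then 1 else 0) else 0 := by
          rw [Finset.sum_eq_single j (fun i _ hi => by simp [Ne.symm hi]) (by simp)]
          simp
        rw [e1, e2, ← Finset.sum_sub_distrib]
        refine (Finset.abs_sum_le_sum_abs _ _).trans ?_
        have h2 : ∀ i ∈ Finset.univ, |(if cls i = q then (if j = i then (1 : ℝ) else 0) else 0) -
            (if cls i = q then ∫ x, Θ.r (g i) x ∂m j else 0)| ≤ ε / n := fun i _ => by
          split_ifs with _ h2
          · simpa [h2] using hg i j
          · simpa [h2] using hg i j
          · simpa using (by positivity : 0 ≤ ε / n)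
        refine (Finset.sum_le_sum h2).trans ?_
        simp only [Finset.sum_const, Finset.card_univ, Fintype.card_fin, nsmul_eq_mul]
        rw [mul_div_cancel₀ _ hn'.ne']
      rw [hint]
      have e3 : (if q' = q then (1 : ℝ) else 0) = (k₀ : ℝ)⁻¹ • ∑ k ∈ Finset.range k₀,
          (if cls ((τ ^ k) (a q')) = q then (1 : ℝ) else 0) := by
        simp only [hcls, hcls_a, Finset.sum_const, Finset.card_range, nsmul_eq_mul, smul_eq_mul]
        rw [← mul_assoc, inv_mul_cancel₀ hpos'.ne', one_mul]
      rw [e3, ← smul_sub, ← Finset.sum_sub_distrib, smul_eq_mul, abs_mul,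
        abs_of_nonneg (inv_nonneg.2 hpos'.le), inv_mul_le_iff₀ hpos']
      refine (Finset.abs_sum_le_sum_abs _ _).trans ((Finset.sum_le_sum fun k _ => hj _).trans ?_)
      simp

end IsMixingBasis

end TestPairing

/-! ### Convergence of the ergodic averages of test functions -/

namespace TestPairing

variable {K S H : Type*} [TopologicalSpace K] [CompactSpace K] [T2Space K]
  [SecondCountableTopology K] [MeasurableSpace K] [BorelSpace K] [AddCommGroup S]
  [Module ℝ S] [NormedAddCommGroup H] [NormedSpace ℂ H]
  {Θ : TestPairing K S H} {ν : Measure K} {T : K → K} {A : H →L[ℂ] H}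

namespace IsErgodicBasis

variable {Q : H →L[ℂ] H} {D C : ℝ} {ι : Type*} [Fintype ι] [DecidableEq ι] {m : ι → Measure K}
  {w : ι → H} (hE : Θ.IsErgodicBasis ν T A Q D C m w)

include hE

theorem proj_apply (i : ι) : Q (w i) = w i := by
  have := hE.prob
  simpa using hE.proj_mul 1 1 IsMul.one i

theorem proj_pow (N : ℕ) (u : H) : Q ((A ^ N) u) = Q u := by
  induction N with
  | zero => rfl
  | succ N ih =>
    rw [pow_succ']
    change (Q * A) ((A ^ N) u) = _
    rw [hE.mul_right, ih]

/-- The second moment of a sum of `L` consecutive terms, expressed by means of double sums of powers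
of `A`, up to `O(L)`. The induction on `L` adds the first term: the square of the new sum is the
square of the old one, composed with `T`, plus twice the correlations of the first term with all the
others, whose sum is `L ⟨Q (g u), g⟩` up to a bounded error. -/
theorem norm_integral_sum_sq_sub_le (hS : Θ.IsTransferSystem ν T A) {g : S} {M : H →L[ℂ] H}
    (hM : Θ.IsMul ν (fun x => (Θ.r g x : ℂ)) M) (L : ℕ) {u : H} {μ : Measure K}
    (h : Θ.Represents ν u μ) :
    ‖((∫ x, (∑ n ∈ Finset.range L, Θ.r g (T^[n] x)) ^ 2 ∂μ : ℝ) : ℂ) - 2 * Θ.ev g (Q (M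
      (∑ k ∈ Finset.range L, ∑ n ∈ Finset.range k, (A ^ n) u)))‖ ≤
    ‖Θ.ev g‖ * ‖M‖ * (2 * D + 2 * ‖Q‖ + 1) * ∑ n ∈ Finset.range L, ‖(A ^ n) u‖ := by
  induction L generalizing u μ with
  | zero => simp
  | succ L ih =>
    have hμ := h.finite
    have hT := hS.qmp.measurable
    have hX : ∀ n, Measurable fun x => Θ.r g (T^[n] x) := fun n =>
      (Θ.r g).continuous.measurable.comp (hT.iterate n)
    have hXb : ∀ n x, |Θ.r g (T^[n] x)| ≤ ‖Θ.r g‖ := fun n x => (Θ.r g).norm_coe_le_norm _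
    have hSm : ∀ L, Measurable fun x => ∑ n ∈ Finset.range L, Θ.r g (T^[n] x) := fun L =>
      Finset.measurable_sum _ fun n _ => hX n
    have hSb : ∀ L x, |∑ n ∈ Finset.range L, Θ.r g (T^[n] x)| ≤ L * ‖Θ.r g‖ := fun L x => by
      refine (Finset.abs_sum_le_sum_abs _ _).trans
        ((Finset.sum_le_sum fun n _ => hXb n x).trans ?_)
      simp
    have hmul : ∀ n, Integrable (fun x => Θ.r g x * Θ.r g (T^[n] x)) μ := fun n =>
      (integrable_continuousMap μ (Θ.r g)).mul_bdd (hX n).aestronglyMeasurable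
        (Eventually.of_forall (hXb n))
    let gc : C(K, ℂ) := ⟨fun x => (Θ.r g x : ℂ), by fun_prop⟩
    have hev : ∀ n, Θ.ev g ((A ^ n) (M u)) = ((∫ x, Θ.r g x * Θ.r g (T^[n] x) ∂μ : ℝ) : ℂ) :=
      fun n => by
        rw [hS.ev_pow_mul h (f := gc) hM, ← integral_complex_ofReal]
        simp [gc]
    have e1 : ∀ x, (∑ n ∈ Finset.range (L + 1), Θ.r g (T^[n] x)) ^ 2 =
        (∑ n ∈ Finset.range L, Θ.r g (T^[n] (T x))) ^ 2 +
          (2 * ∑ n ∈ Finset.range (L + 1), Θ.r g x * Θ.r g (T^[n] x) -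
            Θ.r g x * Θ.r g (T^[0] x)) := fun x => by
      rw [← Finset.mul_sum]
      simp only [Finset.sum_range_succ', Function.iterate_succ_apply, Function.iterate_zero_apply]
      ring
    have hi1 : Integrable (fun x => (∑ n ∈ Finset.range L, Θ.r g (T^[n] (T x))) ^ 2) μ :=
      Integrable.of_bound (((hSm L).comp hT).pow_const 2).aestronglyMeasurable ((L * ‖Θ.r g‖) ^ 2)
        (Eventually.of_forall fun x => by
          rw [Real.norm_eq_abs, abs_pow]
          exact pow_le_pow_left₀ (abs_nonneg _) (hSb L _) 2)
    have hi2 : Integrable (fun x => 2 * ∑ n ∈ Finset.range (L + 1),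
        Θ.r g x * Θ.r g (T^[n] x)) μ := (integrable_finsetSum _ fun n _ => hmul n).const_mul 2
    have e2 : ((∫ x, (∑ n ∈ Finset.range (L + 1), Θ.r g (T^[n] x)) ^ 2 ∂μ : ℝ) : ℂ) =
        ((∫ x, (∑ n ∈ Finset.range L, Θ.r g (T^[n] x)) ^ 2 ∂(μ.map T) : ℝ) : ℂ) +
          (2 * ∑ n ∈ Finset.range (L + 1), Θ.ev g ((A ^ n) (M u)) - Θ.ev g (M u)) := by
      have h0 := hev 0
      rw [pow_zero, one_apply_eq_self] at h0
      have hi3 : Integrable (fun x => 2 * ∑ n ∈ Finset.range (L + 1),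
          Θ.r g x * Θ.r g (T^[n] x) - Θ.r g x * Θ.r g (T^[0] x)) μ := hi2.sub (hmul 0)
      simp only [e1]
      rw [integral_add hi1 hi3, integral_sub hi2 (hmul 0), integral_const_mul,
        integral_finsetSum _ fun n _ => hmul n,
        integral_map hT.aemeasurable ((hSm L).pow_const 2).aestronglyMeasurable, h0]
      simp only [hev]
      push_cast
      ring
    have e3 : ∑ k ∈ Finset.range (L + 1), ∑ n ∈ Finset.range k, (A ^ n) u =
        ∑ k ∈ Finset.range L, ∑ n ∈ Finset.range k, (A ^ n) (A u) + (L : ℂ) • u := by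
      have h1 : ∀ k, ∑ n ∈ Finset.range (k + 1), (A ^ n) u =
          ∑ n ∈ Finset.range k, (A ^ n) (A u) + u := fun k => by
        rw [Finset.sum_range_succ']
        simp only [pow_succ, pow_zero]
        rfl
      rw [Finset.sum_range_succ']
      simp only [h1, Finset.range_zero, Finset.sum_empty, add_zero, Finset.sum_add_distrib,
        Finset.sum_const, Finset.card_range]
      rw [Nat.cast_smul_eq_nsmul]
    have e4 : ∑ n ∈ Finset.range (L + 1), ‖(A ^ n) u‖ =
        ∑ n ∈ Finset.range L, ‖(A ^ n) (A u)‖ + ‖u‖ := by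
      rw [Finset.sum_range_succ']
      simp only [pow_succ, pow_zero]
      rfl
    set R := ∑ n ∈ Finset.range (L + 1), A ^ n - ((L + 1 : ℕ) : ℂ) • Q with hR
    have e5 : ∑ n ∈ Finset.range (L + 1), Θ.ev g ((A ^ n) (M u)) =
        Θ.ev g (R (M u)) + (L + 1) * Θ.ev g (Q (M u)) := by
      have : ∑ n ∈ Finset.range (L + 1), (A ^ n) (M u) =
          R (M u) + ((L + 1 : ℕ) : ℂ) • Q (M u) := by
        simp [hR]
      rw [← map_sum, this, map_add, map_smul, smul_eq_mul]
      push_cast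
      rfl
    have hMu : ‖M u‖ ≤ ‖M‖ * ‖u‖ := M.le_opNorm u
    have b1 : ‖Θ.ev g (R (M u))‖ ≤ ‖Θ.ev g‖ * (D * (‖M‖ * ‖u‖)) :=
      ((Θ.ev g).le_opNorm _).trans (mul_le_mul_of_nonneg_left
        ((R.le_opNorm _).trans (mul_le_mul (hE.norm_sum_le _) hMu (norm_nonneg _)
          ((norm_nonneg _).trans (hE.norm_sum_le 0)))) (norm_nonneg _))
    have b2 : ‖Θ.ev g (Q (M u))‖ ≤ ‖Θ.ev g‖ * (‖Q‖ * (‖M‖ * ‖u‖)) :=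
      ((Θ.ev g).le_opNorm _).trans (mul_le_mul_of_nonneg_left
        ((Q.le_opNorm _).trans (mul_le_mul_of_nonneg_left hMu (norm_nonneg _))) (norm_nonneg _))
    have b3 : ‖Θ.ev g (M u)‖ ≤ ‖Θ.ev g‖ * (‖M‖ * ‖u‖) :=
      ((Θ.ev g).le_opNorm _).trans (mul_le_mul_of_nonneg_left hMu (norm_nonneg _))
    have e6 : ((∫ x, (∑ n ∈ Finset.range (L + 1), Θ.r g (T^[n] x)) ^ 2 ∂μ : ℝ) : ℂ) -
        2 * Θ.ev g (Q (M (∑ k ∈ Finset.range (L + 1), ∑ n ∈ Finset.range k, (A ^ n) u))) =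
        (((∫ x, (∑ n ∈ Finset.range L, Θ.r g (T^[n] x)) ^ 2 ∂(μ.map T) : ℝ) : ℂ) -
          2 * Θ.ev g (Q (M (∑ k ∈ Finset.range L, ∑ n ∈ Finset.range k, (A ^ n) (A u))))) +
        (2 * Θ.ev g (R (M u)) + 2 * Θ.ev g (Q (M u)) - Θ.ev g (M u)) := by
      rw [e2, e3, e5, map_add, map_add, map_add, map_smul, map_smul, map_smul, smul_eq_mul]
      ring
    rw [e6, e4, mul_add]
    refine (norm_add_le _ _).trans (add_le_add (ih (hS.represents_map h)) ?_)
    refine (norm_sub_le _ _).trans ((add_le_add_left (norm_add_le _ _) _).trans ?_)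
    rw [norm_mul, norm_mul, Complex.norm_ofNat]
    have e7 : ‖Θ.ev g‖ * ‖M‖ * (2 * D + 2 * ‖Q‖ + 1) * ‖u‖ =
        2 * (‖Θ.ev g‖ * (D * (‖M‖ * ‖u‖))) + 2 * (‖Θ.ev g‖ * (‖Q‖ * (‖M‖ * ‖u‖))) +
          ‖Θ.ev g‖ * (‖M‖ * ‖u‖) := by ring
    rw [e7]
    gcongr

/-- A double sum of powers of `A` is `L ^ 2 Q / 2` up to `O(L)`. -/
theorem norm_double_sum_sub_le (L : ℕ) (u : H) :
    ‖(2 : ℂ) • ∑ k ∈ Finset.range L, ∑ n ∈ Finset.range k, (A ^ n) u - ((L : ℂ) ^ 2) • Q u‖ ≤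
      (2 * D + ‖Q‖) * ‖u‖ * L := by
  induction L with
  | zero => simp
  | succ L ih =>
    have hD := hE.norm_sum_le L
    set R := ∑ n ∈ Finset.range L, A ^ n - (L : ℂ) • Q with hR
    have h1 : ∑ n ∈ Finset.range L, (A ^ n) u = R u + (L : ℂ) • Q u := by simp [hR]
    have h2 : (2 : ℂ) • ∑ k ∈ Finset.range (L + 1), ∑ n ∈ Finset.range k, (A ^ n) u -
        (((L + 1 : ℕ) : ℂ) ^ 2) • Q u =
        ((2 : ℂ) • ∑ k ∈ Finset.range L, ∑ n ∈ Finset.range k, (A ^ n) u - ((L : ℂ) ^ 2) • Q u) +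
          ((2 : ℂ) • R u - Q u) := by
      rw [Finset.sum_range_succ, h1]
      push_cast
      module
    rw [h2]
    have h3 : ‖(2 : ℂ) • R u - Q u‖ ≤ (2 * D + ‖Q‖) * ‖u‖ := by
      refine (norm_sub_le _ _).trans ?_
      rw [norm_smul, Complex.norm_ofNat, add_mul, mul_assoc]
      exact add_le_add (mul_le_mul_of_nonneg_left ((R.le_opNorm u).trans
        (mul_le_mul_of_nonneg_right hD (norm_nonneg _))) zero_le_two) (Q.le_opNorm u)
    refine (norm_add_le _ _).trans ((add_le_add ih h3).trans (le_of_eq ?_))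
    push_cast
    ring

/-- The second moments of the sums of `L` consecutive terms are quadratic in `L` up to `O(L)`,
uniformly in the starting time: starting at `N` amounts to replacing `u` by `A ^ N u`, which has the
same image under `Q`. -/
theorem exists_sum_sq_bound (hS : Θ.IsTransferSystem ν T A) {g : S} {M : H →L[ℂ] H}
    (hM : Θ.IsMul ν (fun x => (Θ.r g x : ℂ)) M) {u : H} {μ : Measure K}
    (h : Θ.Represents ν u μ) : ∃ B : ℝ, ∀ N L : ℕ,
      |∫ x, (∑ n ∈ Finset.range L, Θ.r g (T^[N + n] x)) ^ 2 ∂μ -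
        (L : ℝ) ^ 2 * (Θ.ev g (Q (M (Q u)))).re| ≤ B * L := by
  set b₁ := ‖Θ.ev g‖ * ‖M‖ * (2 * D + 2 * ‖Q‖ + 1) with hb₁
  set b₂ := ‖Θ.ev g‖ * ‖Q‖ * ‖M‖ with hb₂
  have hD0 : 0 ≤ D := (norm_nonneg _).trans (hE.norm_sum_le 0)
  have hb₁0 : 0 ≤ b₁ := by positivity
  have hb₂0 : 0 ≤ b₂ := by positivity
  refine ⟨b₁ * (C * (C * ‖u‖)) + b₂ * ((2 * D + ‖Q‖) * (C * ‖u‖)), fun N L => ?_⟩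
  have hC : 0 ≤ C := (norm_nonneg _).trans (hE.norm_pow_le 0)
  have hpow : ∀ n x, ‖(A ^ n) x‖ ≤ C * ‖x‖ := fun n x =>
    ((A ^ n).le_opNorm x).trans (mul_le_mul_of_nonneg_right (hE.norm_pow_le n) (norm_nonneg _))
  have hT := hS.qmp.measurable
  have h1 := hE.norm_integral_sum_sq_sub_le hS hM L (hS.represents_pow h N)
  have h2 := hE.norm_double_sum_sub_le L ((A ^ N) u)
  rw [hE.proj_pow] at h2
  set V := ∑ k ∈ Finset.range L, ∑ n ∈ Finset.range k, (A ^ n) ((A ^ N) u) with hV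
  have hmeas : Measurable fun x => (∑ n ∈ Finset.range L, Θ.r g (T^[n] x)) ^ 2 :=
    (Finset.measurable_sum _ fun n _ =>
      (Θ.r g).continuous.measurable.comp (hT.iterate n)).pow_const 2
  have e1 : ∫ x, (∑ n ∈ Finset.range L, Θ.r g (T^[n] x)) ^ 2 ∂(μ.map T^[N]) =
      ∫ x, (∑ n ∈ Finset.range L, Θ.r g (T^[N + n] x)) ^ 2 ∂μ := by
    rw [integral_map (hT.iterate N).aemeasurable hmeas.aestronglyMeasurable]
    simp only [← Function.iterate_add_apply, add_comm]
  rw [e1] at h1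
  set I := ∫ x, (∑ n ∈ Finset.range L, Θ.r g (T^[N + n] x)) ^ 2 ∂μ
  have h3 : ‖2 * Θ.ev g (Q (M V)) - (L : ℂ) ^ 2 * Θ.ev g (Q (M (Q u)))‖ ≤
      b₂ * ((2 * D + ‖Q‖) * (C * ‖u‖) * L) := by
    have e2 : 2 * Θ.ev g (Q (M V)) - (L : ℂ) ^ 2 * Θ.ev g (Q (M (Q u))) =
        Θ.ev g (Q (M ((2 : ℂ) • V - ((L : ℂ) ^ 2) • Q u))) := by
      simp only [map_sub, map_smul, smul_eq_mul]
    rw [e2]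
    have h4 : ‖(2 : ℂ) • V - ((L : ℂ) ^ 2) • Q u‖ ≤ (2 * D + ‖Q‖) * (C * ‖u‖) * L := by
      refine h2.trans ?_
      gcongr
      exact hpow N u
    calc _ ≤ ‖Θ.ev g‖ * (‖Q‖ * (‖M‖ * ‖(2 : ℂ) • V - ((L : ℂ) ^ 2) • Q u‖)) := by
          refine ((Θ.ev g).le_opNorm _).trans (mul_le_mul_of_nonneg_left ?_ (norm_nonneg _))
          exact (Q.le_opNorm _).trans (mul_le_mul_of_nonneg_left (M.le_opNorm _) (norm_nonneg _))
      _ = b₂ * ‖(2 : ℂ) • V - ((L : ℂ) ^ 2) • Q u‖ := by rw [hb₂]; ring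
      _ ≤ _ := mul_le_mul_of_nonneg_left h4 hb₂0
  have h5 : ∑ n ∈ Finset.range L, ‖(A ^ n) ((A ^ N) u)‖ ≤ L * (C * (C * ‖u‖)) := by
    refine (Finset.sum_le_sum fun n _ => (hpow n _).trans
      (mul_le_mul_of_nonneg_left (hpow N u) hC)).trans ?_
    simp
  have h6 : ‖(I : ℂ) - (L : ℂ) ^ 2 * Θ.ev g (Q (M (Q u)))‖ ≤
      b₁ * (L * (C * (C * ‖u‖))) + b₂ * ((2 * D + ‖Q‖) * (C * ‖u‖) * L) := by
    rw [← sub_add_sub_cancel (I : ℂ) (2 * Θ.ev g (Q (M V)))]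
    exact (norm_add_le _ _).trans
      (add_le_add (h1.trans (mul_le_mul_of_nonneg_left h5 hb₁0)) h3)
  have e3 : I - (L : ℝ) ^ 2 * (Θ.ev g (Q (M (Q u)))).re =
      ((I : ℂ) - (L : ℂ) ^ 2 * Θ.ev g (Q (M (Q u)))).re := by
    have : (L : ℂ) ^ 2 = (((L : ℝ) ^ 2 : ℝ) : ℂ) := by push_cast; rfl
    rw [Complex.sub_re, Complex.ofReal_re, this, Complex.re_ofReal_mul]
  rw [e3]
  refine (Complex.abs_re_le_norm _).trans (h6.trans (le_of_eq ?_))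
  ring

/-- The averages of a test function converge almost surely with respect to every measure of the
cone, and the second moment of the limit is computed by the coefficients of the projection. -/
theorem exists_average_limit (hS : Θ.IsTransferSystem ν T A) {u : H} {μ : Measure K}
    (h : Θ.Represents ν u μ) {s : ι → ℂ} (hs : Q u = ∑ i, s i • w i) (g : S) :
    ∃ Y : K → ℝ, Measurable Y ∧ (∀ᵐ x ∂μ, Tendsto (fun N : ℕ => (N : ℝ)⁻¹ *
      ∑ n ∈ Finset.range N, Θ.r g (T^[n] x)) atTop (𝓝 (Y x))) ∧ (∀ᵐ x ∂μ, |Y x| ≤ ‖Θ.r g‖) ∧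
      ∫ x, Y x ^ 2 ∂μ = ∑ i, (s i).re * (∫ x, Θ.r g x ∂m i) ^ 2 := by
  have hμ := h.finite
  have hprob := hE.prob
  obtain ⟨M, hM⟩ := hS.mul g
  obtain ⟨B, hB⟩ := hE.exists_sum_sq_bound hS hM h
  obtain ⟨Y, hYm, hY, hYb, hY2⟩ := exists_tendsto_average_of_sum_sq (m := μ)
    (X := fun n x => Θ.r g (T^[n] x))
    (fun n => (Θ.r g).continuous.measurable.comp (hS.qmp.measurable.iterate n))
    (fun n x => (Θ.r g).norm_coe_le_norm _) hB
  refine ⟨Y, hYm, hY, hYb, hY2.trans ?_⟩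
  let gc : C(K, ℂ) := ⟨fun x => (Θ.r g x : ℂ), by fun_prop⟩
  have h1 : ∀ i, Q (M (w i)) = ((∫ x, Θ.r g x ∂m i : ℝ) : ℂ) • w i := fun i => by
    rw [hE.proj_mul gc M hM i, ← integral_complex_ofReal]
    rfl
  rw [hs]
  simp only [map_sum, map_smul, h1, (hE.represents _).ev_eq g, Complex.re_sum, smul_eq_mul]
  refine Finset.sum_congr rfl fun i _ => ?_
  rw [← Complex.ofReal_mul, Complex.re_mul_ofReal, sq]

end IsErgodicBasis

end TestPairing

/-! ### Basins -/

section Basin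

variable {K : Type*} [TopologicalSpace K] [CompactSpace K] [MeasurableSpace K]

/-- The basin of a measure: the points whose orbit is distributed according to the measure, in the
sense that the averages of every continuous function along the orbit converge to its integral. -/
def basin (T : K → K) (m : Measure K) : Set K :=
  {x | ∀ f : C(K, ℝ), Tendsto (fun N => birkhoffAverage ℝ T f N x) atTop (𝓝 (∫ y, f y ∂m))}

variable [T2Space K] [SecondCountableTopology K] [BorelSpace K]
  {T : K → K} {m : Measure K}

theorem mem_basin_of_dense [IsProbabilityMeasure m] {s : Set C(K, ℝ)} (hs : Dense s) {x : K}
    (h : ∀ f ∈ s, Tendsto (fun N => birkhoffAverage ℝ T f N x) atTop (𝓝 (∫ y, f y ∂m))) :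
    x ∈ basin T m := by
  intro f
  rw [Metric.tendsto_atTop]
  intro ε hε
  obtain ⟨g, hgs, hg⟩ := hs.exists_dist_lt f (show 0 < ε / 3 by positivity)
  have hfg : ∀ y, |f y - g y| ≤ ε / 3 := fun y => by
    rw [← Real.dist_eq]
    exact ((ContinuousMap.dist_lt_iff (by positivity)).1 hg y).le
  obtain ⟨N₀, hN₀⟩ := Metric.tendsto_atTop.1 (h g hgs) (ε / 3) (by positivity)
  refine ⟨N₀, fun N hN => ?_⟩
  have h1 := hN₀ N hN
  rw [Real.dist_eq] at h1 ⊢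
  have h2 : |∫ y, f y ∂m - ∫ y, g y ∂m| ≤ ε / 3 := by
    rw [← integral_sub (integrable_continuousMap m f) (integrable_continuousMap m g)]
    have := norm_integral_le_of_norm_le_const (μ := m) (f := fun y => f y - g y)
      (Eventually.of_forall hfg)
    simpa using this
  have h3 : |birkhoffAverage ℝ T f N x - birkhoffAverage ℝ T g N x| ≤ ε / 3 := by
    rcases Nat.eq_zero_or_pos N with rfl | hN
    · simpa using (div_pos hε three_pos).le
    have hN' : (0 : ℝ) < N := by exact_mod_cast hN
    simp only [birkhoffAverage, birkhoffSum, smul_eq_mul]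
    rw [← mul_sub, ← Finset.sum_sub_distrib, abs_mul, abs_of_pos (inv_pos.2 hN'),
      inv_mul_le_iff₀ hN']
    refine (Finset.abs_sum_le_sum_abs _ _).trans ((Finset.sum_le_sum fun n _ => hfg _).trans ?_)
    simp
  have e : birkhoffAverage ℝ T f N x - ∫ y, f y ∂m =
      (birkhoffAverage ℝ T f N x - birkhoffAverage ℝ T g N x) +
        (birkhoffAverage ℝ T g N x - ∫ y, g y ∂m) - (∫ y, f y ∂m - ∫ y, g y ∂m) := by ring
  rw [e]
  have := abs_sub ((birkhoffAverage ℝ T f N x - birkhoffAverage ℝ T g N x) +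
    (birkhoffAverage ℝ T g N x - ∫ y, g y ∂m)) (∫ y, f y ∂m - ∫ y, g y ∂m)
  have := abs_add_le (birkhoffAverage ℝ T f N x - birkhoffAverage ℝ T g N x)
    (birkhoffAverage ℝ T g N x - ∫ y, g y ∂m)
  linarith

theorem measurable_birkhoffAverage (hT : Measurable T) (f : C(K, ℝ)) (N : ℕ) :
    Measurable (birkhoffAverage ℝ T f N) := by
  have : Measurable fun x => (N : ℝ)⁻¹ • ∑ k ∈ Finset.range N, f (T^[k] x) :=
    (Finset.measurable_sum _ fun n _ =>
      f.continuous.measurable.comp (hT.iterate n)).const_smul (N : ℝ)⁻¹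
  exact this

theorem measurableSet_basin [IsProbabilityMeasure m] (hT : Measurable T) :
    MeasurableSet (basin T m) := by
  obtain ⟨s, hsc, hsd⟩ := TopologicalSpace.exists_countable_dense C(K, ℝ)
  have : basin T m = ⋂ f ∈ s, {x | Tendsto (fun N => birkhoffAverage ℝ T f N x) atTop
      (𝓝 (∫ y, f y ∂m))} := by
    ext x
    simp only [mem_iInter]
    exact ⟨fun h f _ => h f, fun h => mem_basin_of_dense hsd h⟩
  rw [this]
  exact MeasurableSet.biInter hsc fun f _ =>
    measurableSet_tendsto _ fun N => measurable_birkhoffAverage hT f N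

theorem preimage_basin : T ⁻¹' basin T m = basin T m := by
  ext x
  refine forall_congr' fun f => ?_
  have hb : Bornology.IsBounded (range (f <| T^[·] x)) := by
    refine (isBounded_iff_forall_norm_le.2 ⟨‖f‖, ?_⟩)
    rintro _ ⟨n, rfl⟩
    exact f.norm_coe_le_norm _
  have h := tendsto_birkhoffAverage_apply_sub_birkhoffAverage ℝ hb
  constructor
  · intro h1
    simpa using h1.sub h
  · intro h1
    simpa using h.add h1

theorem disjoint_basin {m' : Measure K} [IsProbabilityMeasure m] [IsProbabilityMeasure m']
    (h : m ≠ m') : Disjoint (basin T m) (basin T m') := by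
  refine disjoint_left.2 fun x hx hx' => h ?_
  refine ext_of_forall_integral_eq_of_IsFiniteMeasure fun f => ?_
  exact tendsto_nhds_unique (hx f.toContinuousMap) (hx' f.toContinuousMap)

end Basin

namespace TestPairing

variable {K S H : Type*} [TopologicalSpace K] [CompactSpace K] [T2Space K]
  [SecondCountableTopology K] [MeasurableSpace K] [BorelSpace K] [AddCommGroup S]
  [Module ℝ S] [NormedAddCommGroup H] [NormedSpace ℂ H]
  {Θ : TestPairing K S H} {ν : Measure K} {T : K → K} {A : H →L[ℂ] H}

namespace IsErgodicBasis

variable {Q : H →L[ℂ] H} {D C : ℝ} {ι : Type*} [Fintype ι] [DecidableEq ι] {m : ι → Measure K}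
  {w : ι → H} (hE : Θ.IsErgodicBasis ν T A Q D C m w)

include hE

theorem measure_injective : Function.Injective m := by
  intro i j hij
  by_contra h
  obtain ⟨g, -, hg⟩ := hE.approx i (1 / 3) (by norm_num)
  have h1 := hg i
  have h2 := hg j
  rw [if_pos rfl, hij] at h1
  rw [if_neg (Ne.symm h)] at h2
  have h1 := abs_le.1 h1
  have h2 := abs_le.1 h2
  linarith [h1.1, h1.2, h2.1, h2.2]

/-- Test functions dual to the basis measures. The vectors of integrals of test functions form a
subspace of a finite-dimensional space, which is closed and contains approximations of the standard
basis. -/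
theorem exists_dual : ∃ p : ι → S, ∀ i j, ∫ x, Θ.r (p i) x ∂m j = if j = i then 1 else 0 := by
  have hprob := hE.prob
  let Φ : S →ₗ[ℝ] (ι → ℝ) :=
    { toFun := fun g j => ∫ x, Θ.r g x ∂m j
      map_add' := fun g g' => by
        ext j
        simp only [map_add, ContinuousMap.add_apply, Pi.add_apply]
        exact integral_add (integrable_continuousMap _ _) (integrable_continuousMap _ _)
      map_smul' := fun a g => by
        ext j
        simp only [map_smul, ContinuousMap.smul_apply, Pi.smul_apply, RingHom.id_apply]
        exact integral_smul _ _ }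
  have hcl : IsClosed (LinearMap.range Φ : Set (ι → ℝ)) :=
    (LinearMap.range Φ).closed_of_finiteDimensional
  have hmem : ∀ i, (fun j => if j = i then (1 : ℝ) else 0) ∈ LinearMap.range Φ := fun i => by
    refine hcl.closure_subset (Metric.mem_closure_iff.2 fun ε hε => ?_)
    obtain ⟨g, -, hg⟩ := hE.approx i (ε / 2) (by positivity)
    refine ⟨Φ g, ⟨g, rfl⟩, (dist_pi_lt_iff hε).2 fun j => ?_⟩
    rw [Real.dist_eq]
    exact (hg j).trans_lt (by linarith)
  choose p hp using hmem
  exact ⟨p, fun i j => congrFun (hp i) j⟩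

/-- Almost surely, the averages of all test functions are combinations of the limits of the averages
of the dual test functions, because the limit of the averages of a test function with vanishing
integrals has vanishing second moment. The limits `y i` for the dual functions are nonnegative,
their sum is one, and expanding the second moment of the limit for the sum of two dual functions
shows that `y i * y j = 0` for `i ≠ j`. Hence exactly one of them is nonzero, and the orbit is in
the corresponding basin. -/
theorem measure_basin (hS : Θ.IsTransferSystem ν T A) {u : H} {μ : Measure K}
    (h : Θ.Represents ν u μ) {s : ι → ℂ} (hs : Q u = ∑ i, s i • w i) :
    μ (⋃ i, basin T (m i))ᶜ = 0 ∧ ∀ i, μ.real (basin T (m i)) = (s i).re := by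
  have hμ := h.finite
  have hprob := hE.prob
  obtain ⟨p, hp⟩ := hE.exists_dual
  have hlim := hE.exists_average_limit hS h hs
  choose y hym hy hyb hy2 using fun i => hlim (p i)
  have hbirk : ∀ (f : C(K, ℝ)) N x, birkhoffAverage ℝ T f N x =
      (N : ℝ)⁻¹ * ∑ n ∈ Finset.range N, f (T^[n] x) := fun f N x => rfl
  simp only [← hbirk] at hlim hy
  have hyi2 : ∀ i, ∫ x, y i x ^ 2 ∂μ = (s i).re := fun i => by
    rw [hy2, Finset.sum_eq_single i (fun j _ hj => by rw [hp, if_neg hj]; ring) (by simp), hp,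
      if_pos rfl, one_pow, mul_one]
  -- The averages of a test function are determined by those of the dual functions.
  have hrel : ∀ g, ∀ᵐ x ∂μ, Tendsto (fun N => birkhoffAverage ℝ T (Θ.r g) N x) atTop
      (𝓝 (∑ i, (∫ z, Θ.r g z ∂m i) * y i x)) := by
    intro g
    set g' : S := g - ∑ i, (∫ z, Θ.r g z ∂m i) • p i with hg'
    have hg'r : ∀ x, Θ.r g x = Θ.r g' x + ∑ i, (∫ z, Θ.r g z ∂m i) * Θ.r (p i) x := fun x => by
      simp [hg']
    have hint : ∀ j, ∫ x, Θ.r g' x ∂m j = 0 := fun j => by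
      have h1 : ∫ x, Θ.r g x ∂m j = ∫ x, Θ.r g' x ∂m j + ∫ x, Θ.r g x ∂m j := by
        refine (integral_congr_ae (Eventually.of_forall hg'r)).trans ?_
        rw [integral_add (integrable_continuousMap _ _) (integrable_finsetSum _ fun i _ =>
          (integrable_continuousMap _ _).const_mul _), integral_finsetSum _ fun i _ =>
          (integrable_continuousMap _ _).const_mul _]
        congr 1
        simp only [integral_const_mul, hp]
        simp
      linarith
    obtain ⟨Y, hYm, hY, hYb, hY2⟩ := hlim g'
    have hY0 : ∀ᵐ x ∂μ, Y x = 0 := by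
      have h0 : ∫ x, Y x ^ 2 ∂μ = 0 := by rw [hY2]; simp [hint]
      have hi : Integrable (fun x => Y x ^ 2) μ := by
        refine Integrable.of_bound (hYm.pow_const 2).aestronglyMeasurable (‖Θ.r g'‖ ^ 2) ?_
        filter_upwards [hYb] with x hx
        rw [Real.norm_eq_abs, abs_pow]
        exact pow_le_pow_left₀ (abs_nonneg _) hx 2
      have := (integral_eq_zero_iff_of_nonneg (fun x => sq_nonneg _) hi).1 h0
      filter_upwards [this] with x hx
      exact pow_eq_zero_iff two_ne_zero |>.1 hx
    filter_upwards [hY, hY0, ae_all_iff.2 hy] with x h1 h2 h3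
    rw [h2] at h1
    have h4 := h1.add (tendsto_finsetSum Finset.univ fun i _ =>
      (h3 i).const_mul (∫ z, Θ.r g z ∂m i))
    rw [zero_add] at h4
    refine h4.congr fun N => ?_
    rw [hbirk, hbirk, Finset.sum_congr rfl fun n _ => hg'r (T^[n] x), Finset.sum_add_distrib,
      mul_add]
    congr 1
    rw [Finset.sum_comm, Finset.mul_sum]
    refine Finset.sum_congr rfl fun i _ => ?_
    rw [hbirk, ← Finset.mul_sum]
    ring
  have hnonneg : ∀ i, ∀ᵐ x ∂μ, 0 ≤ y i x := by
    intro i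
    choose g hg0 hg using fun k : ℕ => hE.approx i (1 / ((k : ℝ) + 1)) (by positivity)
    have hg' : ∀ j, Tendsto (fun k => ∫ z, Θ.r (g k) z ∂m j) atTop
        (𝓝 (if j = i then 1 else 0)) := fun j => by
      rw [tendsto_iff_norm_sub_tendsto_zero]
      refine squeeze_zero (fun _ => norm_nonneg _) (fun k => ?_)
        tendsto_one_div_add_atTop_nhds_zero_nat
      rw [norm_sub_rev]
      exact hg k j
    filter_upwards [ae_all_iff.2 fun k => hrel (g k)] with x hx
    have h1 : ∀ k, 0 ≤ ∑ j, (∫ z, Θ.r (g k) z ∂m j) * y j x := fun k =>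
      ge_of_tendsto' (hx k) fun N =>
        mul_nonneg (inv_nonneg.2 N.cast_nonneg) (Finset.sum_nonneg fun n _ => hg0 k _)
    have h2 := tendsto_finsetSum Finset.univ fun j _ => (hg' j).mul_const (y j x)
    have h3 := ge_of_tendsto' h2 h1
    simpa using h3
  have hsum : ∀ᵐ x ∂μ, ∑ i, y i x = 1 := by
    obtain ⟨e, he⟩ := Θ.one
    filter_upwards [hrel e] with x hx
    have h1 : ∑ i, y i x = ∑ i, (∫ z, Θ.r e z ∂m i) * y i x := by simp [he]
    rw [h1]
    refine tendsto_nhds_unique hx (tendsto_const_nhds.congr' ?_)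
    filter_upwards [eventually_ne_atTop 0] with N hN
    have hN' : (N : ℝ) ≠ 0 := by exact_mod_cast hN
    rw [hbirk, he]
    simp [hN']
  have hyi : ∀ i j, Integrable (fun x => y i x * y j x) μ := fun i j => by
    refine Integrable.of_bound ((hym i).mul (hym j)).aestronglyMeasurable
      (‖Θ.r (p i)‖ * ‖Θ.r (p j)‖) ?_
    filter_upwards [hyb i, hyb j] with x h1 h2
    rw [norm_mul]
    exact mul_le_mul h1 h2 (norm_nonneg _) (norm_nonneg _)
  have horth : ∀ i j, i ≠ j → ∀ᵐ x ∂μ, y i x * y j x = 0 := by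
    intro i j hij
    obtain ⟨Y, hYm, hY, hYb, hY2⟩ := hlim (p i + p j)
    have hYy : ∀ᵐ x ∂μ, Y x = y i x + y j x := by
      filter_upwards [hY, hy i, hy j] with x h1 h2 h3
      refine tendsto_nhds_unique h1 ((h2.add h3).congr fun N => ?_)
      simp only [hbirk, map_add, ContinuousMap.add_apply, Finset.sum_add_distrib, mul_add]
    have h1 : ∫ x, Y x ^ 2 ∂μ = (s i).re + (s j).re := by
      have e1 : ∀ k, ∫ x, Θ.r (p i + p j) x ∂m k =
          (if k = i then 1 else 0) + (if k = j then 1 else 0) := fun k => by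
        simp only [map_add, ContinuousMap.add_apply]
        rw [integral_add (integrable_continuousMap _ _) (integrable_continuousMap _ _), hp, hp]
      have e2 : ∀ k, (s k).re * ((if k = i then (1 : ℝ) else 0) + (if k = j then 1 else 0)) ^ 2 =
          (if k = i then (s k).re else 0) + (if k = j then (s k).re else 0) := fun k => by
        by_cases hk : k = i
        · have : k ≠ j := fun h => hij (hk.symm.trans h)
          simp [hk, hij]
        · by_cases hk' : k = j
          · simp [hk', Ne.symm hij]
          · simp [hk, hk']
      rw [hY2]
      simp only [e1, e2, Finset.sum_add_distrib]
      simp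
    have h2 : ∫ x, Y x ^ 2 ∂μ = (s i).re + 2 * ∫ x, y i x * y j x ∂μ + (s j).re := by
      have hsq : ∀ i, Integrable (fun x => y i x ^ 2) μ := fun i => by
        simpa only [sq] using hyi i i
      have hi12 : Integrable (fun x => y i x ^ 2 + 2 * (y i x * y j x)) μ :=
        (hsq i).add ((hyi i j).const_mul 2)
      rw [← hyi2 i, ← hyi2 j, ← integral_const_mul,
        ← integral_add (hsq i) ((hyi i j).const_mul 2), ← integral_add hi12 (hsq j)]
      refine integral_congr_ae (hYy.mono fun x hx => ?_)
      simp only [hx]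
      ring
    have h3 : ∫ x, y i x * y j x ∂μ = 0 := by linarith
    refine (integral_eq_zero_iff_of_nonneg_ae ?_ (hyi i j)).1 h3
    filter_upwards [hnonneg i, hnonneg j] with x h1 h2
    exact mul_nonneg h1 h2
  obtain ⟨t, ht, htc, htd⟩ := Θ.dense.exists_countable_dense_subset
  have hconv : ∀ᵐ x ∂μ, ∃ i, x ∈ basin T (m i) ∧ ∀ j, y j x = if j = i then 1 else 0 := by
    have h1 : ∀ᵐ x ∂μ, ∀ f ∈ t, Tendsto (fun N => birkhoffAverage ℝ T f N x) atTop
        (𝓝 (∑ i, (∫ z, f z ∂m i) * y i x)) := by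
      refine (ae_ball_iff htc).2 fun f hf => ?_
      obtain ⟨g, rfl⟩ := ht hf
      exact hrel g
    have h2 : ∀ᵐ x ∂μ, ∀ i j, i ≠ j → y i x * y j x = 0 :=
      ae_all_iff.2 fun i => ae_all_iff.2 fun j => by
        by_cases hij : i = j
        · simp [hij]
        · exact (horth i j hij).mono fun x hx _ => hx
    filter_upwards [h1, h2, hsum] with x h1 h2 h3
    obtain ⟨i, hi⟩ : ∃ i, y i x ≠ 0 := by
      by_contra! h0
      simp [h0] at h3
    have h0 : ∀ j, j ≠ i → y j x = 0 := fun j hj =>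
      (mul_eq_zero.1 (h2 j i hj)).resolve_right hi
    have hone : y i x = 1 := by
      rwa [Finset.sum_eq_single i (fun j _ hj => h0 j hj) (by simp)] at h3
    have hval : ∀ j, y j x = if j = i then 1 else 0 := fun j => by
      split_ifs with hj
      · rw [hj, hone]
      · exact h0 j hj
    refine ⟨i, mem_basin_of_dense htd fun f hf => ?_, hval⟩
    have := h1 f hf
    simpa [hval] using this
  refine ⟨?_, fun i => ?_⟩
  · change ∀ᵐ x ∂μ, x ∈ ⋃ i, basin T (m i)
    filter_upwards [hconv] with x ⟨i, hi, _⟩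
    exact mem_iUnion.2 ⟨i, hi⟩
  · have hbm : MeasurableSet (basin T (m i)) := measurableSet_basin hS.qmp.measurable
    have h1 : (fun x => y i x ^ 2) =ᵐ[μ] (basin T (m i)).indicator fun _ => (1 : ℝ) := by
      filter_upwards [hconv] with x ⟨j, hj, hval⟩
      rw [hval i]
      by_cases hij : i = j
      · subst hij
        simp [hj]
      · have : x ∉ basin T (m i) := fun hx =>
          disjoint_left.1 (disjoint_basin (hE.measure_injective.ne hij)) hx hj
        simp [hij, this]
    rw [← hyi2 i, integral_congr_ae h1, integral_indicator hbm, setIntegral_const, smul_eq_mul,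
      mul_one]

theorem measure_basin_self (hS : Θ.IsTransferSystem ν T A) (i : ι) : m i (basin T (m i)) = 1 := by
  have hprob := hE.prob
  have h := (hE.measure_basin hS (hE.represents i) (s := fun j => if j = i then 1 else 0)
    (by rw [hE.proj_apply]; simp)).2 i
  rw [if_pos rfl, Complex.one_re] at h
  exact (ENNReal.toReal_eq_one_iff _).1 h

/-- The basins have positive reference measure: a bounded function close to the basis element has
positive mass on the basin. -/
theorem reference_basin_ne_zero (hS : Θ.IsTransferSystem ν T A) (i : ι) :
    ν (basin T (m i)) ≠ 0 := by
  have hν := hS.finite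
  have hprob := hE.prob
  obtain ⟨p, hp⟩ := hE.exists_dual
  have hev : ∀ {u : H} {s : ι → ℂ}, Q u = ∑ j, s j • w j → Θ.ev (p i) (Q u) = s i := by
    intro u s hs
    rw [hs]
    simp [map_sum, map_smul, (hE.represents _).ev_eq (p i), hp, apply_ite]
  have hcont : Continuous fun u => (Θ.ev (p i) (Q u)).re :=
    Complex.continuous_re.comp ((Θ.ev (p i)).continuous.comp Q.continuous)
  have hwi : (Θ.ev (p i) (Q (w i))).re = 1 := by
    rw [hev (s := fun j => if j = i then 1 else 0) (by rw [hE.proj_apply]; simp), if_pos rfl,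
      Complex.one_re]
  have hopen : IsOpen {u | 0 < (Θ.ev (p i) (Q u)).re} := isOpen_lt continuous_const hcont
  obtain ⟨u, hu, φ, hφ, huφ⟩ := mem_closure_iff.1 (hE.represents i).mem_cone _ hopen
    (show 0 < (Θ.ev (p i) (Q (w i))).re by rw [hwi]; exact one_pos)
  obtain ⟨s, hs⟩ := hE.span u
  have h1 := (hE.measure_basin hS (huφ.represents hφ) hs).2 i
  rw [← hev hs] at h1
  intro h0
  have h2 := withDensity_absolutelyContinuous ν (fun x => ENNReal.ofReal (φ x)) h0
  rw [Measure.real, h2, ENNReal.toReal_zero] at h1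
  exact absurd h1.symm (ne_of_gt hu)

/-- The basins cover the space up to a null set of the reference measure: the complement `U` is
invariant and null for `f₀ dν`, so `ν U` is the integral over `U` of the image of the function one
under the `N₀`-th power of the transfer operator, which vanishes where `f₀ = 0`. -/
theorem reference_compl_basin {P : H →L[ℂ] H} {C' δ : ℝ} {φ : ℕ → ℕ} {u₀ : H} {f₀ : K → ℝ}
    {N₀ : ℕ} (hQ : Θ.IsQuasicompactSystem ν T A P C' δ φ u₀ f₀ N₀) :
    ν (⋃ i, basin T (m i))ᶜ = 0 := by
  have hν := hQ.finite
  have hprob := hE.prob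
  set U := (⋃ i, basin T (m i))ᶜ with hU
  have hT := hQ.qmp.measurable
  have hUm : MeasurableSet U :=
    (MeasurableSet.iUnion fun i => measurableSet_basin hT).compl
  have hTU : ∀ N, T^[N] ⁻¹' U = U := fun N => by
    induction N with
    | zero => rfl
    | succ N ih =>
      rw [Function.iterate_succ, preimage_comp, ih, hU, preimage_compl, preimage_iUnion]
      simp only [preimage_basin]
  obtain ⟨s, hs⟩ := hE.span u₀
  have hf0m : AEMeasurable f₀ ν := by simpa using hQ.isBdd_f₀.integrable.re.aemeasurable
  have h1 := (hE.measure_basin hQ.toIsTransferSystem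
    (hQ.isBdd_f₀.represents fun x => (hQ.f₀_mem x).1) hs).1
  have h2 : ∀ᵐ x ∂ν, x ∈ U → f₀ x ≤ 0 := by
    rw [← hU, withDensity_apply _ hUm, lintegral_eq_zero_iff' hf0m.ennreal_ofReal.restrict] at h1
    have h3 := (ae_restrict_iff' hUm).1 h1
    filter_upwards [h3] with x hx hxU
    simpa using hx hxU
  have hone : MemLp (fun _ : K => (1 : ℂ)) ∞ ν := memLp_const 1
  have h3 := integral_iterate_transfer_mul hQ.qmp (f := fun _ => 1) (integrable_const (1 : ℂ))
    (g := U.indicator fun _ => 1) (measurable_const.indicator hUm) (b := 1) (fun x => by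
      by_cases hx : x ∈ U <;> simp [hx]) N₀
  have h4 : ∫ x, (PhysicalMeasures.transfer T ν)^[N₀] (fun _ => 1) x *
      U.indicator (fun _ => (1 : ℂ)) x ∂ν = 0 := by
    refine integral_eq_zero_of_ae ?_
    filter_upwards [h2, hQ.dominates _ hone] with x hx1 hx2
    by_cases hxU : x ∈ U
    · have h5 : (PhysicalMeasures.transfer T ν)^[N₀] (fun _ => 1) x = 0 := by
        by_contra h0
        have := hx1 hxU
        rw [hx2 h0] at this
        linarith
      simp [h5]
    · simp [hxU]
  have h5 : ∫ x, (1 : ℂ) * U.indicator (fun _ => (1 : ℂ)) (T^[N₀] x) ∂ν = (ν.real U : ℂ) := by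
    have : ∀ x, (1 : ℂ) * U.indicator (fun _ => (1 : ℂ)) (T^[N₀] x) =
        (T^[N₀] ⁻¹' U).indicator (fun _ => (1 : ℂ)) x := fun x => by
      rw [one_mul]
      rfl
    simp only [this, hTU]
    rw [integral_indicator hUm, setIntegral_const]
    simp
  rw [h4, h5] at h3
  have h6 : ν.real U = 0 := by exact_mod_cast h3.symm
  exact (measureReal_eq_zero_iff).1 h6

end IsErgodicBasis

end TestPairing

/-! ### Smooth functions and distributions on a manifold -/

section Manifold

variable {d : ℕ} {X : Type*} [TopologicalSpace X] [ChartedSpace (EuclideanSpace ℝ (Fin d)) X]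

/-- The density is bounded on a closed ball in a chart. -/
theorem IsSmoothMeasure.isLocallyFiniteMeasure [MeasurableSpace X] {Leb : Measure X}
    (h : IsSmoothMeasure d Leb) : IsLocallyFiniteMeasure Leb := by
  refine ⟨fun x => ?_⟩
  set e := chartAt (EuclideanSpace ℝ (Fin d)) x with he
  obtain ⟨ρ, hρ, -, hLeb⟩ := h e (chart_mem_atlas _ x)
  obtain ⟨r, hr, hball⟩ := Metric.nhds_basis_closedBall.mem_iff.1
    (e.open_target.mem_nhds (e.map_source (mem_chart_source _ x)))
  refine ⟨e.symm '' Metric.closedBall (e x) r, ?_, ?_⟩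
  · have h1 := e.symm.image_mem_nhds (x := e x) (e.map_source (mem_chart_source _ x))
      (Metric.closedBall_mem_nhds (e x) hr)
    rwa [e.left_inv (mem_chart_source _ x)] at h1
  · rw [hLeb _ hball Metric.isClosed_closedBall.measurableSet]
    exact ((hρ.continuousOn.mono hball).integrableOn_compact
      (isCompact_closedBall _ _)).lintegral_lt_top

section Holder

variable {F : Type*} [NormedAddCommGroup F] [NormedSpace ℝ F]

theorem contDiffOn_inChart [IsManifold 𝓘(ℝ, EuclideanSpace ℝ (Fin d)) ∞ X] {f : X → F}
    (hf : ContMDiff 𝓘(ℝ, EuclideanSpace ℝ (Fin d)) 𝓘(ℝ, F) ∞ f) (c : X) :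
    ContDiffOn ℝ ∞ (inChart d f c) (chartAt (EuclideanSpace ℝ (Fin d)) c).target := by
  rw [← contMDiffOn_iff_contDiffOn]
  exact hf.comp_contMDiffOn contMDiffOn_chart_symm

/-- The derivatives of a smooth function are locally Lipschitz, hence locally Hölder. -/
theorem _root_.ContMDiff.isCAlpha [IsManifold 𝓘(ℝ, EuclideanSpace ℝ (Fin d)) ∞ X] {f : X → F}
    (hf : ContMDiff 𝓘(ℝ, EuclideanSpace ℝ (Fin d)) 𝓘(ℝ, F) ∞ f) (α : ℝ) :
    IsCAlpha d α f := by
  refine ⟨hf.of_le (by exact_mod_cast le_top), fun c K hK hKc => ?_⟩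
  set h := iteratedFDeriv ℝ ⌊α⌋₊ (inChart d f c) with hh
  have hloc : LocallyLipschitzOn K h := fun x hx => by
    have h1 : ContDiffAt ℝ ∞ (inChart d f c) x := (contDiffOn_inChart hf c).contDiffAt
      ((chartAt _ c).open_target.mem_nhds (hK hx))
    have h2 : ContDiffAt ℝ 1 h x := h1.iteratedFDeriv_right (by exact_mod_cast le_top)
    obtain ⟨L, t, ht, hL⟩ := h2.exists_lipschitzOnWith
    exact ⟨L, t, mem_nhdsWithin_of_mem_nhds ht, hL⟩
  obtain ⟨L, hL⟩ := hloc.exists_lipschitzOnWith_of_compact hKc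
  set θ := α - ⌊α⌋₊ with hθ
  have hθ1 : θ < 1 := by linarith [Nat.lt_floor_add_one α]
  refine ⟨L * Metric.diam K ^ (1 - θ), fun y hy z hz => ?_⟩
  have h1 : ‖h y - h z‖ ≤ L * ‖y - z‖ := by
    rw [← dist_eq_norm, ← dist_eq_norm]
    exact hL.dist_le_mul y hy z hz
  rcases eq_or_ne y z with rfl | hyz
  · rw [sub_self, norm_zero]
    exact mul_nonneg (mul_nonneg L.coe_nonneg (Real.rpow_nonneg Metric.diam_nonneg _))
      (Real.rpow_nonneg (norm_nonneg _) _)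
  have hpos : 0 < ‖y - z‖ := norm_pos_iff.2 (sub_ne_zero.2 hyz)
  have h2 : ‖y - z‖ = ‖y - z‖ ^ (1 - θ) * ‖y - z‖ ^ θ := by
    rw [← Real.rpow_add hpos, sub_add_cancel, Real.rpow_one]
  have h3 : ‖y - z‖ ^ (1 - θ) ≤ Metric.diam K ^ (1 - θ) := by
    refine Real.rpow_le_rpow (norm_nonneg _) ?_ (by linarith)
    rw [← dist_eq_norm]
    exact Metric.dist_le_diam_of_mem hKc.isBounded hy hz
  refine h1.trans ((mul_le_mul_of_nonneg_left h2.le L.coe_nonneg).trans ?_)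
  rw [mul_assoc]
  exact mul_le_mul_of_nonneg_left
    (mul_le_mul_of_nonneg_right h3 (Real.rpow_nonneg (norm_nonneg _) _)) L.coe_nonneg

end Holder

/-- Restriction to `X₀` of smooth functions. -/
noncomputable def smoothRestrict (X₀ : Set X) : SmoothFun d X →ₐ[ℝ] C(X₀, ℝ) where
  toFun g := ⟨fun x => g x, g.contMDiff.continuous.comp continuous_subtype_val⟩
  map_one' := rfl
  map_mul' _ _ := rfl
  map_zero' := rfl
  map_add' _ _ := rfl
  commutes' _ := rfl

variable [T2Space X] [SecondCountableTopology X]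
  [IsManifold 𝓘(ℝ, EuclideanSpace ℝ (Fin d)) ∞ X] {X₀ : Set X} [CompactSpace X₀]

/-- The Stone–Weierstrass theorem, points being separated by smooth bump functions. -/
theorem denseRange_smoothRestrict :
    DenseRange (smoothRestrict X₀ : SmoothFun d X →ₐ[ℝ] C(X₀, ℝ)) := by
  have : LocallyCompactSpace X := ChartedSpace.locallyCompactSpace (EuclideanSpace ℝ (Fin d)) X
  have hsep : (smoothRestrict X₀ : SmoothFun d X →ₐ[ℝ] C(X₀, ℝ)).range.SeparatesPoints := by
    intro x y hxy
    obtain ⟨f, hf0, hf1, -⟩ := exists_contMDiffMap_zero_one_of_isClosed (n := ⊤)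
      𝓘(ℝ, EuclideanSpace ℝ (Fin d)) (isClosed_singleton (x := (x : X)))
      (isClosed_singleton (x := (y : X)))
      (disjoint_singleton.2 fun h => hxy (Subtype.ext h))
    refine ⟨smoothRestrict X₀ f, ⟨_, ⟨f, rfl⟩, rfl⟩, ?_⟩
    have h0 : f x = 0 := hf0 rfl
    have h1 : f y = 1 := hf1 rfl
    change f x ≠ f y
    rw [h0, h1]
    exact zero_ne_one
  have h := ContinuousMap.subalgebra_topologicalClosure_eq_top_of_separatesPoints _ hsep
  intro f
  have hf : f ∈ (smoothRestrict X₀ : SmoothFun d X →ₐ[ℝ] C(X₀, ℝ)).range.topologicalClosure := by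
    rw [h]
    trivial
  exact hf

variable {H : Type*} [NormedAddCommGroup H] [NormedSpace ℂ H]

namespace DistributionSpace

/-- A space of distributions supported on `X₀`, as a space of generalized measures on `X₀` tested
against smooth functions on `X`. -/
noncomputable def testPairing (D : DistributionSpace d X₀ H) : TestPairing X₀ (SmoothFun d X) H where
  r := (smoothRestrict X₀).toLinearMap
  dense := denseRange_smoothRestrict
  one := ⟨1, rfl⟩
  ev g := { toFun := fun u => D.pairing u g
            map_add' := fun u v => by simp
            map_smul' := fun a u => by simp
            cont := D.continuous_pairing g }
  sep u hu := D.injective (by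
    rw [map_zero]
    ext g
    exact hu g)
  ev_add g g' := by
    ext u
    exact map_add (D.pairing u) g g'
  ev_smul a g u := (map_smul (D.pairing u) a g).trans (Complex.real_smul ..)

variable [MeasurableSpace X] [BorelSpace X] {D : DistributionSpace d X₀ H} {ν : Measure X₀}
  {𝒦 : ChartCover d X₀} {α : ℝ} {T : X₀ → X₀} {𝓛 : H →L[ℂ] H}

theorem isTransferSystem (hν : IsFiniteMeasure ν) (hT : Measure.QuasiMeasurePreserving T ν ν)
    (h1 : D.CAlphaMultipliers ν 𝒦 α)
    (h2 : Dense {u : H | ∃ φ, D.IsBddFun ν u φ}) (h3 : D.IsTransferExtension ν T 𝓛)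
    (h5 : D.NoMassOnDiscontinuities ν T) : D.testPairing.IsTransferSystem ν T 𝓛 where
  finite := hν
  qmp := hT
  dense := h2
  mul g := by
    obtain ⟨C, -, hC⟩ := h1
    have hg : ContMDiff 𝓘(ℝ, EuclideanSpace ℝ (Fin d)) 𝓘(ℝ, ℂ) ∞ fun x => (g x : ℂ) :=
      Complex.ofRealCLM.contDiff.contMDiff.comp g.contMDiff
    obtain ⟨M, hM, -⟩ := hC _ (hg.isCAlpha α)
    exact ⟨M, hM⟩
  transfer := h3
  noMass u m hu := by
    obtain ⟨v, hv, hvu⟩ := mem_closure_iff_seq_limit.1 hu.mem_cone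
    choose φ hφ hvφ using hv
    exact h5 u v φ hφ hvφ hvu m hu.finite hu.ev_eq

theorem exists_isQuasicompactSystem [CompleteSpace H] (hν : IsFiniteMeasure ν)
    (hT : Measure.QuasiMeasurePreserving T ν ν) (h1 : D.CAlphaMultipliers ν 𝒦 α)
    (h2 : Dense {u : H | ∃ φ, D.IsBddFun ν u φ}) (h3 : D.IsTransferExtension ν T 𝓛)
    (h3' : essentialSpectralRadius 𝓛 < 1) (h5 : D.NoMassOnDiscontinuities ν T)
    {u₀ : H} {f₀ : X₀ → ℝ} {N₀ : ℕ} (hf₀ : ∀ x, f₀ x ∈ Icc (0 : ℝ) 1)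
    (hu₀ : D.IsBddFun ν u₀ fun x => (f₀ x : ℂ)) (h4 : ∀ φ : X₀ → ℂ, MemLp φ ∞ ν →
      ∀ᵐ x ∂ν, (transfer T ν)^[N₀] φ x ≠ 0 → f₀ x = 1) :
    ∃ P C δ φ, D.testPairing.IsQuasicompactSystem ν T 𝓛 P C δ φ u₀ f₀ N₀ := by
  have hS := D.isTransferSystem hν hT h1 h2 h3 h5
  obtain ⟨P, C, δ, φ, hP⟩ := exists_isPeripheralProjection h3' D.testPairing.ev
    D.testPairing.sep h2 fun u ⟨ψ, hψ⟩ g => ⟨_, fun n => hS.norm_ev_pow_le hψ n g⟩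
  exact ⟨P, C, δ, φ, { hS, hP with f₀_mem := hf₀, isBdd_f₀ := hu₀, dominates := h4 }⟩

end DistributionSpace

end Manifold

/-! ### Decomposition of the ergodic measures -/

section CyclicDecomposition

theorem sum_zmod_eq_sum_range {M : Type*} [AddCommMonoid M] (k : ℕ) [NeZero k] (f : ℕ → M) :
    ∑ j : ZMod k, f j.val = ∑ r ∈ Finset.range k, f r := by
  obtain ⟨k, rfl⟩ := Nat.exists_eq_succ_of_ne_zero (NeZero.ne k)
  exact Fin.sum_univ_eq_sum_range f (k + 1)

/-- Convergence of averages for complex observables reduces to the real and imaginary parts. -/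
theorem tendsto_average_of_mem_basin {K : Type*} [TopologicalSpace K] [CompactSpace K]
    [T2Space K] [SecondCountableTopology K] [MeasurableSpace K] [BorelSpace K] {T : K → K}
    {m : Measure K} [IsFiniteMeasure m] {x : K} (hx : x ∈ basin T m) (f : C(K, ℂ)) :
    Tendsto (fun n : ℕ => (n : ℂ)⁻¹ * ∑ j ∈ Finset.range n, f (T^[j] x)) atTop
      (𝓝 (∫ y, f y ∂m)) := by
  have hfi : Integrable f m :=
    Integrable.of_bound f.continuous.measurable.aestronglyMeasurable ‖f‖
      (Eventually.of_forall f.norm_coe_le_norm)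
  have hre := hx ⟨fun y => (f y).re, Complex.continuous_re.comp f.continuous⟩
  have him := hx ⟨fun y => (f y).im, Complex.continuous_im.comp f.continuous⟩
  have e : ∀ n : ℕ, (n : ℂ)⁻¹ * ∑ j ∈ Finset.range n, f (T^[j] x) =
      ((birkhoffAverage ℝ T (fun y => (f y).re) n x : ℝ) : ℂ) +
        ((birkhoffAverage ℝ T (fun y => (f y).im) n x : ℝ) : ℂ) * Complex.I := fun n => by
    simp only [birkhoffAverage, birkhoffSum, smul_eq_mul]
    push_cast
    rw [mul_assoc, ← mul_add, Finset.sum_mul, ← Finset.sum_add_distrib]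
    simp only [Complex.re_add_im]
  have e' : ∫ y, f y ∂m = ((∫ y, (f y).re ∂m : ℝ) : ℂ) + ((∫ y, (f y).im ∂m : ℝ) : ℂ) * Complex.I :=
    (integral_re_add_im hfi).symm
  rw [e']
  simp only [e]
  exact ((Complex.continuous_ofReal.tendsto _).comp hre).add
    (((Complex.continuous_ofReal.tendsto _).comp him).mul_const _)

variable {d : ℕ} {X : Type*} [TopologicalSpace X] [ChartedSpace (EuclideanSpace ℝ (Fin d)) X]
  [T2Space X] [SecondCountableTopology X]
  [IsManifold 𝓘(ℝ, EuclideanSpace ℝ (Fin d)) ∞ X] [MeasurableSpace X] [BorelSpace X]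
  {X₀ : Set X} [CompactSpace X₀] {H : Type*} [NormedAddCommGroup H] [NormedSpace ℂ H]
  {D : DistributionSpace d X₀ H} {ν : Measure X₀} {𝒦 : ChartCover d X₀} {α : ℝ} {T : X₀ → X₀}
  {𝓛 P : H →L[ℂ] H} {C δ : ℝ} {φ : ℕ → ℕ} {n : ℕ} {m : Fin n → Measure X₀} {v : Fin n → H}
  {τ : Equiv.Perm (Fin n)}

/-- Decay of correlations for continuous observables acting by multiplication gives exponential
mixing for `C^α` observables, whose multiplication operators are bounded by the `C^α` norm. -/
theorem exponentiallyMixing (hB : D.testPairing.IsMixingBasis ν T 𝓛 P m v τ)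
    (hS : D.testPairing.IsTransferSystem ν T 𝓛) (hP : IsPeripheralProjection 𝓛 P C δ φ)
    (h1 : D.CAlphaMultipliers ν 𝒦 α) {k : ℕ} (hk : 0 < k) {i : Fin n} (hi : (τ ^ k) i = i) :
    ExponentiallyMixing 𝒦 α T^[k] (m i) := by
  obtain ⟨c, hc, hcorr⟩ := hB.norm_correlation_le hS hP hi
  obtain ⟨B, hB0, hmul⟩ := h1
  refine ⟨c * B * B, δ, hP.δ_pos, hP.δ_lt_one, fun f g hf hg M N hfM hgN j => ?_⟩
  obtain ⟨Mf, hMf, hMfn⟩ := hmul f hf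
  obtain ⟨Mg, hMg, hMgn⟩ := hmul g hg
  have hMf' : ‖Mf‖ ≤ B * M :=
    Mf.opNorm_le_bound (mul_nonneg hB0.le hfM.1) (hMfn M hfM)
  have hMg' : ‖Mg‖ ≤ B * N :=
    Mg.opNorm_le_bound (mul_nonneg hB0.le hgN.1) (hMgn N hgN)
  have h := hcorr ⟨fun x => f x, hf.1.continuous.comp continuous_subtype_val⟩
    ⟨fun x => g x, hg.1.continuous.comp continuous_subtype_val⟩ Mf Mg hMf hMg j
  have hδ : δ ^ (k * j) ≤ δ ^ j :=
    pow_le_pow_of_le_one hP.δ_pos.le hP.δ_lt_one.le (Nat.le_mul_of_pos_left j hk)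
  rw [Function.iterate_mul] at h
  refine h.trans ?_
  calc c * ‖Mf‖ * ‖Mg‖ * δ ^ (k * j) ≤ c * (B * M) * (B * N) * δ ^ j := by
        have := hP.δ_pos.le
        have := hfM.1
        have : 0 ≤ c * (B * M) * (B * N) :=
          mul_nonneg (mul_nonneg hc (mul_nonneg hB0.le hfM.1)) (mul_nonneg hB0.le hgN.1)
        gcongr
    _ = c * B * B * M * N * δ ^ j := by ring

/-- The average of the mixing measures along an orbit of the permutation `τ` splits into components
permuted cyclically by `T`. -/
theorem exists_cyclic_decomposition (hB : D.testPairing.IsMixingBasis ν T 𝓛 P m v τ)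
    (hS : D.testPairing.IsTransferSystem ν T 𝓛) (hP : IsPeripheralProjection 𝓛 P C δ φ)
    (h1 : D.CAlphaMultipliers ν 𝒦 α) (a : Fin n) :
    ∃ (k : ℕ) (_ : NeZero k) (μ : ZMod k → Measure X₀),
      ENNReal.ofReal (orderOf τ : ℝ)⁻¹ • ∑ r ∈ Finset.range (orderOf τ), m ((τ ^ r) a) =
        ∑ j, μ j ∧ (∀ j, (μ j).map T = μ (j + 1)) ∧
      ∀ j, IsProbabilityMeasure ((k : ℝ≥0∞) • μ j) ∧
        ExponentiallyMixing 𝒦 α T^[k] ((k : ℝ≥0∞) • μ j) := by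
  have hpos : 0 < orderOf τ := orderOf_pos τ
  have hmod : ∀ r, τ ^ (r % orderOf τ) = τ ^ r := pow_mod_orderOf τ
  have hone : τ ^ orderOf τ = 1 := pow_orderOf_eq_one τ
  generalize orderOf τ = k at hpos hmod hone
  have hk0 : NeZero k := ⟨hpos.ne'⟩
  refine ⟨k, hk0, fun j => ENNReal.ofReal (k : ℝ)⁻¹ • m ((τ ^ j.val) a), ?_, fun j => ?_,
    fun j => ?_⟩
  · rw [sum_zmod_eq_sum_range k fun r => ENNReal.ofReal (k : ℝ)⁻¹ • m ((τ ^ r) a),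
      Finset.smul_sum]
  · have hval : τ ^ (j + 1).val = τ ^ (j.val + 1) := by
      rw [ZMod.val_add, ZMod.val_one_eq_one_mod, Nat.add_mod_mod, hmod]
    simp only [Measure.map_smul, hB.measure_map hS]
    rw [hval, pow_succ', Equiv.Perm.mul_apply]
  · have hcancel : (k : ℝ≥0∞) • ENNReal.ofReal (k : ℝ)⁻¹ • m ((τ ^ j.val) a) =
        m ((τ ^ j.val) a) := by
      rw [smul_smul, ENNReal.ofReal_inv_of_pos (by exact_mod_cast hpos), ENNReal.ofReal_natCast,
        ENNReal.mul_inv_cancel (by exact_mod_cast hpos.ne') (ENNReal.natCast_ne_top k), one_smul]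
    rw [hcancel]
    exact ⟨hB.prob _, exponentiallyMixing hB hS hP h1 hpos (by rw [hone]; rfl)⟩

end CyclicDecomposition

end PhysicalMeasures

open PhysicalMeasures in
theorem theoremB1 {d : ℕ} {X : Type*} [TopologicalSpace X] [T2Space X]
    [SecondCountableTopology X] [ChartedSpace (EuclideanSpace ℝ (Fin d)) X]
    [IsManifold 𝓘(ℝ, EuclideanSpace ℝ (Fin d)) ∞ X] [MeasurableSpace X] [BorelSpace X]
    (Leb : Measure X) (hLeb : PhysicalMeasures.IsSmoothMeasure d Leb)
    (X₀ : Set X) (hX₀ : IsCompact X₀) (hpos : 0 < Leb X₀)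
    (ν : Measure X₀) (hν : ν = Leb.comap Subtype.val)
    (T : X₀ → X₀) (hT : Measure.QuasiMeasurePreserving T ν ν)
    {H : Type*} [NormedAddCommGroup H] [NormedSpace ℂ H] [CompleteSpace H]
    (D : PhysicalMeasures.DistributionSpace d X₀ H)
    (𝒦 : PhysicalMeasures.ChartCover d X₀) (α : ℝ) (hα : 0 < α)
    (h1 : D.CAlphaMultipliers ν 𝒦 α)
    (h2 : Dense {u : H | ∃ φ, D.IsBddFun ν u φ})
    (𝓛 : H →L[ℂ] H) (h3 : D.IsTransferExtension ν T 𝓛)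
    (h3' : PhysicalMeasures.essentialSpectralRadius 𝓛 < 1)
    (h4 : ∃ (u₀ : H) (f₀ : X₀ → ℝ) (N₀ : ℕ), 0 < N₀ ∧ (∀ x, f₀ x ∈ Icc (0 : ℝ) 1) ∧
      D.IsBddFun ν u₀ (fun x => (f₀ x : ℂ)) ∧
      ∀ φ : X₀ → ℂ, MemLp φ ∞ ν →
        ∀ᵐ x ∂ν, (PhysicalMeasures.transfer T ν)^[N₀] φ x ≠ 0 → f₀ x = 1)
    (h5 : D.NoMassOnDiscontinuities ν T) :
    ∃ (l : ℕ) (μ : Fin l → Measure X₀) (A : Fin l → Set X₀),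
      (∀ i, IsProbabilityMeasure (μ i) ∧ Ergodic T (μ i)) ∧
      (∀ i, MeasurableSet (A i)) ∧ Pairwise (Function.onFun Disjoint A) ∧
      (∀ i, μ i (A i) = 1) ∧ (∀ i, 0 < ν (A i)) ∧ ν (⋃ i, A i)ᶜ = 0 ∧
      (∀ i, ∀ x ∈ A i, ∀ f ∈ closure {h : C(X₀, ℂ) | ∃ u : H, D.IsFun ν u h},
        Tendsto (fun n : ℕ => (n : ℂ)⁻¹ * ∑ j ∈ Finset.range n, f (T^[j] x)) atTop
          (𝓝 (∫ y, f y ∂(μ i)))) ∧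
      ∀ i, ∃ (k : ℕ) (_ : NeZero k) (m : ZMod k → Measure X₀),
        μ i = ∑ j, m j ∧ (∀ j, (m j).map T = m (j + 1)) ∧
        ∀ j, IsProbabilityMeasure ((k : ℝ≥0∞) • m j) ∧
          PhysicalMeasures.ExponentiallyMixing 𝒦 α T^[k] ((k : ℝ≥0∞) • m j) := by
  have hcompact : CompactSpace X₀ := isCompact_iff_compactSpace.1 hX₀
  have hfin : IsFiniteMeasure ν := by
    have := hLeb.isLocallyFiniteMeasure
    refine ⟨?_⟩
    rw [hν, (MeasurableEmbedding.subtype_coe hX₀.isClosed.measurableSet).comap_apply,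
      image_univ, Subtype.range_coe]
    exact hX₀.measure_lt_top
  obtain ⟨u₀, f₀, N₀, -, hf₀, hu₀, h4⟩ := h4
  obtain ⟨P, C, δ, φ, hQ⟩ :=
    D.exists_isQuasicompactSystem hfin hT h1 h2 h3 h3' h5 hf₀ hu₀ h4
  have hS := hQ.toIsTransferSystem
  have hP := hQ.toIsPeripheralProjection
  obtain ⟨w, μ₀, c, hR⟩ := hQ.exists_isPeripheralSystem
  obtain ⟨n, m, v, τ, hB⟩ := hR.exists_isMixingBasis
  obtain ⟨Q, B, l, a, w', hE⟩ := hB.exists_isErgodicBasis hS hP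
  have hprob := hE.prob
  exact ⟨l, _, fun i => basin T _, fun i => ⟨hE.prob i, hE.ergodic i⟩,
    fun i => measurableSet_basin hT.measurable,
    fun i j hij => disjoint_basin (hE.measure_injective.ne hij), hE.measure_basin_self hS,
    fun i => pos_iff_ne_zero.2 (hE.reference_basin_ne_zero hS i), hE.reference_compl_basin hQ,
    fun i x hx f _ => tendsto_average_of_mem_basin hx f,
    fun i => exists_cyclic_decomposition hB hS hP h1 (a i)⟩
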